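/- Fix $0<t<2$. Let $\varepsilon$ be a function assigning to each closed ball $B(x,r)\subset\mathbb C$ ($r>0$) a number $\varepsilon(x,r)\in[0,\infty)$, and put $h(x,r)=r^t\varepsilon(x,r)$. Assume that $\varepsilon\in\mathcal G_1\cap\mathcal G_2(t)$, that is, there are constants $C_1,C_2>0$ such that $$C_1^{-1}\varepsilon(x,r)\le\varepsilon(y,s)\le C_1\,\varepsilon(x,r)\quad\text{whenever } |x-y|\le 2r,\ r/2\le s\le 2r,$$ $$\sum_{k\ge0}2^{-k(2-t)}\varepsilon(x,2^kr)\le C_2\,\varepsilon(x,r)\quad\text{for all }x\in\mathbb C,\ r>0.$$ For a bounded set $A$ let $h(A)$ be the infimum of $h(B)$ over the closed balls $B$ of minimal diameter containing $A$. Let $\mathcal P$ be a finite family of dyadic squares such that $3P\cap3P'=\varnothing$ for distinct $P,P'\in\mathcal P$, and such that $$\sum_{P\in\mathcal P:\,P\subset Q}h(P)\le C_{pack}\,h(Q)\quad\text{for every dyadic square }Q.$$ Put $\overline P=\bigcup_{P\in\mathcal P}P$ and $\omega=\sum_{P\in\mathcal P}\frac{h(P)}{\ell(P)^2}\chi_P$,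 where $\ell(P)$ is the side length of $P$; we also write $\omega$ for the measure $\omega\,dm$, where $m$ is planar Lebesgue measure. Let $$\mathcal S_\delta f(z)=-\frac1\pi\int_{|z-\xi|>\delta}\frac{f(\xi)}{(z-\xi)^2}\,dm(\xi),\qquad \mathcal S f(z)=\lim_{\delta\to0^+}\mathcal S_\delta f(z),\qquad \mathcal S_*f(z)=\sup_{\delta>0}|\mathcal S_\delta f(z)|.$$ Then: (a) for each $1<p<\infty$ there is a constant $C$ depending only on $p,t,C_1,C_2,C_{pack}$ such that, for all $f\in L^p(\omega)$, the limit $\mathcal S(f\chi_{\overline P})(z)$ exists for $\omega$-almost every $z$ and $$\|\mathcal S(f\chi_{\overline P})\|_{L^p(\omega)}\le C\|f\|_{L^p(\omega)},\qquad \|\mathcal S_*(f\chi_{\overline P})\|_{L^p(\omega)}\le C\|f\|_{L^p(\omega)};$$ (b) there is a constant $C$ depending only on $t,C_1,C_2,C_{pack}$ such that, for all $f\in L^1(\omega)$, the limit $\mathcal S(f\chi_{\overline P})(z)$ exists for $\omega$-almost every $z$ and $$\|\mathcal S(f\chi_{\overline P})\|_{L^{1,\infty}(\omega)}\le C\|f\|_{L^1(\omega)},\qquad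 \|\mathcal S_*(f\chi_{\overline P})\|_{L^{1,\infty}(\omega)}\le C\|f\|_{L^1(\omega)},$$ where $\|g\|_{L^{1,\infty}(\omega)}=\sup_{\lambda>0}\lambda\,\omega(\{|g|>\lambda\})$. -/

import Mathlib

open MeasureTheory Filter Topology
open scoped NNReal ENNReal

noncomputable section

namespace BeurlingWeight

/-- The gauge function `h(x,r) = r^t ε(x,r)` attached to a function `ε` of closed balls; the ball
with centre `x` and radius `r > 0` is encoded by the pair `(x, r)`, and the values of `ε` at
`r ≤ 0` play no role. -/
def gauge (t : ℝ) (ε : ℂ → ℝ → ℝ≥0) (x : ℂ) (r : ℝ) : ℝ := r ^ t * (ε x r : ℝ)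

/-- `ε` belongs to the class `𝒢₁`, with constant `C`. -/
def MemG1 (C : ℝ) (ε : ℂ → ℝ → ℝ≥0) : Prop :=
  0 < C ∧ ∀ (x y : ℂ) (r s : ℝ), 0 < r → ‖x - y‖ ≤ 2 * r → r / 2 ≤ s → s ≤ 2 * r →
    C⁻¹ * (ε x r : ℝ) ≤ ε y s ∧ (ε y s : ℝ) ≤ C * ε x r

/-- `ε` belongs to the class `𝒢₂(t)`, with constant `C`:
`∑_{k ≥ 0} 2^{-k(2-t)} ε(x, 2^k r) ≤ C ε(x, r)` for all `x` and all `r > 0`. -/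
def MemG2 (t C : ℝ) (ε : ℂ → ℝ → ℝ≥0) : Prop :=
  0 < C ∧ ∀ (x : ℂ) (r : ℝ), 0 < r →
    Summable (fun k : ℕ => (2 : ℝ) ^ (-((k : ℝ) * (2 - t))) * (ε x (2 ^ k * r) : ℝ)) ∧
    ∑' k : ℕ, (2 : ℝ) ^ (-((k : ℝ) * (2 - t))) * (ε x (2 ^ k * r) : ℝ) ≤ C * ε x r

/-- The ball with centre `x` and radius `r` is a closed ball of minimal diameter among those
containing `A`. -/
def IsMinimalBall (A : Set ℂ) (x : ℂ) (r : ℝ) : Prop :=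
  A ⊆ Metric.closedBall x r ∧ ∀ (y : ℂ) (s : ℝ), A ⊆ Metric.closedBall y s → r ≤ s

/-- A gauge `h` is evaluated on a bounded set `A` as the infimum of `h(B)` over the closed balls
`B` of minimal diameter containing `A`. -/
def gaugeOfSet (h : ℂ → ℝ → ℝ) (A : Set ℂ) : ℝ :=
  sInf {v : ℝ | ∃ (x : ℂ) (r : ℝ), IsMinimalBall A x r ∧ v = h x r}

/-- The dyadic square `[m 2^k, (m+1) 2^k) × [n 2^k, (n+1) 2^k)`, with `k, m, n` integers. -/
structure DyadicSquare where
  /-- the exponent of the side length -/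
  k : ℤ
  /-- the horizontal position -/
  m : ℤ
  /-- the vertical position -/
  n : ℤ

namespace DyadicSquare

/-- The side length `ℓ(P)`. -/
def side (P : DyadicSquare) : ℝ := (2 : ℝ) ^ P.k

/-- The lower left corner of `P`. -/
def corner (P : DyadicSquare) : ℂ := ⟨P.m * P.side, P.n * P.side⟩

/-- The set of points of `P`. -/
def toSet (P : DyadicSquare) : Set ℂ :=
  Set.Ico P.corner.re (P.corner.re + P.side) ×ℂ Set.Ico P.corner.im (P.corner.im + P.side)

/-- The triple `3P`: the square with the same centre and three times the side length. -/
def triple (P : DyadicSquare) : Set ℂ :=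
  Set.Ico (P.corner.re - P.side) (P.corner.re + 2 * P.side) ×ℂ
    Set.Ico (P.corner.im - P.side) (P.corner.im + 2 * P.side)

/-- The centre of `P`. -/
def center (P : DyadicSquare) : ℂ :=
  ⟨P.corner.re + P.side / 2, P.corner.im + P.side / 2⟩

theorem side_pos (P : DyadicSquare) : 0 < P.side := by
  unfold side; positivity

end DyadicSquare

/-- The value `h(P)` of the gauge `h(x,r) = r^t ε(x,r)` on a dyadic square. -/
def hval (t : ℝ) (ε : ℂ → ℝ → ℝ≥0) (P : DyadicSquare) : ℝ :=
  gaugeOfSet (gauge t ε) P.toSet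

/-- The squares of the family have pairwise disjoint triples. -/
def DisjointTriples (F : Finset DyadicSquare) : Prop :=
  ∀ P ∈ F, ∀ Q ∈ F, P ≠ Q → Disjoint P.triple Q.triple

open Classical in
/-- The `h`-packing condition, with constant `C`. -/
def Packing (t : ℝ) (ε : ℂ → ℝ → ℝ≥0) (C : ℝ) (F : Finset DyadicSquare) : Prop :=
  ∀ Q : DyadicSquare, ∑ P ∈ F with P.toSet ⊆ Q.toSet, hval t ε P ≤ C * hval t ε Q

/-- The union of the squares of the family. -/
def unionSet (F : Finset DyadicSquare) : Set ℂ := ⋃ P ∈ F, P.toSet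

/-- The weight `∑_P h(P) / ℓ(P)^2 χ_P`. -/
def weight (t : ℝ) (ε : ℂ → ℝ → ℝ≥0) (F : Finset DyadicSquare) (z : ℂ) : ℝ :=
  ∑ P ∈ F, P.toSet.indicator (fun _ => hval t ε P / P.side ^ 2) z

/-- The measure whose density with respect to planar Lebesgue measure is the weight. -/
def weightMeasure (t : ℝ) (ε : ℂ → ℝ → ℝ≥0) (F : Finset DyadicSquare) : Measure ℂ :=
  (volume : Measure ℂ).withDensity (fun z => ENNReal.ofReal (weight t ε F z))

/-- The `δ`-truncated Beurling transform. -/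
def truncBeurling (δ : ℝ) (f : ℂ → ℂ) (z : ℂ) : ℂ :=
  (-1 / (Real.pi : ℂ)) * ∫ ξ in {ξ : ℂ | δ < ‖z - ξ‖}, f ξ / (z - ξ) ^ 2

/-- The Beurling transform: the principal value `lim_{δ → 0+}` of the truncated transforms (an
unspecified value where the limit does not exist). -/
def beurling (f : ℂ → ℂ) (z : ℂ) : ℂ :=
  limUnder (𝓝[>] (0 : ℝ)) (fun δ => truncBeurling δ f z)

/-- The principal value defining the Beurling transform of `f` converges at `z`. -/
def BeurlingConverges (f : ℂ → ℂ) (z : ℂ) : Prop :=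
  Tendsto (fun δ => truncBeurling δ f z) (𝓝[>] (0 : ℝ)) (𝓝 (beurling f z))

/-- The maximal Beurling transform `sup_{δ > 0} |S_δ f(z)|`, with values in `[0, ∞]`. -/
def maxBeurling (f : ℂ → ℂ) (z : ℂ) : ℝ≥0∞ :=
  ⨆ (δ : ℝ) (_ : 0 < δ), ‖truncBeurling δ f z‖ₑ

/-- The `L^{1,∞}(μ)` quasinorm `sup_{s > 0} s μ{|g| > s}`. -/
def weakL1Norm {E : Type*} [ENorm E] (g : ℂ → E) (μ : Measure ℂ) : ℝ≥0∞ :=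
  ⨆ s : ℝ≥0, (s : ℝ≥0∞) * μ {z | (s : ℝ≥0∞) < ‖g z‖ₑ}

/-- The only closed ball of minimal diameter containing a dyadic square is the circumscribed
one. -/
theorem isMinimalBall_dyadic (P : DyadicSquare) (x : ℂ) (r : ℝ) :
    IsMinimalBall P.toSet x r ↔ x = P.center ∧ r = P.side / Real.sqrt 2 := by
  have hl := P.side_pos
  have hne : P.side ≠ 0 := hl.ne'
  have h2 : (0 : ℝ) < Real.sqrt 2 := by positivity
  have hs2 : Real.sqrt 2 ^ 2 = 2 := Real.sq_sqrt (by norm_num)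
  have hr0 : 0 < P.side / Real.sqrt 2 := by positivity
  have hrsq : (P.side / Real.sqrt 2) ^ 2 = P.side ^ 2 / 2 := by rw [div_pow, hs2]
  have mem (y z : ℂ) (s : ℝ) (h : z ∈ Metric.closedBall y s) :
      0 ≤ s ∧ (z.re - y.re) ^ 2 + (z.im - y.im) ^ 2 ≤ s ^ 2 := by
    rw [Metric.mem_closedBall, dist_eq_norm] at h
    have h0 := norm_nonneg (z - y)
    refine ⟨h0.trans h, ?_⟩
    have := pow_le_pow_left₀ h0 h 2
    rw [Complex.sq_norm, Complex.normSq_apply] at this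
    simp only [Complex.sub_re, Complex.sub_im] at this
    nlinarith
  have corners (y : ℂ) (s : ℝ) (h : P.toSet ⊆ Metric.closedBall y s) :
      0 ≤ s ∧ P.side ^ 2 / 2 + 2 * ((P.center.re - y.re) ^ 2 + (P.center.im - y.im) ^ 2)
        ≤ s ^ 2 + ((P.center.re - y.re) ^ 2 + (P.center.im - y.im) ^ 2) := by
    have hc : closure P.toSet ⊆ Metric.closedBall y s :=
      closure_minimal h Metric.isClosed_closedBall
    rw [DyadicSquare.toSet, Complex.closure_reProdIm, closure_Ico (by linarith),
      closure_Ico (by linarith)] at hc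
    have key (a b : ℝ) (ha : a = 0 ∨ a = P.side) (hb : b = 0 ∨ b = P.side) :=
      mem y ⟨P.corner.re + a, P.corner.im + b⟩ s (hc (by
        rw [Complex.mem_reProdIm]
        rcases ha with rfl | rfl <;> rcases hb with rfl | rfl <;>
          simp [hl.le]))
    have k1 := key 0 0 (by simp) (by simp)
    have k2 := key P.side 0 (by simp) (by simp)
    have k3 := key 0 P.side (by simp) (by simp)
    have k4 := key P.side P.side (by simp) (by simp)
    refine ⟨k1.1, ?_⟩
    have e1 := k1.2
    have e2 := k2.2
    have e3 := k3.2
    have e4 := k4.2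
    simp only [DyadicSquare.center]
    nlinarith
  have circ : P.toSet ⊆ Metric.closedBall P.center (P.side / Real.sqrt 2) := by
    intro z hz
    rw [DyadicSquare.toSet, Complex.mem_reProdIm] at hz
    obtain ⟨⟨a1, a2⟩, b1, b2⟩ := hz
    rw [Metric.mem_closedBall, dist_eq_norm]
    refine (sq_le_sq₀ (norm_nonneg _) hr0.le).1 ?_
    rw [hrsq, Complex.sq_norm, Complex.normSq_apply]
    simp only [Complex.sub_re, Complex.sub_im, DyadicSquare.center]
    nlinarith
  have lower (y : ℂ) (s : ℝ) (h : P.toSet ⊆ Metric.closedBall y s) :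
      P.side / Real.sqrt 2 ≤ s := by
    obtain ⟨h0, h1⟩ := corners y s h
    refine (sq_le_sq₀ hr0.le h0).1 ?_
    rw [hrsq]
    nlinarith [sq_nonneg (P.center.re - y.re), sq_nonneg (P.center.im - y.im)]
  constructor
  · rintro ⟨h1, h2'⟩
    have hr : r = P.side / Real.sqrt 2 := le_antisymm (h2' _ _ circ) (lower _ _ h1)
    refine ⟨?_, hr⟩
    have h3 := (corners x r h1).2
    rw [hr, hrsq] at h3
    have u := sq_nonneg (P.center.re - x.re)
    have v := sq_nonneg (P.center.im - x.im)
    have u0 : (P.center.re - x.re) ^ 2 = 0 := by linarith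
    have v0 : (P.center.im - x.im) ^ 2 = 0 := by linarith
    have u1 := pow_eq_zero_iff (two_ne_zero) |>.1 u0
    have v1 := pow_eq_zero_iff (two_ne_zero) |>.1 v0
    apply Complex.ext <;> linarith
  · rintro ⟨rfl, rfl⟩
    exact ⟨circ, lower⟩

/-- The value of a gauge on a dyadic square is its value on the circumscribed ball. -/
theorem hval_eq (t : ℝ) (ε : ℂ → ℝ → ℝ≥0) (P : DyadicSquare) :
    hval t ε P = gauge t ε P.center (P.side / Real.sqrt 2) := by
  have : {v : ℝ | ∃ (x : ℂ) (r : ℝ), IsMinimalBall P.toSet x r ∧ v = gauge t ε x r}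
      = {gauge t ε P.center (P.side / Real.sqrt 2)} := by
    ext v
    simp [isMinimalBall_dyadic, and_assoc]
  rw [hval, gaugeOfSet, this, csInf_singleton]

end BeurlingWeight

end

/-! The weight is constant on each square, and distinct squares are far apart relative to their
sizes. For `z` in a square `P` of the family, the transform of `f` restricted to the union is split
into the contribution of `P` itself and that of the other squares. On `P` the weight is a constant,
so the first part is governed by the unweighted bounds for the maximal Beurling transform, summed
over the squares. The second part is dominated by a positive operator `farOp` with kernel `|z -
y|⁻²` restricted to pairs in different squares.

The positive operator is treated by duality. Let `y` lie in `P`, of side `ℓ`. Disjointness of the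
triples keeps the other squares at distance at least `ℓ` from `y`, so the transposed operator
applied to `g ω` is at most a sum over `k` of `(2^k ℓ)⁻²` times the `ω`-integral of `g` over the
ball of radius `2^(k+1) ℓ` about `y`. Such a ball meets only squares of the family lying in nine
dyadic squares of side `2^(k+1) ℓ`, so packing and the class `𝒢₁` bound its mass by a multiple of
`(2^k ℓ)^t ε(y, 2^k ℓ)`. After division by `(2^k ℓ)^2` these are the terms of the `𝒢₂(t)` series,
whose sum is controlled by `ε(y, ℓ) ℓ^(t-2)`, that is, by the weight at `y`
(`tsum_weightMeasure_closedBall_le`). Hence the transposed operator is at most a constant times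
`ω(y)` times the centred maximal function of `g` with respect to `ω`. The Besicovitch theorem bounds
the latter on `L^q(ω)` with no doubling assumption; duality gives `L^p(ω)`
(`lintegral_farOp_rpow_le`), and the choice `g = 1` gives `L^1(ω)` (`lintegral_farOp_le`).

The unweighted theory uses no Fourier transform. The function `conj z / (|z|² + δ²)` has
`∂`-derivative minus the regularised Beurling kernel, and `∂̄`-derivative an approximate identity.
Since Jacobian determinants of decaying maps have zero integral, these two kernels have the same
autocorrelation, which gives `L²` bounds uniform in `δ`; and the parameters in the convolution of
one kernel with the other may be exchanged, which is an exact form of Cotlar's inequality and gives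
the maximal `L²` bound (`lintegral_regMax_sq_le`). A Calderón–Zygmund decomposition yields weak type
(1,1) (`regMax_weak`), and a good-λ inequality yields all `p > 1` at once (`good_lambda`,
`regMax_strong`). Truncated and regularised kernels differ by a multiple of the Hardy–Littlewood
maximal function, and principal values exist almost everywhere by density of smooth functions. -/

namespace BeurlingWeight

/-! ### Layer cake formulas -/

/-- The density `q s^{q-1}` of the layer cake formula. -/
noncomputable def powDens (q s : ℝ) : ℝ≥0∞ := ENNReal.ofReal (q * s ^ (q - 1))

@[fun_prop]
theorem measurable_powDens (q : ℝ) : Measurable (powDens q) := by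
  unfold powDens; fun_prop

theorem lintegral_powDens_Ioc {q : ℝ} (hq : 0 < q) {a : ℝ} (ha : 0 ≤ a) :
    ∫⁻ s in Set.Ioc 0 a, powDens q s = ENNReal.ofReal (a ^ q) := by
  have hi : IntervalIntegrable (fun s : ℝ => q * s ^ (q - 1)) volume 0 a :=
    (intervalIntegral.intervalIntegrable_rpow' (by linarith)).const_mul q
  have : ∫ s in (0 : ℝ)..a, q * s ^ (q - 1) = a ^ q := by
    rw [intervalIntegral.integral_const_mul, integral_rpow (Or.inl (by linarith))]
    simp only [sub_add_cancel]
    rw [Real.zero_rpow hq.ne']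
    field_simp
    ring
  rw [← this, intervalIntegral.integral_of_le ha, ofReal_integral_eq_lintegral_ofReal]
  · rfl
  · exact hi.1
  · refine (ae_restrict_iff' measurableSet_Ioc).2 (ae_of_all _ fun s hs => ?_)
    have := hs.1
    simp only [Pi.zero_apply]
    positivity

theorem rpow_eq_lintegral_powDens {q : ℝ} (hq : 0 < q) (a : ℝ≥0∞) :
    a ^ q = ∫⁻ s in Set.Ioi (0 : ℝ), Set.indicator {s | ENNReal.ofReal s < a} (powDens q) s := by
  have hm : MeasurableSet {s : ℝ | ENNReal.ofReal s < a} :=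
    measurableSet_lt ENNReal.measurable_ofReal measurable_const
  rw [lintegral_indicator hm, Measure.restrict_restrict hm]
  induction a with
  | top =>
    rw [ENNReal.top_rpow_of_pos hq]
    symm
    -- The density has infinite total mass: the interval `(0, r^(1/q)]` alone carries mass `r`.
    refine ENNReal.eq_top_of_forall_nnreal_le fun r => ?_
    have h0 : (0 : ℝ) ≤ (r : ℝ) ^ q⁻¹ := by positivity
    have := lintegral_powDens_Ioc hq h0
    rw [← Real.rpow_mul r.coe_nonneg, inv_mul_cancel₀ hq.ne', Real.rpow_one,
      ENNReal.ofReal_coe_nnreal] at this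
    rw [← this]
    exact lintegral_mono_set fun s hs => ⟨by simp, hs.1⟩
  | coe a =>
    have := lintegral_powDens_Ioc hq a.coe_nonneg
    rw [← ENNReal.ofReal_rpow_of_nonneg a.coe_nonneg hq.le, ENNReal.ofReal_coe_nnreal] at this
    rw [← this, ← Measure.restrict_congr_set Ioo_ae_eq_Ioc]
    congr 2
    ext s
    simp only [Set.mem_Ioo, Set.mem_inter_iff, Set.mem_ofPred_eq, Set.mem_Ioi]
    constructor
    · rintro ⟨h, h'⟩
      refine ⟨?_, h⟩
      rw [← ENNReal.ofReal_coe_nnreal]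
      exact (ENNReal.ofReal_lt_ofReal_iff (h.trans h')).2 h'
    · rintro ⟨h, h'⟩
      refine ⟨h', ?_⟩
      rw [← ENNReal.ofReal_coe_nnreal] at h
      exact (ENNReal.ofReal_lt_ofReal_iff_of_nonneg (le_of_lt h')).1 h

theorem measurableSet_ofReal_lt {α : Type*} [MeasurableSpace α] {G : α → ℝ≥0∞}
    (hG : Measurable G) : MeasurableSet {z : ℝ × α | ENNReal.ofReal z.1 < G z.2} :=
  measurableSet_lt (ENNReal.measurable_ofReal.comp measurable_fst) (hG.comp measurable_snd)

/-- A layer cake formula with an extra weight `w`. -/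
theorem lintegral_mul_rpow_eq {α : Type*} [MeasurableSpace α] (μ : Measure α) [SFinite μ]
    {q : ℝ} (hq : 0 < q) {G w : α → ℝ≥0∞} (hG : Measurable G) (hw : Measurable w) :
    ∫⁻ x, w x * G x ^ q ∂μ
      = ∫⁻ s in Set.Ioi (0 : ℝ), powDens q s * ∫⁻ x in {x | ENNReal.ofReal s < G x}, w x ∂μ := by
  have h1 : ∀ x, w x * G x ^ q = ∫⁻ s in Set.Ioi (0 : ℝ),
      Set.indicator {z : ℝ × α | ENNReal.ofReal z.1 < G z.2} (fun z => powDens q z.1 * w z.2)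
        (s, x) := by
    intro x
    rw [rpow_eq_lintegral_powDens hq, ← lintegral_const_mul]
    · refine lintegral_congr fun s => ?_
      simp only [Set.indicator_apply, Set.mem_ofPred_eq]
      split_ifs <;> simp [mul_comm]
    · exact (measurable_powDens q).indicator
        (measurableSet_lt ENNReal.measurable_ofReal measurable_const)
  simp_rw [h1]
  rw [lintegral_lintegral_swap]
  · refine lintegral_congr fun s => ?_
    have hs : MeasurableSet {x | ENNReal.ofReal s < G x} := measurableSet_lt measurable_const hG
    rw [← lintegral_const_mul _ hw, ← lintegral_indicator hs]
    refine lintegral_congr fun x => ?_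
    simp [Set.indicator_apply]
  · refine Measurable.aemeasurable ?_
    have := ((((measurable_powDens q).comp measurable_fst).mul
      (hw.comp measurable_snd)).indicator (measurableSet_ofReal_lt hG))
    exact this.comp measurable_swap

theorem lintegral_rpow_eq {α : Type*} [MeasurableSpace α] (μ : Measure α) [SFinite μ]
    {q : ℝ} (hq : 0 < q) {G : α → ℝ≥0∞} (hG : Measurable G) :
    ∫⁻ x, G x ^ q ∂μ
      = ∫⁻ s in Set.Ioi (0 : ℝ), powDens q s * μ {x | ENNReal.ofReal s < G x} := by
  simpa using lintegral_mul_rpow_eq μ hq hG (measurable_const (a := (1 : ℝ≥0∞)))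

/-- Splitting off one factor `s` lets a weak type bound on `s μ{G > s}` be inserted into the layer
cake integral. -/
theorem powDens_eq {q : ℝ} (hq : 1 < q) {s : ℝ} (hs : 0 < s) :
    powDens q s = ENNReal.ofReal (q / (q - 1)) * ENNReal.ofReal s * powDens (q - 1) s := by
  have : 0 < q - 1 := by linarith
  rw [powDens, powDens, ← ENNReal.ofReal_mul (by positivity), ← ENNReal.ofReal_mul (by positivity)]
  congr 1
  rw [show q - 1 = (q - 1 - 1) + 1 by ring, Real.rpow_add_one hs.ne']
  simp only [sub_add_cancel]
  field_simp

/-- A weak type inequality with the restriction to the upper level sets gives the strong type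
inequality. -/
theorem lintegral_rpow_le_of_weak {α : Type*} [MeasurableSpace α] (μ : Measure α) [SFinite μ]
    {q : ℝ} (hq : 1 < q) {G g : α → ℝ≥0∞} (hG : Measurable G) (hg : Measurable g) {N : ℝ≥0∞}
    (hN : N ≠ ∞) (h : ∀ s : ℝ, 0 < s → ENNReal.ofReal s * μ {x | ENNReal.ofReal s < G x}
      ≤ N * ∫⁻ x in {x | ENNReal.ofReal s < 2 * g x}, g x ∂μ) :
    ∫⁻ x, G x ^ q ∂μ ≤ ENNReal.ofReal (q / (q - 1)) * N * 2 ^ (q - 1) * ∫⁻ x, g x ^ q ∂μ := by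
  rw [lintegral_rpow_eq μ (by linarith) hG]
  calc ∫⁻ s in Set.Ioi (0 : ℝ), powDens q s * μ {x | ENNReal.ofReal s < G x}
      ≤ ∫⁻ s in Set.Ioi (0 : ℝ), (ENNReal.ofReal (q / (q - 1)) * N) *
        (powDens (q - 1) s * ∫⁻ x in {x | ENNReal.ofReal s < 2 * g x}, g x ∂μ) := by
        refine setLIntegral_mono_ae' measurableSet_Ioi (ae_of_all _ fun s hs => ?_)
        rw [powDens_eq hq hs]
        calc _ = ENNReal.ofReal (q / (q - 1)) * powDens (q - 1) s *
              (ENNReal.ofReal s * μ {x | ENNReal.ofReal s < G x}) := by ring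
          _ ≤ ENNReal.ofReal (q / (q - 1)) * powDens (q - 1) s *
              (N * ∫⁻ x in {x | ENNReal.ofReal s < 2 * g x}, g x ∂μ) := by
              exact mul_le_mul_right (h s hs) _
          _ = _ := by ring
    -- The weighted layer cake formula read backwards, with weight `g`, height `2 g` and exponent `q
    -- - 1`.
    _ = ENNReal.ofReal (q / (q - 1)) * N * ∫⁻ x, g x * (2 * g x) ^ (q - 1) ∂μ := by
        rw [lintegral_mul_rpow_eq μ (by linarith) (hg.const_mul 2) hg, lintegral_const_mul']
        exact ENNReal.mul_ne_top ENNReal.ofReal_ne_top hN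
    _ = _ := by
        rw [mul_assoc _ (2 ^ (q - 1)), ← lintegral_const_mul _ (hg.pow_const q)]
        congr 1
        refine lintegral_congr fun x => ?_
        rw [ENNReal.mul_rpow_of_nonneg _ _ (by linarith), mul_left_comm]
        congr 1
        nth_rw 1 [← ENNReal.rpow_one (g x)]
        rw [← ENNReal.rpow_add_of_nonneg _ _ (by norm_num) (by linarith)]
        congr 1
        ring

/-! ### The Besicovitch covering theorem and maximal functions -/

/-- The weak type estimate for centred maximal functions with respect to arbitrary measures. -/
theorem exists_besicovitch_weak : ∃ N : ℕ, ∀ (μ : Measure ℂ) (g : ℂ → ℝ≥0∞) (a : ℝ≥0∞) (s : Set ℂ),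
    (∀ x ∈ s, ∃ r : ℝ, 0 < r ∧ a * μ (Metric.closedBall x r) ≤ ∫⁻ y in Metric.closedBall x r, g y ∂μ) →
      a * μ s ≤ N * ∫⁻ y, g y ∂μ := by
  obtain ⟨N, τ, hτ, hN⟩ := HasBesicovitchCovering.no_satelliteConfig (α := ℂ)
  refine ⟨N, fun μ g a s h => ?_⟩
  have h' : ∀ x : s, ∃ r : ℝ, 0 < r ∧
      a * μ (Metric.closedBall x r) ≤ ∫⁻ y in Metric.closedBall (x : ℂ) r, g y ∂μ :=
    fun x => h x x.2
  choose r hr0 hr using h'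
  -- The covering theorem needs bounded radii, so `s` is exhausted by the points of radius at most
  -- `n`. Continuity from below along a monotone sequence of sets requires no measurability.
  let S : ℕ → Set ℂ := fun n => {x | ∃ hx : x ∈ s, r ⟨x, hx⟩ ≤ n}
  have hS : s = ⋃ n, S n := by
    ext x
    simp only [S, Set.mem_iUnion, Set.mem_ofPred_eq]
    constructor
    · intro hx
      obtain ⟨n, hn⟩ := exists_nat_ge (r ⟨x, hx⟩)
      exact ⟨n, hx, hn⟩
    · rintro ⟨_, hx, _⟩
      exact hx
  have hmono : Monotone S := by
    intro m n hmn x ⟨hx, hle⟩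
    exact ⟨hx, hle.trans (by exact_mod_cast hmn)⟩
  have hn : ∀ n, a * μ (S n) ≤ N * ∫⁻ y, g y ∂μ := by
    intro n
    let q : Besicovitch.BallPackage {x : s // r x ≤ n} ℂ :=
      { c := fun x => x.1, r := fun x => r x.1, rpos := fun x => hr0 x.1, r_bound := n,
        r_le := fun x => x.2 }
    obtain ⟨u, hu, hcov⟩ := Besicovitch.exist_disjoint_covering_families hτ hN q
    have hcount : ∀ i, (u i).Countable := fun i =>
      (hu i).countable_of_nonempty_interior fun j _ =>
        ⟨q.c j, mem_interior.2 ⟨Metric.ball (q.c j) (q.r j), Metric.ball_subset_closedBall,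
          Metric.isOpen_ball, Metric.mem_ball_self (q.rpos j)⟩⟩
    have hsub : S n ⊆ ⋃ i : Fin N, ⋃ j ∈ u i, Metric.closedBall (q.c j) (q.r j) := by
      intro x ⟨hx, hle⟩
      have := hcov ⟨⟨⟨x, hx⟩, hle⟩, rfl⟩
      simp only [Set.mem_iUnion] at this ⊢
      obtain ⟨i, j, hj, hxj⟩ := this
      exact ⟨i, j, hj, Metric.ball_subset_closedBall hxj⟩
    calc a * μ (S n) ≤ a * ∑ i : Fin N, μ (⋃ j ∈ u i, Metric.closedBall (q.c j) (q.r j)) := by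
          gcongr
          refine (measure_mono hsub).trans ((measure_iUnion_le _).trans ?_)
          rw [tsum_fintype]
      _ ≤ ∑ i : Fin N, ∫⁻ y, g y ∂μ := by
          rw [Finset.mul_sum]
          refine Finset.sum_le_sum fun i _ => ?_
          calc a * μ (⋃ j ∈ u i, Metric.closedBall (q.c j) (q.r j))
              ≤ a * ∑' j : u i, μ (Metric.closedBall (q.c j) (q.r j)) := by
                gcongr
                exact measure_biUnion_le μ (hcount i) _
            _ ≤ ∑' j : u i, ∫⁻ y in Metric.closedBall (q.c j) (q.r j), g y ∂μ := by
                rw [← ENNReal.tsum_mul_left]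
                exact ENNReal.tsum_le_tsum fun j => hr j.1.1
            _ = ∫⁻ y in ⋃ j ∈ u i, Metric.closedBall (q.c j) (q.r j), g y ∂μ :=
                (lintegral_biUnion (hcount i) (fun j _ => Metric.isClosed_closedBall.measurableSet)
                  (hu i) _).symm
            _ ≤ _ := setLIntegral_le_lintegral _ _
      _ = _ := by simp
  rw [hS, hmono.measure_iUnion, ENNReal.mul_iSup]
  exact iSup_le hn

/-- The number of families in the Besicovitch covering theorem for the plane. -/
noncomputable def besN : ℕ := exists_besicovitch_weak.choose

theorem besicovitch_weak (μ : Measure ℂ) (g : ℂ → ℝ≥0∞) (a : ℝ≥0∞) (s : Set ℂ)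
    (h : ∀ x ∈ s, ∃ r : ℝ, 0 < r ∧
      a * μ (Metric.closedBall x r) ≤ ∫⁻ y in Metric.closedBall x r, g y ∂μ) :
    a * μ s ≤ besN * ∫⁻ y, g y ∂μ :=
  exists_besicovitch_weak.choose_spec μ g a s h

/-- The strong type estimate for functions dominated by a centred maximal function. -/
theorem lintegral_rpow_le_of_centred (μ : Measure ℂ) [SFinite μ]
    (hμ : ∀ x r, μ (Metric.closedBall x r) < ∞) {q : ℝ} (hq : 1 < q) {G g : ℂ → ℝ≥0∞}
    (hG : Measurable G) (hg : Measurable g)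
    (h : ∀ (x : ℂ) (s : ℝ), 0 < s → ENNReal.ofReal s < G x → ∃ r : ℝ, 0 < r ∧
      ENNReal.ofReal s * μ (Metric.closedBall x r) ≤ ∫⁻ y in Metric.closedBall x r, g y ∂μ) :
    ∫⁻ x, G x ^ q ∂μ
      ≤ ENNReal.ofReal (q / (q - 1)) * (2 * besN) * 2 ^ (q - 1) * ∫⁻ x, g x ^ q ∂μ := by
  refine lintegral_rpow_le_of_weak μ hq hG hg (by finiteness) fun s hs => ?_
  have hm : MeasurableSet {x | ENNReal.ofReal s < 2 * g x} :=
    measurableSet_lt measurable_const (hg.const_mul 2)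
  -- The values of `g` below `s / 2` account for at most half of any average exceeding `s`, so only
  -- the upper part of `g` enters, at level `s / 2`. The halves can be cancelled because balls have
  -- finite measure.
  have key := besicovitch_weak μ ({x | ENNReal.ofReal s < 2 * g x}.indicator g)
    (ENNReal.ofReal (s / 2)) {x | ENNReal.ofReal s < G x} ?_
  · rw [lintegral_indicator hm] at key
    have h2 : ENNReal.ofReal s = 2 * ENNReal.ofReal (s / 2) := by
      rw [← ENNReal.ofReal_ofNat 2, ← ENNReal.ofReal_mul (by norm_num)]
      congr 1; ring
    calc _ = 2 * (ENNReal.ofReal (s / 2) * μ {x | ENNReal.ofReal s < G x}) := by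
          nth_rw 1 [h2]; rw [mul_assoc]
      _ ≤ 2 * (besN * ∫⁻ x in {x | ENNReal.ofReal s < 2 * g x}, g x ∂μ) := by gcongr
      _ = _ := by ring
  · intro x hx
    obtain ⟨r, hr, hle⟩ := h x s hs hx
    refine ⟨r, hr, ?_⟩
    have hB := hμ x r
    set B := Metric.closedBall x r
    have h2 : ENNReal.ofReal s = ENNReal.ofReal (s / 2) + ENNReal.ofReal (s / 2) := by
      rw [← ENNReal.ofReal_add (by positivity) (by positivity)]
      congr 1; ring
    have hfin : ENNReal.ofReal (s / 2) * μ B ≠ ∞ := ENNReal.mul_ne_top ENNReal.ofReal_ne_top hB.ne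
    have : ∫⁻ y in B, g y ∂μ ≤ ∫⁻ y in B, {x | ENNReal.ofReal s < 2 * g x}.indicator g y ∂μ
        + ENNReal.ofReal (s / 2) * μ B := by
      rw [← setLIntegral_const, ← lintegral_add_right _ measurable_const]
      refine lintegral_mono fun y => ?_
      simp only [Set.indicator_apply, Set.mem_ofPred_eq]
      split_ifs with hy
      · exact le_self_add
      · rw [zero_add]
        push Not at hy
        rw [ENNReal.ofReal_div_of_pos (by norm_num)]
        rw [ENNReal.le_div_iff_mul_le (by simp) (by simp), mul_comm]
        simpa using hy
    rw [h2, add_mul] at hle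
    exact (ENNReal.add_le_add_iff_right hfin).1 (hle.trans this)

end BeurlingWeight

/-! ### The uncentred Hardy–Littlewood maximal function for Lebesgue measure. -/

namespace BeurlingWeight

/-- The uncentred Hardy–Littlewood maximal function. -/
noncomputable def maxFn (f : ℂ → ℝ≥0∞) (x : ℂ) : ℝ≥0∞ :=
  ⨆ (c : ℂ) (r : ℝ) (_ : x ∈ Metric.ball c r),
    (volume (Metric.ball c r))⁻¹ * ∫⁻ y in Metric.ball c r, f y

theorem lt_maxFn_iff {f : ℂ → ℝ≥0∞} {x : ℂ} {a : ℝ≥0∞} : a < maxFn f x ↔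
    ∃ (c : ℂ) (r : ℝ), x ∈ Metric.ball c r ∧
      a < (volume (Metric.ball c r))⁻¹ * ∫⁻ y in Metric.ball c r, f y := by
  simp only [maxFn, lt_iSup_iff, exists_prop]

/-- A ball that witnesses the inequality at one point witnesses it at all its points; this is the
advantage of uncentred balls, and it holds for arbitrary `f`. -/
theorem isOpen_lt_maxFn (f : ℂ → ℝ≥0∞) (a : ℝ≥0∞) : IsOpen {x | a < maxFn f x} := by
  refine isOpen_iff_forall_mem_open.2 fun x hx => ?_
  obtain ⟨c, r, hxc, h⟩ := lt_maxFn_iff.1 hx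
  exact ⟨Metric.ball c r, fun y hy => lt_maxFn_iff.2 ⟨c, r, hy, h⟩, Metric.isOpen_ball, hxc⟩

theorem measurable_maxFn (f : ℂ → ℝ≥0∞) : Measurable (maxFn f) :=
  measurable_of_Ioi fun a => (isOpen_lt_maxFn f a).measurableSet

theorem volume_ball_ne_zero {c x : ℂ} {r : ℝ} (hx : x ∈ Metric.ball c r) :
    volume (Metric.ball c r) ≠ 0 :=
  (Metric.measure_ball_pos _ _ (Metric.pos_of_mem_ball hx)).ne'

theorem lintegral_ball_le_maxFn (f : ℂ → ℝ≥0∞) {c x : ℂ} {r : ℝ} (hx : x ∈ Metric.ball c r) :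
    ∫⁻ y in Metric.ball c r, f y ≤ volume (Metric.ball c r) * maxFn f x := by
  have h : (volume (Metric.ball c r))⁻¹ * ∫⁻ y in Metric.ball c r, f y ≤ maxFn f x :=
    le_iSup_of_le c (le_iSup_of_le r (le_iSup_of_le hx le_rfl))
  calc _ = volume (Metric.ball c r) *
        ((volume (Metric.ball c r))⁻¹ * ∫⁻ y in Metric.ball c r, f y) := by
        rw [← mul_assoc, ENNReal.mul_inv_cancel (volume_ball_ne_zero hx) measure_ball_lt_top.ne,
          one_mul]
    _ ≤ _ := by gcongr

/-- A ball containing `x` lies in the ball about `x` of twice the radius, whose area is four times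
larger. This reduces to the centred setting of the Besicovitch theorem. -/
theorem exists_centred_of_lt_maxFn {f : ℂ → ℝ≥0∞} {x : ℂ} {a : ℝ≥0∞} (h : a < maxFn f x) :
    ∃ r : ℝ, 0 < r ∧
      a * volume (Metric.closedBall x r) ≤ ∫⁻ y in Metric.closedBall x r, 4 * f y := by
  obtain ⟨c, r, hx, h⟩ := lt_maxFn_iff.1 h
  have hr := Metric.pos_of_mem_ball hx
  refine ⟨2 * r, by positivity, ?_⟩
  have hv : volume (Metric.closedBall x (2 * r)) = 4 * volume (Metric.ball c r) := by
    rw [Complex.volume_closedBall, Complex.volume_ball, ENNReal.ofReal_mul (by norm_num), mul_pow]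
    norm_num
    ring
  rw [hv, lintegral_const_mul' _ _ (by norm_num), mul_left_comm]
  gcongr
  calc a * volume (Metric.ball c r)
      ≤ (volume (Metric.ball c r))⁻¹ * (∫⁻ y in Metric.ball c r, f y) *
        volume (Metric.ball c r) := by gcongr
    _ = ∫⁻ y in Metric.ball c r, f y := by
        rw [mul_right_comm, ENNReal.inv_mul_cancel (volume_ball_ne_zero hx)
          measure_ball_lt_top.ne, one_mul]
    _ ≤ ∫⁻ y in Metric.closedBall x (2 * r), f y := by
        refine lintegral_mono_set fun y hy => ?_
        rw [Metric.mem_closedBall]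
        rw [Metric.mem_ball] at hx hy
        linarith [dist_triangle_right y x c]

theorem maxFn_weak (f : ℂ → ℝ≥0∞) (a : ℝ≥0∞) :
    a * volume {x | a < maxFn f x} ≤ 4 * besN * ∫⁻ y, f y := by
  have := besicovitch_weak volume (fun y => 4 * f y) a {x | a < maxFn f x}
    fun x hx => exists_centred_of_lt_maxFn hx
  rw [lintegral_const_mul' _ _ (by norm_num)] at this
  calc _ ≤ _ := this
    _ = _ := by ring

/-- The constant in the strong type estimate for the maximal function. -/
noncomputable def maxConst (q : ℝ) : ℝ≥0∞ :=
  ENNReal.ofReal (q / (q - 1)) * (2 * besN) * 2 ^ (q - 1) * 4 ^ q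

theorem maxConst_ne_top {q : ℝ} (hq : 1 < q) : maxConst q ≠ ∞ := by
  unfold maxConst
  have h1 : (2 : ℝ≥0∞) ^ (q - 1) ≠ ∞ := ENNReal.rpow_ne_top_of_nonneg (by linarith) (by norm_num)
  have h2 : (4 : ℝ≥0∞) ^ q ≠ ∞ := ENNReal.rpow_ne_top_of_nonneg (by linarith) (by norm_num)
  finiteness

theorem maxFn_strong {f : ℂ → ℝ≥0∞} (hf : Measurable f) {q : ℝ} (hq : 1 < q) :
    ∫⁻ x, maxFn f x ^ q ≤ maxConst q * ∫⁻ x, f x ^ q := by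
  refine (lintegral_rpow_le_of_centred volume (fun x r => measure_closedBall_lt_top) hq
    (measurable_maxFn f) (hf.const_mul 4)
    fun x s _ hlt => exists_centred_of_lt_maxFn hlt).trans_eq ?_
  simp_rw [ENNReal.mul_rpow_of_nonneg _ _ (zero_le_one.trans hq.le)]
  rw [lintegral_const_mul' _ _ (ENNReal.rpow_ne_top_of_nonneg (by linarith) (by norm_num)),
    maxConst]
  ring

theorem maxFn_const_le (a : ℝ≥0∞) (x : ℂ) : maxFn (fun _ => a) x ≤ a := by
  refine iSup_le fun c => iSup_le fun r => iSup_le fun hx => ?_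
  rw [setLIntegral_const, mul_left_comm, ENNReal.inv_mul_cancel (volume_ball_ne_zero hx)
    measure_ball_lt_top.ne, mul_one]

theorem maxFn_congr {f g : ℂ → ℝ≥0∞} (h : f =ᵐ[volume] g) : maxFn f = maxFn g := by
  ext x
  unfold maxFn
  congr! 6 with c r hx
  exact lintegral_congr_ae (ae_restrict_of_ae h)

/-! ### An integrable majorant adapted to a scale -/

/-- The kernel `r / (r + |x - y|)^3`. -/
noncomputable def tailKer (r : ℝ) (x y : ℂ) : ℝ := r / (r + ‖x - y‖) ^ 3

theorem tailKer_nonneg {r : ℝ} (hr : 0 < r) (x y : ℂ) : 0 ≤ tailKer r x y := by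
  unfold tailKer; positivity

theorem continuous_tailKer {r : ℝ} (hr : 0 < r) (x : ℂ) : Continuous (tailKer r x) := by
  unfold tailKer
  refine continuous_const.div (by fun_prop) fun y => ?_
  positivity

theorem tailKer_comm (r : ℝ) (x y : ℂ) : tailKer r x y = tailKer r y x := by
  rw [tailKer, tailKer, norm_sub_rev]

theorem exists_annulus {r : ℝ} (hr : 0 < r) (a : ℝ) : ∃ k : ℕ, a < 2 ^ k * r ∧
    (k = 0 ∨ 2 ^ k * r ≤ 2 * a) := by
  have hex : ∃ k : ℕ, a < 2 ^ k * r := by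
    obtain ⟨k, hk⟩ := pow_unbounded_of_one_lt (a / r) (one_lt_two)
    exact ⟨k, (div_lt_iff₀ hr).1 hk⟩
  classical
  refine ⟨Nat.find hex, Nat.find_spec hex, ?_⟩
  rcases Nat.eq_zero_or_pos (Nat.find hex) with h | h
  · exact Or.inl h
  · right
    have := Nat.find_min hex (Nat.sub_lt h one_pos)
    push Not at this
    obtain ⟨k, hk⟩ := Nat.exists_eq_succ_of_ne_zero h.ne'
    rw [hk] at this ⊢
    simp only [Nat.succ_eq_add_one, add_tsub_cancel_right] at this
    rw [Nat.succ_eq_add_one, pow_succ]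
    linarith

/-- A single term suffices: for the least `k` with `|x - y| < 2^k r` one has `2^k r ≤ 2 (r + |x -
y|)`, and cubing gives the factor `8`. -/
theorem tailKer_le_tsum {r : ℝ} (hr : 0 < r) (x y : ℂ) :
    ENNReal.ofReal (tailKer r x y) ≤ ∑' k : ℕ, (Metric.ball x (2 ^ k * r)).indicator
      (fun _ => ENNReal.ofReal (8 / (8 ^ k * r ^ 2))) y := by
  obtain ⟨k, hk, hk'⟩ := exists_annulus hr ‖x - y‖
  refine le_trans ?_ (ENNReal.le_tsum k)
  rw [Set.indicator_of_mem (by rwa [Metric.mem_ball, dist_comm, dist_eq_norm])]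
  apply ENNReal.ofReal_le_ofReal
  unfold tailKer
  have h0 := norm_nonneg (x - y)
  set a := ‖x - y‖
  have h1 : 2 ^ k * r ≤ 2 * (r + a) := by
    rcases hk' with rfl | h
    · simp; linarith
    · linarith
  have h2 : (2 ^ k * r) ^ 3 ≤ (2 * (r + a)) ^ 3 := pow_le_pow_left₀ (by positivity) h1 3
  rw [div_le_div_iff₀ (by positivity) (by positivity)]
  have h3 : (2 ^ k * r) ^ 3 = 8 ^ k * r ^ 3 := by
    rw [mul_pow, ← pow_mul, mul_comm k 3, pow_mul]; norm_num
  rw [h3] at h2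
  nlinarith [h2]

/-- The kernel decays one power faster than area grows, so the dyadic balls contribute a geometric
series. Doubling their radii puts `x'` inside; height times area is then `32 π 2^(-k) ≤ 128 ·
2^(-k)`, with sum `256`. -/
theorem lintegral_tailKer_le {f : ℂ → ℝ≥0∞} (hf : AEMeasurable f) {r : ℝ} (hr : 0 < r) {x x' : ℂ} (h : ‖x - x'‖ ≤ r) :
    ∫⁻ y, ENNReal.ofReal (tailKer r x y) * f y ≤ 256 * maxFn f x' := by
  calc ∫⁻ y, ENNReal.ofReal (tailKer r x y) * f y
      ≤ ∫⁻ y, ∑' k : ℕ, ENNReal.ofReal (8 / (8 ^ k * r ^ 2)) *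
          (Metric.ball x (2 ^ k * r)).indicator f y := by
        refine lintegral_mono fun y => ?_
        calc _ ≤ (∑' k : ℕ, (Metric.ball x (2 ^ k * r)).indicator
                (fun _ => ENNReal.ofReal (8 / (8 ^ k * r ^ 2))) y) * f y := by
              gcongr; exact tailKer_le_tsum hr x y
          _ = _ := by
              rw [← ENNReal.tsum_mul_right]
              refine tsum_congr fun k => ?_
              by_cases hy : y ∈ Metric.ball x (2 ^ k * r) <;> simp [hy]
    _ ≤ ∑' k : ℕ, ENNReal.ofReal (8 / (8 ^ k * r ^ 2)) * ∫⁻ y in Metric.ball x (2 ^ k * r), f y := by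
        rw [lintegral_tsum fun k => (hf.indicator measurableSet_ball).const_mul _]
        refine ENNReal.tsum_le_tsum fun k => ?_
        rw [lintegral_const_mul' _ _ ENNReal.ofReal_ne_top, lintegral_indicator measurableSet_ball]
    _ ≤ ∑' k : ℕ, 128 * (2⁻¹) ^ k * maxFn f x' := by
        refine ENNReal.tsum_le_tsum fun k => ?_
        have hx' : x' ∈ Metric.ball x (2 * (2 ^ k * r)) := by
          rw [Metric.mem_ball, dist_comm, dist_eq_norm]
          have : (1 : ℝ) ≤ 2 ^ k := one_le_pow₀ (by norm_num)
          nlinarith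
        calc _ ≤ ENNReal.ofReal (8 / (8 ^ k * r ^ 2)) *
              (volume (Metric.ball x (2 * (2 ^ k * r))) * maxFn f x') := by
              gcongr
              refine le_trans ?_ (lintegral_ball_le_maxFn f hx')
              refine lintegral_mono_set (Metric.ball_subset_ball ?_)
              have : (0 : ℝ) < 2 ^ k * r := by positivity
              linarith
          _ = ENNReal.ofReal (32 * Real.pi * (2⁻¹) ^ k) * maxFn f x' := by
              rw [← mul_assoc, Complex.volume_ball, ← ENNReal.ofReal_pow (by positivity)]
              rw [show (NNReal.pi : ℝ≥0∞) = ENNReal.ofReal Real.pi from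
                (ENNReal.ofReal_coe_nnreal (p := NNReal.pi)).symm]
              rw [← ENNReal.ofReal_mul (by positivity), ← ENNReal.ofReal_mul (by positivity)]
              congr 2
              have h8 : (8 : ℝ) ^ k = 2 ^ k * 2 ^ k * 2 ^ k := by
                rw [← mul_pow, ← mul_pow]; norm_num
              rw [h8, inv_pow]
              field_simp
              norm_num
          _ ≤ _ := by
              gcongr
              rw [ENNReal.ofReal_mul (by positivity), ENNReal.ofReal_pow (by positivity),
                ENNReal.ofReal_inv_of_pos (by norm_num)]
              simp only [ENNReal.ofReal_ofNat]
              gcongr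
              rw [← ENNReal.ofReal_ofNat 128]
              apply ENNReal.ofReal_le_ofReal
              nlinarith [Real.pi_le_four]
    _ = 256 * maxFn f x' := by
        rw [ENNReal.tsum_mul_right, ENNReal.tsum_mul_left, ENNReal.tsum_geometric]
        rw [ENNReal.one_sub_inv_two, inv_inv]
        norm_num

theorem lintegral_tailKer_le_const {r : ℝ} (hr : 0 < r) (x : ℂ) :
    ∫⁻ y, ENNReal.ofReal (tailKer r x y) ≤ 256 := by
  calc _ = ∫⁻ y, ENNReal.ofReal (tailKer r x y) * 1 := by simp
    _ ≤ 256 * maxFn (fun _ => 1) x := lintegral_tailKer_le aemeasurable_const hr (by simpa using hr.le)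
    _ ≤ 256 * 1 := by gcongr; exact maxFn_const_le 1 x
    _ = 256 := by simp

end BeurlingWeight

/-! ### Regularised kernels and their convolution identities, by integration by parts. -/

namespace BeurlingWeight

open ComplexConjugate

/-! ### Functions with polynomial decay -/

/-- Continuous functions that are `O((1 + |z|)^{-n})`. -/
def Decays (n : ℕ) (f : ℂ → ℂ) : Prop :=
  Continuous f ∧ ∃ C : ℝ, ∀ z, ‖f z‖ ≤ C / (1 + ‖z‖) ^ n

namespace Decays

variable {m n : ℕ} {f g : ℂ → ℂ}

theorem mul (hf : Decays m f) (hg : Decays n g) : Decays (m + n) (fun z => f z * g z) := by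
  obtain ⟨hf, A, hA⟩ := hf
  obtain ⟨hg, B, hB⟩ := hg
  refine ⟨hf.mul hg, A * B, fun z => ?_⟩
  rw [norm_mul, pow_add, ← div_mul_div_comm]
  exact mul_le_mul (hA z) (hB z) (norm_nonneg _) ((norm_nonneg _).trans (hA z))

theorem const_mul (hf : Decays n f) (c : ℂ) : Decays n (fun z => c * f z) := by
  obtain ⟨hf, A, hA⟩ := hf
  refine ⟨continuous_const.mul hf, ‖c‖ * A, fun z => ?_⟩
  rw [norm_mul, mul_div_assoc]
  exact mul_le_mul_of_nonneg_left (hA z) (norm_nonneg _)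

theorem add (hf : Decays n f) (hg : Decays n g) : Decays n (fun z => f z + g z) := by
  obtain ⟨hf, A, hA⟩ := hf
  obtain ⟨hg, B, hB⟩ := hg
  refine ⟨hf.add hg, A + B, fun z => ?_⟩
  rw [add_div]
  exact (norm_add_le _ _).trans (add_le_add (hA z) (hB z))

theorem sub (hf : Decays n f) (hg : Decays n g) : Decays n (fun z => f z - g z) := by
  simpa [sub_eq_add_neg] using hf.add (hg.const_mul (-1))

theorem conj_comp (hf : Decays n f) : Decays n (fun z => conj (f z)) := by
  obtain ⟨hf, A, hA⟩ := hf
  exact ⟨Complex.continuous_conj.comp hf, A, fun z => by simpa using hA z⟩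

theorem mono (hf : Decays n f) (h : m ≤ n) : Decays m f := by
  obtain ⟨hf, A, hA⟩ := hf
  refine ⟨hf, A, fun z => (hA z).trans ?_⟩
  have hA0 : 0 ≤ A := by simpa using (norm_nonneg _).trans (hA 0)
  gcongr
  linarith [norm_nonneg z]

theorem of_norm_le {φ : ℂ → ℂ} (hf : Decays n f) (hφ : Continuous φ) {B : ℝ}
    (h : ∀ z, 1 + ‖z‖ ≤ B * (1 + ‖φ z‖)) : Decays n (fun z => f (φ z)) := by
  obtain ⟨hf, A, hA⟩ := hf
  refine ⟨hf.comp hφ, A * B ^ n, fun z => (hA _).trans ?_⟩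
  have hA0 : 0 ≤ A := by simpa using (norm_nonneg _).trans (hA 0)
  rw [div_le_div_iff₀ (by positivity) (by positivity), mul_assoc, ← mul_pow]
  gcongr
  exact h z

theorem comp_sub_right (hf : Decays n f) (w : ℂ) : Decays n (fun z => f (z - w)) := by
  refine hf.of_norm_le (by fun_prop) (B := 1 + ‖w‖) fun z => ?_
  have := norm_le_norm_sub_add z w
  nlinarith [norm_nonneg w, norm_nonneg (z - w)]

theorem comp_sub_left (hf : Decays n f) (w : ℂ) : Decays n (fun z => f (w - z)) := by
  refine hf.of_norm_le (by fun_prop) (B := 1 + ‖w‖) fun z => ?_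
  have := norm_le_norm_sub_add z w
  rw [norm_sub_rev] at this
  nlinarith [norm_nonneg w, norm_nonneg (w - z)]

theorem integrable (hf : Decays n f) (hn : 3 ≤ n) : Integrable f := by
  obtain ⟨hf', A, hA⟩ := hf.mono hn
  have h := (integrable_one_add_norm (E := ℂ) (μ := volume) (r := 3)
    (by rw [Complex.finrank_real_complex]; norm_num)).const_mul A
  refine h.mono' hf'.aestronglyMeasurable (ae_of_all _ fun z => (hA z).trans_eq ?_)
  rw [Real.rpow_neg (by positivity), div_eq_mul_inv]
  norm_cast

end Decays

theorem integral_mul_lineDeriv_eq {f f' g g' : ℂ → ℂ} {v : ℂ} (h1 : Integrable fun z => f' z * g z)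
    (h2 : Integrable fun z => f z * g' z) (h3 : Integrable fun z => f z * g z)
    (hf : ∀ z, HasLineDerivAt ℝ f (f' z) z v) (hg : ∀ z, HasLineDerivAt ℝ g (g' z) z v) :
    ∫ z, f z * g' z = -∫ z, f' z * g z :=
  integral_bilinear_hasLineDerivAt_right_eq_neg_left_of_integrable
    (B := ContinuousLinearMap.mul ℝ ℂ) h1 h2 h3 (fun z _ => hf z) fun z _ => hg z

/-- The Jacobian determinant of a decaying map has vanishing integral. -/
theorem integral_jacobian {u u₁ u₂ v₁ v₂ v₁₂ : ℂ → ℂ} {a b : ℂ}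
    (hu : Decays 1 u) (hu₁ : Decays 2 u₁) (hu₂ : Decays 2 u₂) (hv₁ : Decays 2 v₁)
    (hv₂ : Decays 2 v₂) (hv₁₂ : Decays 3 v₁₂)
    (du₁ : ∀ z, HasLineDerivAt ℝ u (u₁ z) z a) (du₂ : ∀ z, HasLineDerivAt ℝ u (u₂ z) z b)
    (dv₁ : ∀ z, HasLineDerivAt ℝ v₁ (v₁₂ z) z b) (dv₂ : ∀ z, HasLineDerivAt ℝ v₂ (v₁₂ z) z a) :
    ∫ z, u₁ z * v₂ z = ∫ z, u₂ z * v₁ z := by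
  -- Both integrals equal minus the integral of `u * v₁₂`, the equality of mixed derivatives being
  -- encoded in the common `v₁₂`. All products decay at least to order 3, hence are integrable in
  -- the plane.
  have e1 := integral_mul_lineDeriv_eq ((hu₁.mul hv₂).integrable (by norm_num))
    ((hu.mul hv₁₂).integrable (by norm_num)) ((hu.mul hv₂).integrable (by norm_num)) du₁ dv₂
  have e2 := integral_mul_lineDeriv_eq ((hu₂.mul hv₁).integrable (by norm_num))
    ((hu.mul hv₁₂).integrable (by norm_num)) ((hu.mul hv₁).integrable (by norm_num)) du₂ dv₁
  exact neg_injective (e1.symm.trans e2)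

/-! ### The regularised Cauchy and Beurling kernels -/

/-- The regularisation `|z|^2 + δ^2` of `|z|^2`. -/
noncomputable def regDen (δ : ℝ) (z : ℂ) : ℂ := z * conj z + (δ : ℂ) ^ 2

theorem regDen_eq (δ : ℝ) (z : ℂ) : regDen δ z = ((‖z‖ ^ 2 + δ ^ 2 : ℝ) : ℂ) := by
  rw [regDen, Complex.mul_conj, Complex.normSq_eq_norm_sq]; push_cast; rfl

theorem norm_regDen (δ : ℝ) (z : ℂ) : ‖regDen δ z‖ = ‖z‖ ^ 2 + δ ^ 2 := by
  rw [regDen_eq, Complex.norm_real, Real.norm_of_nonneg (by positivity)]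

theorem regDen_ne_zero {δ : ℝ} (hδ : 0 < δ) (z : ℂ) : regDen δ z ≠ 0 := by
  rw [← norm_ne_zero_iff, norm_regDen]; positivity

@[fun_prop]
theorem continuous_regDen (δ : ℝ) : Continuous (regDen δ) := by
  unfold regDen; fun_prop

/-- The regularised Cauchy kernel. -/
noncomputable def cauchyReg (δ : ℝ) (z : ℂ) : ℂ := conj z * (regDen δ z)⁻¹

/-- The regularised Beurling kernel. -/
noncomputable def beurlingReg (δ : ℝ) (z : ℂ) : ℂ := cauchyReg δ z * cauchyReg δ z

/-- The approximate identity attached to the regularisation. -/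
noncomputable def massReg (δ : ℝ) (z : ℂ) : ℂ := (δ : ℂ) ^ 2 * ((regDen δ z)⁻¹ * (regDen δ z)⁻¹)

theorem decays_regDen_inv {δ : ℝ} (hδ : 0 < δ) : Decays 2 (fun z => (regDen δ z)⁻¹) := by
  refine ⟨(continuous_regDen δ).inv₀ (regDen_ne_zero hδ), 2 * (1 + (δ ^ 2)⁻¹), fun z => ?_⟩
  rw [norm_inv, norm_regDen, inv_eq_one_div, div_le_div_iff₀ (by positivity) (by positivity), one_mul]
  have h1 : (1 + ‖z‖) ^ 2 ≤ 2 * (1 + ‖z‖ ^ 2) := by nlinarith [sq_nonneg (1 - ‖z‖)]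
  have h2 : (δ ^ 2)⁻¹ * δ ^ 2 = 1 := inv_mul_cancel₀ (by positivity)
  have h3 : 0 ≤ (δ ^ 2)⁻¹ * ‖z‖ ^ 2 := by positivity
  nlinarith [sq_nonneg δ]

theorem decays_id_mul_regDen_inv {δ : ℝ} (hδ : 0 < δ) :
    Decays 1 (fun z => z * (regDen δ z)⁻¹) := by
  obtain ⟨hc, C, hC⟩ := decays_regDen_inv hδ
  refine ⟨continuous_id.mul hc, C, fun z => ?_⟩
  have hC0 : 0 ≤ C := by simpa using (norm_nonneg _).trans (hC 0)
  rw [norm_mul]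
  calc ‖z‖ * ‖(regDen δ z)⁻¹‖ ≤ (1 + ‖z‖) * (C / (1 + ‖z‖) ^ 2) := by
        gcongr
        · linarith
        · exact hC z
    _ = C / (1 + ‖z‖) ^ 1 := by field_simp

theorem decays_cauchyReg {δ : ℝ} (hδ : 0 < δ) : Decays 1 (cauchyReg δ) := by
  convert (decays_id_mul_regDen_inv hδ).conj_comp using 2 with z
  rw [map_mul, map_inv₀, cauchyReg, regDen_eq, Complex.conj_ofReal]

theorem decays_beurlingReg {δ : ℝ} (hδ : 0 < δ) : Decays 2 (beurlingReg δ) :=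
  (decays_cauchyReg hδ).mul (decays_cauchyReg hδ)

theorem decays_massReg {δ : ℝ} (hδ : 0 < δ) : Decays 4 (massReg δ) :=
  ((decays_regDen_inv hδ).mul (decays_regDen_inv hδ)).const_mul _

theorem conj_massReg (δ : ℝ) (z : ℂ) : conj (massReg δ z) = massReg δ z := by
  rw [massReg, regDen_eq]; simp [-Complex.ofReal_add]

theorem hasDerivAt_line (z w : ℂ) : HasDerivAt (fun s : ℝ => z + s • w) w 0 := by
  simpa using ((hasDerivAt_id (0 : ℝ)).smul_const w).const_add z

theorem hasDerivAt_conj_line (z w : ℂ) :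
    HasDerivAt (fun s : ℝ => conj (z + s • w)) (conj w) 0 := by
  have := hasDerivAt_line (conj z) (conj w)
  convert this using 2 with s
  simp

theorem hasDerivAt_regDen_line (δ : ℝ) (z w : ℂ) :
    HasDerivAt (fun s : ℝ => regDen δ (z + s • w)) (w * conj z + z * conj w) 0 := by
  simpa [regDen] using
    ((hasDerivAt_line z w).mul (hasDerivAt_conj_line z w)).add_const ((δ : ℂ) ^ 2)

/-- The derivative of the regularised Cauchy kernel in the direction `w`. -/
noncomputable def cauchyRegDeriv (δ : ℝ) (w z : ℂ) : ℂ :=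
  conj w * massReg δ z - w * beurlingReg δ z

/-- This is the origin of the two kernels: for `conj z / (z conj z + δ²)` the derivative in `conj z`
is `massReg` and the derivative in `z` is `-beurlingReg`. -/
theorem hasLineDerivAt_cauchyReg {δ : ℝ} (hδ : 0 < δ) (w z : ℂ) :
    HasLineDerivAt ℝ (cauchyReg δ) (cauchyRegDeriv δ w z) z w := by
  have hD := regDen_ne_zero hδ z
  have h := (hasDerivAt_conj_line z w).mul
    ((hasDerivAt_regDen_line δ z w).fun_inv (by simpa using hD))
  refine HasDerivAt.congr_deriv h ?_
  simp only [zero_smul, add_zero, cauchyRegDeriv, massReg, beurlingReg, cauchyReg]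
  field_simp
  rw [regDen]
  ring

/-- The second derivative of the regularised Cauchy kernel in the directions `w` and `v`. -/
noncomputable def cauchyRegDeriv₂ (δ : ℝ) (w v z : ℂ) : ℂ :=
  (-2 * w * conj v) * (cauchyReg δ z * (regDen δ z)⁻¹)
    - 2 * (cauchyRegDeriv δ w z * (v * cauchyReg δ z + conj v * (z * (regDen δ z)⁻¹)))

theorem hasLineDerivAt_cauchyRegDeriv {δ : ℝ} (hδ : 0 < δ) (w v z : ℂ) :
    HasLineDerivAt ℝ (cauchyRegDeriv δ w) (cauchyRegDeriv₂ δ w v z) z v := by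
  have hD := regDen_ne_zero hδ z
  have hi := (hasDerivAt_regDen_line δ z v).fun_inv (by simpa using hD)
  have hc := (hasDerivAt_conj_line z v).mul hi
  have h := (((hi.mul hi).const_mul ((δ : ℂ) ^ 2)).const_mul (conj w)).sub
    ((hc.mul hc).const_mul w)
  refine HasDerivAt.congr_deriv h ?_
  simp only [zero_smul, add_zero, cauchyRegDeriv₂, cauchyRegDeriv, massReg, beurlingReg, cauchyReg,
    Pi.mul_apply]
  field_simp
  ring

theorem cauchyRegDeriv₂_comm {δ : ℝ} (hδ : 0 < δ) (z : ℂ) :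
    cauchyRegDeriv₂ δ Complex.I 1 z = cauchyRegDeriv₂ δ 1 Complex.I z := by
  have hD := regDen_ne_zero hδ z
  simp only [cauchyRegDeriv₂, cauchyRegDeriv, massReg, beurlingReg, cauchyReg, Complex.conj_I,
    map_one]
  field_simp
  rw [regDen]
  ring

theorem decays_cauchyRegDeriv {δ : ℝ} (hδ : 0 < δ) (w : ℂ) : Decays 2 (cauchyRegDeriv δ w) :=
  (((decays_massReg hδ).mono (by norm_num)).const_mul _).sub ((decays_beurlingReg hδ).const_mul _)

theorem decays_cauchyRegDeriv₂ {δ : ℝ} (hδ : 0 < δ) (w v : ℂ) :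
    Decays 3 (cauchyRegDeriv₂ δ w v) :=
  (((decays_cauchyReg hδ).mul (decays_regDen_inv hδ)).const_mul _).sub
    (((decays_cauchyRegDeriv hδ w).mul (((decays_cauchyReg hδ).const_mul v).add
      ((decays_id_mul_regDen_inv hδ).const_mul _))).const_mul 2)

theorem hasLineDerivAt_comp_sub_right {f : ℂ → ℂ} {f' z v w : ℂ}
    (h : HasLineDerivAt ℝ f f' (z - w) v) : HasLineDerivAt ℝ (fun ξ => f (ξ - w)) f' z v := by
  unfold HasLineDerivAt at *
  convert h using 3
  ring

theorem hasLineDerivAt_comp_sub_left {f : ℂ → ℂ} {f' z v w : ℂ}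
    (h : HasLineDerivAt ℝ f f' (w - z) (-v)) : HasLineDerivAt ℝ (fun ξ => f (w - ξ)) f' z v := by
  unfold HasLineDerivAt at *
  convert h using 3
  simp
  ring

theorem hasLineDerivAt_conj_comp {f : ℂ → ℂ} {f' z v : ℂ}
    (h : HasLineDerivAt ℝ f f' z v) : HasLineDerivAt ℝ (fun ξ => conj (f ξ)) (conj f') z v := by
  unfold HasLineDerivAt at *
  exact (Complex.conjCLE.toContinuousLinearMap.hasFDerivAt.comp_hasDerivAt (0 : ℝ) h)

/-- Convolution of the regularised Beurling kernel with the approximate identity is symmetric in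
the parameters. -/
theorem integral_massReg_mul_beurlingReg {d e : ℝ} (hd : 0 < d) (he : 0 < e) (z : ℂ) :
    ∫ ξ, massReg d (z - ξ) * beurlingReg e ξ = ∫ ξ, beurlingReg d (z - ξ) * massReg e ξ := by
  have h := integral_jacobian (a := 1) (b := Complex.I) ((decays_cauchyReg hd).comp_sub_left z)
    ((decays_cauchyRegDeriv hd (-1)).comp_sub_left z)
    ((decays_cauchyRegDeriv hd (-Complex.I)).comp_sub_left z)
    (decays_cauchyRegDeriv he 1) (decays_cauchyRegDeriv he Complex.I)
    (decays_cauchyRegDeriv₂ he 1 Complex.I)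
    (fun ξ => hasLineDerivAt_comp_sub_left (hasLineDerivAt_cauchyReg hd _ _))
    (fun ξ => hasLineDerivAt_comp_sub_left (hasLineDerivAt_cauchyReg hd _ _))
    (fun ξ => hasLineDerivAt_cauchyRegDeriv he _ _ _)
    (fun ξ => by
      rw [← cauchyRegDeriv₂_comm he]; exact hasLineDerivAt_cauchyRegDeriv he _ _ _)
  have i1 := (((decays_massReg hd).comp_sub_left z).mul (decays_beurlingReg he)).integrable
    (by norm_num)
  have i2 := (((decays_beurlingReg hd).comp_sub_left z).mul (decays_massReg he)).integrable
    (by norm_num)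
  have j1 := (((decays_cauchyRegDeriv hd (-1)).comp_sub_left z).mul
    (decays_cauchyRegDeriv he Complex.I)).integrable (by norm_num)
  have j2 := (((decays_cauchyRegDeriv hd (-Complex.I)).comp_sub_left z).mul
    (decays_cauchyRegDeriv he 1)).integrable (by norm_num)
  rw [← sub_eq_zero, ← integral_sub j1 j2] at h
  rw [← sub_eq_zero, ← integral_sub i1 i2]
  -- Expanding the directional derivatives along `1` and `i` in terms of the two kernels turns the
  -- Jacobian determinant into `2 i` times the difference of the two integrands.
  have h2 : ∫ ξ, (2 * Complex.I) * (massReg d (z - ξ) * beurlingReg e ξ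
      - beurlingReg d (z - ξ) * massReg e ξ) = 0 := by
    rw [← h]
    refine integral_congr_ae (ae_of_all _ fun ξ => ?_)
    simp only [cauchyRegDeriv, map_neg, map_one, Complex.conj_I]
    ring
  rw [integral_const_mul] at h2
  simpa using h2

/-- Conjugation interchanges the `z` and `conj z` derivatives, so the vanishing Jacobian now equates
the autocorrelations of the two kernels. This plays the role of Plancherel's theorem. -/
theorem integral_conj_beurlingReg_mul_beurlingReg {d : ℝ} (hd : 0 < d) (z : ℂ) :
    ∫ ξ, conj (beurlingReg d (ξ - z)) * beurlingReg d ξ = ∫ ξ, massReg d (ξ - z) * massReg d ξ := by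
  have h := integral_jacobian (a := 1) (b := Complex.I)
    ((decays_cauchyReg hd).comp_sub_right z).conj_comp
    ((decays_cauchyRegDeriv hd 1).comp_sub_right z).conj_comp
    ((decays_cauchyRegDeriv hd Complex.I).comp_sub_right z).conj_comp
    (decays_cauchyRegDeriv hd 1) (decays_cauchyRegDeriv hd Complex.I)
    (decays_cauchyRegDeriv₂ hd 1 Complex.I)
    (fun ξ => hasLineDerivAt_conj_comp
      (hasLineDerivAt_comp_sub_right (hasLineDerivAt_cauchyReg hd _ _)))
    (fun ξ => hasLineDerivAt_conj_comp
      (hasLineDerivAt_comp_sub_right (hasLineDerivAt_cauchyReg hd _ _)))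
    (fun ξ => hasLineDerivAt_cauchyRegDeriv hd _ _ _)
    (fun ξ => by
      rw [← cauchyRegDeriv₂_comm hd]; exact hasLineDerivAt_cauchyRegDeriv hd _ _ _)
  have i1 := (((decays_beurlingReg hd).comp_sub_right z).conj_comp.mul
    (decays_beurlingReg hd)).integrable (by norm_num)
  have i2 := (((decays_massReg hd).comp_sub_right z).mul (decays_massReg hd)).integrable
    (by norm_num)
  have j1 := (((decays_cauchyRegDeriv hd 1).comp_sub_right z).conj_comp.mul
    (decays_cauchyRegDeriv hd Complex.I)).integrable (by norm_num)
  have j2 := (((decays_cauchyRegDeriv hd Complex.I).comp_sub_right z).conj_comp.mul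
    (decays_cauchyRegDeriv hd 1)).integrable (by norm_num)
  rw [← sub_eq_zero, ← integral_sub j1 j2] at h
  rw [← sub_eq_zero, ← integral_sub i1 i2]
  have h2 : ∫ ξ, (2 * Complex.I) * (conj (beurlingReg d (ξ - z)) * beurlingReg d ξ
      - massReg d (ξ - z) * massReg d ξ) = 0 := by
    rw [← h]
    refine integral_congr_ae (ae_of_all _ fun ξ => ?_)
    simp only [cauchyRegDeriv, map_sub, map_mul, map_one, Complex.conj_I, conj_massReg, map_neg]
    ring
  rw [integral_const_mul] at h2
  simpa using h2

end BeurlingWeight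

/-! ### Uniform L² bounds for the regularised transforms and for their maximal operator. -/

namespace BeurlingWeight

open ComplexConjugate

theorem maxFn_strong_ae {f : ℂ → ℝ≥0∞} (hf : AEMeasurable f) {q : ℝ} (hq : 1 < q) :
    ∫⁻ x, maxFn f x ^ q ≤ maxConst q * ∫⁻ x, f x ^ q := by
  have h := maxFn_strong hf.measurable_mk hq
  rw [← maxFn_congr hf.ae_eq_mk] at h
  refine h.trans_eq ?_
  congr 1
  refine lintegral_congr_ae ?_
  filter_upwards [hf.ae_eq_mk] with x hx
  rw [hx]

/-! ### Pointwise estimates of the kernels -/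

theorem norm_massReg {δ : ℝ} (z : ℂ) : ‖massReg δ z‖ = δ ^ 2 / (‖z‖ ^ 2 + δ ^ 2) ^ 2 := by
  rw [massReg, norm_mul, norm_mul, norm_inv, norm_regDen, norm_pow, Complex.norm_real,
    Real.norm_eq_abs, sq_abs]
  field_simp

theorem norm_massReg_le {δ : ℝ} (hδ : 0 < δ) (x y : ℂ) :
    ‖massReg δ (x - y)‖ ≤ 4 * tailKer δ x y := by
  rw [norm_massReg, tailKer]
  have h0 := norm_nonneg (x - y)
  set a := ‖x - y‖
  rw [← mul_div_assoc, div_le_div_iff₀ (by positivity) (by positivity)]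
  have h1 : (δ + a) ^ 2 ≤ 2 * (a ^ 2 + δ ^ 2) := by nlinarith [sq_nonneg (δ - a)]
  have h2 : ((δ + a) ^ 2) ^ 2 ≤ (2 * (a ^ 2 + δ ^ 2)) ^ 2 := pow_le_pow_left₀ (by positivity) h1 2
  have h3 : δ * (δ + a) ^ 3 ≤ (δ + a) * (δ + a) ^ 3 := by gcongr; linarith
  nlinarith

theorem norm_beurlingReg (δ : ℝ) (z : ℂ) :
    ‖beurlingReg δ z‖ = ‖z‖ ^ 2 / (‖z‖ ^ 2 + δ ^ 2) ^ 2 := by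
  rw [beurlingReg, cauchyReg, norm_mul, norm_mul, norm_inv, norm_regDen, Complex.norm_conj]
  field_simp

/-! ### Convolution with decaying kernels -/

/-- Convolution with the kernel `k`. -/
noncomputable def kconv (k f : ℂ → ℂ) (x : ℂ) : ℂ := ∫ y, k (x - y) * f y

theorem Decays.bounded {n : ℕ} {k : ℂ → ℂ} (hk : Decays n k) : ∃ C, 0 ≤ C ∧ ∀ z, ‖k z‖ ≤ C := by
  obtain ⟨_, C, hC⟩ := hk.mono (Nat.zero_le n)
  exact ⟨C, by simpa using (norm_nonneg _).trans (hC 0), by simpa using hC⟩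

theorem integrable_kconv {n : ℕ} {k f : ℂ → ℂ} (hk : Decays n k) (hf : Integrable f) (x : ℂ) :
    Integrable fun y => k (x - y) * f y := by
  obtain ⟨C, -, hC⟩ := hk.bounded
  exact hf.bdd_mul (hk.comp_sub_left x).1.aestronglyMeasurable (ae_of_all _ fun y => hC _)

theorem continuous_kconv {n : ℕ} {k f : ℂ → ℂ} (hk : Decays n k) (hf : Integrable f) :
    Continuous (kconv k f) := by
  obtain ⟨C, -, hC⟩ := hk.bounded
  refine continuous_of_dominated (bound := fun y => C * ‖f y‖)
    (fun x => (integrable_kconv hk hf x).aestronglyMeasurable)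
    (fun x => ae_of_all _ fun y => ?_) (hf.norm.const_mul C) (ae_of_all _ fun y => ?_)
  · rw [norm_mul]; gcongr; exact hC _
  · have := hk.1
    fun_prop

theorem Decays.integrable_norm_sq {k : ℂ → ℂ} (hk : Decays 2 k) : Integrable fun z => ‖k z‖ ^ 2 := by
  have := ((hk.mul hk).integrable (by norm_num)).norm
  simpa [sq] using this

/-- A kernel of order 2 need not be integrable, but it is square integrable; the product of two
translates is at most the sum of their squares, so the integral in `x` is bounded uniformly in the
pair `p`. This justifies Fubini for the expanded square. -/
theorem integrable_sq_kconv_aux {k f : ℂ → ℂ} (hk : Decays 2 k) (hf : Integrable f) :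
    Integrable (Function.uncurry fun (x : ℂ) (p : ℂ × ℂ) =>
      conj (k (x - p.1) * f p.1) * (k (x - p.2) * f p.2)) := by
  have hkc := hk.1
  have hm : AEStronglyMeasurable (Function.uncurry fun (x : ℂ) (p : ℂ × ℂ) =>
      conj (k (x - p.1) * f p.1) * (k (x - p.2) * f p.2)) (volume.prod (volume.prod volume)) := by
    have h1 : AEStronglyMeasurable (fun q : ℂ × ℂ × ℂ => f q.2.1)
      (volume.prod (volume.prod volume)) := hf.aestronglyMeasurable.comp_fst.comp_snd
    have h2 : AEStronglyMeasurable (fun q : ℂ × ℂ × ℂ => f q.2.2)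
      (volume.prod (volume.prod volume)) := hf.aestronglyMeasurable.comp_snd.comp_snd
    have h3 : Continuous (fun q : ℂ × ℂ × ℂ => k (q.1 - q.2.1)) := by fun_prop
    have h4 : Continuous (fun q : ℂ × ℂ × ℂ => k (q.1 - q.2.2)) := by fun_prop
    exact (Complex.continuous_conj.comp_aestronglyMeasurable (h3.aestronglyMeasurable.mul h1)).mul
      (h4.aestronglyMeasurable.mul h2)
  have hsq := hk.integrable_norm_sq
  have hb : ∀ y y' x : ℂ, ‖k (x - y)‖ * ‖k (x - y')‖ ≤ ‖k (x - y)‖ ^ 2 + ‖k (x - y')‖ ^ 2 := by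
    intro y y' x
    nlinarith [sq_nonneg (‖k (x - y)‖ - ‖k (x - y')‖), sq_nonneg (‖k (x - y)‖),
      sq_nonneg (‖k (x - y')‖)]
  have hint : ∀ y y' : ℂ, Integrable fun x : ℂ => ‖k (x - y)‖ * ‖k (x - y')‖ := by
    intro y y'
    refine ((hsq.comp_sub_right y).add (hsq.comp_sub_right y')).mono'
      (by fun_prop) (ae_of_all _ fun x => ?_)
    rw [Real.norm_of_nonneg (by positivity)]
    exact hb y y' x
  refine (integrable_prod_iff' hm).2 ⟨ae_of_all _ fun p => ?_, ?_⟩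
  · have h1 := ((hk.comp_sub_right p.1).conj_comp.mul (hk.comp_sub_right p.2)).integrable
      (by norm_num)
    refine (h1.const_mul (conj (f p.1) * f p.2)).congr (ae_of_all _ fun x => ?_)
    simp only [Function.uncurry_apply_pair, map_mul]
    ring
  · refine ((hf.norm.mul_prod hf.norm).mul_const (2 * ∫ z, ‖k z‖ ^ 2)).mono'
      hm.prod_swap.norm.integral_prod_right' (ae_of_all _ fun p => ?_)
    rw [Real.norm_of_nonneg (integral_nonneg fun x => norm_nonneg _)]
    have e1 : ∀ x, ‖Function.uncurry (fun (x : ℂ) (p : ℂ × ℂ) =>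
        conj (k (x - p.1) * f p.1) * (k (x - p.2) * f p.2)) (x, p)‖
        = ‖f p.1‖ * ‖f p.2‖ * (‖k (x - p.1)‖ * ‖k (x - p.2)‖) := by
      intro x
      simp only [Function.uncurry_apply_pair, norm_mul, Complex.norm_conj]
      ring
    simp_rw [e1]
    rw [integral_const_mul]
    gcongr
    calc ∫ x, ‖k (x - p.1)‖ * ‖k (x - p.2)‖
        ≤ ∫ x, (‖k (x - p.1)‖ ^ 2 + ‖k (x - p.2)‖ ^ 2) :=
          integral_mono (hint _ _) ((hsq.comp_sub_right p.1).add (hsq.comp_sub_right p.2))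
            fun x => hb _ _ x
      _ = _ := by
          rw [integral_add (hsq.comp_sub_right p.1) (hsq.comp_sub_right p.2),
            integral_sub_right_eq_self (fun z => ‖k z‖ ^ 2),
            integral_sub_right_eq_self (fun z => ‖k z‖ ^ 2)]
          ring

theorem conj_kconv_mul_kconv (k f : ℂ → ℂ) (x : ℂ) : ((‖kconv k f x‖ ^ 2 : ℝ) : ℂ)
    = ∫ p : ℂ × ℂ, conj (k (x - p.1) * f p.1) * (k (x - p.2) * f p.2) := by
  rw [Complex.ofReal_pow, ← Complex.conj_mul', kconv, ← integral_conj]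
  exact (integral_prod_mul _ _).symm

theorem integrable_norm_sq_kconv {k f : ℂ → ℂ} (hk : Decays 2 k) (hf : Integrable f) :
    Integrable fun x => ‖kconv k f x‖ ^ 2 := by
  have h := (integrable_sq_kconv_aux hk hf).integral_prod_left
  simp only [Function.uncurry_apply_pair] at h
  refine h.re.congr (ae_of_all _ fun x => ?_)
  exact (congrArg Complex.re (conj_kconv_mul_kconv k f x)).symm.trans (Complex.ofReal_re _)

/-- Expanding the square and applying Fubini shows that the `L²` norm depends on `k` only through
its autocorrelation. -/
theorem integral_norm_sq_kconv {k f : ℂ → ℂ} (hk : Decays 2 k) (hf : Integrable f) :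
    ((∫ x, ‖kconv k f x‖ ^ 2 : ℝ) : ℂ)
      = ∫ p : ℂ × ℂ, (conj (f p.1) * f p.2) * ∫ ξ, conj (k (ξ - (p.1 - p.2))) * k ξ := by
  rw [← integral_complex_ofReal]
  simp_rw [conj_kconv_mul_kconv]
  rw [integral_integral_swap (integrable_sq_kconv_aux hk hf)]
  refine integral_congr_ae (ae_of_all _ fun p => ?_)
  simp only
  rw [← integral_sub_right_eq_self (fun ξ => conj (k (ξ - (p.1 - p.2))) * k ξ) p.2,
    ← integral_const_mul]
  refine integral_congr_ae (ae_of_all _ fun x => ?_)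
  simp only [map_mul, sub_sub_sub_cancel_right]
  ring

/-- A regularised form of the isometry of the Beurling transform on `L²`: the singular kernel is
exchanged for an absolutely integrable one with the same autocorrelation. -/
theorem integral_norm_sq_beurlingReg {d : ℝ} (hd : 0 < d) {f : ℂ → ℂ} (hf : Integrable f) :
    ∫ x, ‖kconv (beurlingReg d) f x‖ ^ 2 = ∫ x, ‖kconv (massReg d) f x‖ ^ 2 := by
  have h1 := integral_norm_sq_kconv (decays_beurlingReg hd) hf
  have h2 := integral_norm_sq_kconv ((decays_massReg hd).mono (by norm_num : 2 ≤ 4)) hf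
  simp_rw [integral_conj_beurlingReg_mul_beurlingReg hd] at h1
  simp_rw [conj_massReg] at h2
  exact_mod_cast h1.trans h2.symm

theorem lintegral_enorm_sq_kconv {k f : ℂ → ℂ} (hk : Decays 2 k) (hf : Integrable f) :
    ∫⁻ x, ‖kconv k f x‖ₑ ^ (2 : ℝ) = ENNReal.ofReal (∫ x, ‖kconv k f x‖ ^ 2) := by
  rw [ofReal_integral_eq_lintegral_ofReal (integrable_norm_sq_kconv hk hf)
    (ae_of_all _ fun x => by positivity)]
  refine lintegral_congr fun x => ?_
  rw [ENNReal.ofReal_pow (norm_nonneg _), ofReal_norm]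
  norm_cast

theorem enorm_kconv_massReg_le {d : ℝ} (hd : 0 < d) {f : ℂ → ℂ} (hf : AEStronglyMeasurable f)
    {x x' : ℂ} (hx : ‖x - x'‖ ≤ d) :
    ‖kconv (massReg d) f x‖ₑ ≤ 1024 * maxFn (fun y => ‖f y‖ₑ) x' := by
  calc ‖kconv (massReg d) f x‖ₑ ≤ ∫⁻ y, ‖massReg d (x - y) * f y‖ₑ :=
        enorm_integral_le_lintegral_enorm _
    _ ≤ ∫⁻ y, 4 * (ENNReal.ofReal (tailKer d x y) * ‖f y‖ₑ) := by
        refine lintegral_mono fun y => ?_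
        rw [enorm_mul, ← mul_assoc]
        gcongr
        rw [← ofReal_norm, ← ENNReal.ofReal_ofNat 4, ← ENNReal.ofReal_mul (by norm_num)]
        exact ENNReal.ofReal_le_ofReal (norm_massReg_le hd x y)
    _ ≤ 4 * (256 * maxFn (fun y => ‖f y‖ₑ) x') := by
        rw [lintegral_const_mul' _ _ (by norm_num)]
        gcongr
        exact lintegral_tailKer_le hf.enorm hd hx
    _ = _ := by rw [← mul_assoc]; norm_num

theorem lintegral_beurlingReg_sq_le {d : ℝ} (hd : 0 < d) {f : ℂ → ℂ} (hf : Integrable f) :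
    ∫⁻ x, ‖kconv (beurlingReg d) f x‖ₑ ^ (2 : ℝ)
      ≤ 1024 ^ (2 : ℝ) * maxConst 2 * ∫⁻ x, ‖f x‖ₑ ^ (2 : ℝ) := by
  rw [lintegral_enorm_sq_kconv (decays_beurlingReg hd) hf, integral_norm_sq_beurlingReg hd hf,
    ← lintegral_enorm_sq_kconv ((decays_massReg hd).mono (by norm_num : 2 ≤ 4)) hf]
  calc _ ≤ ∫⁻ x, 1024 ^ (2 : ℝ) * maxFn (fun y => ‖f y‖ₑ) x ^ (2 : ℝ) := by
        refine lintegral_mono fun x => ?_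
        rw [← ENNReal.mul_rpow_of_nonneg _ _ (by norm_num)]
        gcongr
        exact enorm_kconv_massReg_le hd hf.aestronglyMeasurable (by simpa using hd.le)
    _ ≤ 1024 ^ (2 : ℝ) * (maxConst 2 * ∫⁻ x, ‖f x‖ₑ ^ (2 : ℝ)) := by
        rw [lintegral_const_mul' _ _ (by finiteness)]
        gcongr
        exact maxFn_strong_ae hf.aestronglyMeasurable.enorm (by norm_num)
    _ = _ := by ring

/-! ### The maximal operator of the regularised Beurling kernels -/

/-- The maximal operator attached to the regularised Beurling kernels. -/
noncomputable def regMax (f : ℂ → ℂ) (x : ℂ) : ℝ≥0∞ :=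
  ⨆ (δ : ℝ) (_ : 0 < δ), ‖kconv (beurlingReg δ) f x‖ₑ

theorem le_regMax (f : ℂ → ℂ) (x : ℂ) {δ : ℝ} (hδ : 0 < δ) :
    ‖kconv (beurlingReg δ) f x‖ₑ ≤ regMax f x :=
  le_iSup₂_of_le δ hδ le_rfl

theorem lt_regMax_iff {f : ℂ → ℂ} {x : ℂ} {a : ℝ≥0∞} :
    a < regMax f x ↔ ∃ δ : ℝ, 0 < δ ∧ a < ‖kconv (beurlingReg δ) f x‖ₑ := by
  simp only [regMax, lt_iSup_iff, exists_prop]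

theorem isOpen_lt_regMax {f : ℂ → ℂ} (hf : Integrable f) (a : ℝ≥0∞) :
    IsOpen {x | a < regMax f x} := by
  have : {x | a < regMax f x}
      = ⋃ (δ : ℝ) (_ : 0 < δ), {x | a < ‖kconv (beurlingReg δ) f x‖ₑ} := by
    ext x; simp [lt_regMax_iff]
  rw [this]
  refine isOpen_iUnion fun δ => isOpen_iUnion fun hδ => ?_
  exact isOpen_lt continuous_const (continuous_kconv (decays_beurlingReg hδ) hf).enorm

theorem measurable_regMax {f : ℂ → ℂ} (hf : Integrable f) : Measurable (regMax f) :=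
  measurable_of_Ioi fun a => (isOpen_lt_regMax hf a).measurableSet

/-- The total mass of the approximate identity. -/
noncomputable def massConst : ℂ := ∫ z, massReg 1 z

/-- The integrand is positive. The exact value of the mass is irrelevant, since one only needs to
divide by it. -/
theorem massConst_ne_zero : massConst ≠ 0 := by
  have h1 : ∀ z, massReg 1 z = ((1 / (‖z‖ ^ 2 + 1) ^ 2 : ℝ) : ℂ) := by
    intro z
    rw [massReg, regDen_eq]
    push_cast
    field_simp
  have hi := (decays_massReg one_pos).integrable (by norm_num)
  have hi' : Integrable fun z : ℂ => (1 / (‖z‖ ^ 2 + 1) ^ 2 : ℝ) := by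
    refine hi.re.congr (ae_of_all _ fun z => ?_)
    simp only [h1]
    simp only [RCLike.re_to_complex, Complex.ofReal_re]
  have hpos : 0 < ∫ z : ℂ, (1 / (‖z‖ ^ 2 + 1) ^ 2 : ℝ) := by
    refine integral_pos_of_integrable_nonneg_nonzero (x := 0) ?_ hi' (fun z => by positivity)
      (by simp)
    exact continuous_const.div (by fun_prop) fun z => by positivity
  rw [massConst]
  simp_rw [h1]
  rw [integral_complex_ofReal]
  exact_mod_cast hpos.ne'

theorem massReg_smul {e : ℝ} (he : 0 < e) (z : ℂ) :
    massReg e (e • z) = ((e ^ 2)⁻¹ : ℝ) • massReg 1 z := by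
  have h : regDen e (e • z) = (e : ℂ) ^ 2 * regDen 1 z := by
    simp [regDen]; ring
  have hD := regDen_ne_zero one_pos z
  rw [massReg, massReg, h, Complex.real_smul]
  have : (e : ℂ) ≠ 0 := by exact_mod_cast he.ne'
  push_cast
  field_simp

/-- Rescaling moves the parameter into the argument of `k`, leaving a fixed integrable factor for
dominated convergence. -/
theorem kconv_massReg_eq {e : ℝ} (he : 0 < e) (k : ℂ → ℂ) (w : ℂ) :
    ∫ ξ, k (w - ξ) * massReg e ξ = ∫ ξ, k (w - e • ξ) * massReg 1 ξ := by
  have h := Measure.integral_comp_smul volume (fun ξ => k (w - ξ) * massReg e ξ) e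
  simp_rw [massReg_smul he, mul_smul_comm] at h
  rw [integral_smul, Complex.finrank_real_complex, abs_of_nonneg (by positivity)] at h
  have he2 : (e ^ 2)⁻¹ ≠ (0 : ℝ) := by positivity
  exact (smul_right_injective ℂ he2 h).symm

theorem tendsto_kconv_massReg {n : ℕ} {k : ℂ → ℂ} (hk : Decays n k) (w : ℂ) {e : ℕ → ℝ}
    (he : ∀ j, 0 < e j) (he0 : Tendsto e atTop (𝓝 0)) :
    Tendsto (fun j => ∫ ξ, k (w - ξ) * massReg (e j) ξ) atTop (𝓝 (k w * massConst)) := by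
  simp_rw [fun j => kconv_massReg_eq (he j) k w]
  rw [massConst, ← integral_const_mul]
  have hi := (decays_massReg one_pos).integrable (by norm_num)
  have hc := hk.1
  have hc' := (decays_massReg one_pos).1
  obtain ⟨C, -, hC⟩ := hk.bounded
  refine tendsto_integral_of_dominated_convergence (fun ξ => C * ‖massReg 1 ξ‖)
    (fun j => ?_) (hi.norm.const_mul C) (fun j => ae_of_all _ fun ξ => ?_) (ae_of_all _ fun ξ => ?_)
  · exact Continuous.aestronglyMeasurable (by fun_prop)
  · rw [norm_mul]; gcongr; exact hC _
  · refine Tendsto.mul_const _ ?_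
    have : Tendsto (fun j => w - e j • ξ) atTop (𝓝 (w - (0 : ℝ) • ξ)) :=
      tendsto_const_nhds.sub (he0.smul_const ξ)
    rw [zero_smul, sub_zero] at this
    exact (hc.tendsto w).comp this

theorem norm_kconv_massReg_le {k : ℂ → ℂ} {C : ℝ} (hC : ∀ z, ‖k z‖ ≤ C)
    (w : ℂ) {e : ℝ} (he : 0 < e) :
    ‖∫ ξ, k (w - ξ) * massReg e ξ‖ ≤ C * ∫ ξ, ‖massReg 1 ξ‖ := by
  rw [kconv_massReg_eq he, ← integral_const_mul]
  have hi := (decays_massReg one_pos).integrable (by norm_num)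
  refine norm_integral_le_of_norm_le (hi.norm.const_mul C) (ae_of_all _ fun ξ => ?_)
  rw [norm_mul]; gcongr; exact hC _

theorem kconv_kconv {m n : ℕ} {k l f : ℂ → ℂ} (hk : Decays m k) (hm : 3 ≤ m) (hl : Decays n l)
    (hf : Integrable f) (x : ℂ) :
    kconv k (kconv l f) x = ∫ z, (∫ ξ, k (x - z - ξ) * l ξ) * f z := by
  have hkc := hk.1
  have hlc := hl.1
  obtain ⟨C, -, hC⟩ := hl.bounded
  simp only [kconv]
  simp_rw [← integral_const_mul, ← integral_mul_const]
  rw [integral_integral_swap]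
  · refine integral_congr_ae (ae_of_all _ fun z => ?_)
    simp only
    simp_rw [← mul_assoc]
    rw [integral_mul_const, integral_mul_const, ← integral_sub_right_eq_self (fun ξ => k (x - z - ξ) * l ξ) z]
    simp only [sub_sub, add_sub_cancel]
  · have h1 : Integrable (fun p : ℂ × ℂ => k (x - p.1) * f p.2) (volume.prod volume) :=
      Integrable.mul_prod ((hk.comp_sub_left x).integrable hm) hf
    have h2 := h1.bdd_mul (f := fun p : ℂ × ℂ => l (p.1 - p.2)) (c := C)
      (Continuous.aestronglyMeasurable (by fun_prop)) (ae_of_all _ fun p => hC _)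
    refine h2.congr (ae_of_all _ fun p => ?_)
    simp only [Function.uncurry]
    ring

/-- Exchanging the parameters moves the vanishing one onto the approximate identity, which converges
to a multiple of the Dirac mass. So the transform at scale `d` is recovered by averaging, at scale
`d`, transforms at arbitrarily small scales. -/
theorem tendsto_kconv_massReg_beurlingReg {d : ℝ} (hd : 0 < d) {f : ℂ → ℂ} (hf : Integrable f)
    (x : ℂ) {e : ℕ → ℝ} (he : ∀ j, 0 < e j) (he0 : Tendsto e atTop (𝓝 0)) :
    Tendsto (fun j => kconv (massReg d) (kconv (beurlingReg (e j)) f) x) atTop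
      (𝓝 (massConst * kconv (beurlingReg d) f x)) := by
  have hk := decays_beurlingReg hd
  obtain ⟨C, hC0, hC⟩ := hk.bounded
  simp_rw [fun j => kconv_kconv (decays_massReg hd) (by norm_num) (decays_beurlingReg (he j)) hf x,
    fun j => integral_massReg_mul_beurlingReg hd (he j)]
  rw [kconv, ← integral_const_mul]
  have hlim := fun z => tendsto_kconv_massReg hk (x - z) he he0
  refine tendsto_integral_of_dominated_convergence
    (fun z => (C * ∫ ξ, ‖massReg 1 ξ‖) * ‖f z‖) (fun j => ?_) (hf.norm.const_mul _)
    (fun j => ae_of_all _ fun z => ?_) (ae_of_all _ fun z => ?_)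
  · refine AEStronglyMeasurable.mul ?_ hf.aestronglyMeasurable
    refine Continuous.aestronglyMeasurable ?_
    have := continuous_kconv hk ((decays_massReg (he j)).integrable (by norm_num))
    exact this.comp (continuous_const.sub continuous_id)
  · rw [norm_mul]
    gcongr
    exact norm_kconv_massReg_le hC _ (he j)
  · convert (hlim z).mul_const (f z) using 2
    ring

/-- The constant in the strong type `(2,2)` estimate for the maximal operator. -/
noncomputable def regConst₂ : ℝ≥0∞ :=
  ((‖massConst‖ₑ)⁻¹ * 1024) ^ (2 : ℝ) * maxConst 2 * (1024 ^ (2 : ℝ) * maxConst 2)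

theorem regConst₂_ne_top : regConst₂ ≠ ∞ := by
  have h1 : maxConst 2 ≠ ∞ := maxConst_ne_top (by norm_num)
  have h2 : (‖massConst‖ₑ)⁻¹ ≠ ∞ := by simpa using massConst_ne_zero
  unfold regConst₂
  finiteness

/-- Averages at any scale `d` are bounded by the maximal function, so one sequence of small
parameters controls all scales: `regMax f` is at most the lower limit of multiples of the maximal
functions of the transforms along that sequence. Fatou's lemma and the uniform `L²` bounds finish
the proof. -/
theorem lintegral_regMax_sq_le {f : ℂ → ℂ} (hf : Integrable f) :
    ∫⁻ x, regMax f x ^ (2 : ℝ) ≤ regConst₂ * ∫⁻ x, ‖f x‖ₑ ^ (2 : ℝ) := by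
  obtain ⟨e, -, he, he0⟩ := exists_seq_strictAnti_tendsto (0 : ℝ)
  have hc0 : ‖massConst‖ₑ ≠ 0 := by simpa using massConst_ne_zero
  set b : ℝ≥0∞ := (‖massConst‖ₑ)⁻¹ * 1024 with hb
  let H : ℕ → ℂ → ℝ≥0∞ := fun j x => (b * maxFn (fun y => ‖kconv (beurlingReg (e j)) f y‖ₑ) x) ^ (2 : ℝ)
  have hH : ∀ j, Measurable (H j) := fun j => ((measurable_maxFn _).const_mul _).pow_const _
  have key : ∀ x, regMax f x ^ (2 : ℝ) ≤ liminf (fun j => H j x) atTop := by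
    intro x
    rw [← ENNReal.le_rpow_inv_iff (by norm_num)]
    refine iSup₂_le fun d hd => ?_
    rw [ENNReal.le_rpow_inv_iff (by norm_num)]
    have ht := (tendsto_kconv_massReg_beurlingReg hd hf x he he0).enorm
    have ht2 := (ENNReal.Tendsto.const_mul (a := (‖massConst‖ₑ)⁻¹) ht
      (Or.inr (by simpa using massConst_ne_zero))).ennrpow_const 2
    rw [enorm_mul, ← mul_assoc, ENNReal.inv_mul_cancel hc0 enorm_ne_top, one_mul] at ht2
    rw [← ht2.liminf_eq]
    refine liminf_le_liminf (Eventually.of_forall fun j => ?_)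
    simp only [H, hb]
    rw [mul_assoc]
    gcongr
    exact enorm_kconv_massReg_le hd
      (continuous_kconv (decays_beurlingReg (he j)) hf).aestronglyMeasurable (by simpa using hd.le)
  calc _ ≤ ∫⁻ x, liminf (fun j => H j x) atTop := lintegral_mono key
    _ ≤ liminf (fun j => ∫⁻ x, H j x) atTop := lintegral_liminf_le hH
    _ ≤ liminf (fun _ : ℕ => regConst₂ * ∫⁻ x, ‖f x‖ₑ ^ (2 : ℝ)) atTop := by
        refine liminf_le_liminf (Eventually.of_forall fun j => ?_)
        simp only [H]
        simp_rw [ENNReal.mul_rpow_of_nonneg _ _ (show (0 : ℝ) ≤ 2 by norm_num)]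
        have hbt : b ≠ ∞ := by
          have h2 : (‖massConst‖ₑ)⁻¹ ≠ ∞ := by simpa using massConst_ne_zero
          finiteness
        rw [lintegral_const_mul' _ _ (by finiteness), regConst₂, mul_assoc, mul_assoc, mul_assoc]
        gcongr
        rw [← mul_assoc (_ ^ _)]
        exact (maxFn_strong_ae (continuous_kconv (decays_beurlingReg (he j)) hf).enorm.aemeasurable
          (by norm_num)).trans (mul_le_mul_right (lintegral_beurlingReg_sq_le (he j) hf) _)
    _ = _ := by simp

end BeurlingWeight

namespace BeurlingWeight

open ComplexConjugate

/-! ### Smoothness of the regularised kernels -/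

theorem norm_cauchyReg_le {δ : ℝ} {z : ℂ} (hz : z ≠ 0) : ‖cauchyReg δ z‖ ≤ 1 / ‖z‖ := by
  have h0 : 0 < ‖z‖ := norm_pos_iff.2 hz
  rw [cauchyReg, norm_mul, norm_inv, norm_regDen, Complex.norm_conj, ← div_eq_mul_inv,
    div_le_div_iff₀ (by positivity) h0]
  nlinarith [sq_nonneg δ]

/-- Over a common denominator, the estimate reduces to `|z||w| (|z||w| + δ²) ≤ (|z|² + δ²)(|w|² +
δ²)`, so the bound is the one for the unregularised kernel `1/z`. -/
theorem norm_cauchyReg_sub_le {δ : ℝ} (hδ : 0 < δ) {z w : ℂ} (hz : z ≠ 0) (hw : w ≠ 0) :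
    ‖cauchyReg δ z - cauchyReg δ w‖ ≤ ‖z - w‖ / (‖z‖ * ‖w‖) := by
  have hDz := regDen_ne_zero hδ z
  have hDw := regDen_ne_zero hδ w
  have hz0 : 0 < ‖z‖ := norm_pos_iff.2 hz
  have hw0 : 0 < ‖w‖ := norm_pos_iff.2 hw
  have h : cauchyReg δ z - cauchyReg δ w
      = (conj z * conj w * (w - z) + (δ : ℂ) ^ 2 * conj (z - w)) / (regDen δ z * regDen δ w) := by
    rw [cauchyReg, cauchyReg, eq_div_iff (mul_ne_zero hDz hDw)]
    field_simp
    simp only [regDen, map_sub]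
    ring
  rw [h, norm_div, norm_mul, norm_regDen, norm_regDen]
  have hn : ‖conj z * conj w * (w - z) + (δ : ℂ) ^ 2 * conj (z - w)‖
      ≤ ‖z - w‖ * (‖z‖ * ‖w‖ + δ ^ 2) := by
    refine (norm_add_le _ _).trans_eq ?_
    simp only [norm_mul, Complex.norm_conj, norm_pow, Complex.norm_real, Real.norm_eq_abs, sq_abs,
      norm_sub_rev w z]
    ring
  refine (div_le_div_of_nonneg_right hn (by positivity)).trans ?_
  rw [div_le_div_iff₀ (by positivity) (by positivity), mul_assoc]
  refine mul_le_mul_of_nonneg_left ?_ (norm_nonneg _)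
  have : 0 ≤ (‖z‖ - ‖w‖) ^ 2 * δ ^ 2 := by positivity
  have : 0 ≤ ‖z‖ * ‖w‖ * δ ^ 2 := by positivity
  have : 0 ≤ δ ^ 2 * δ ^ 2 := by positivity
  nlinarith

/-- A difference of squares factors into the difference and the sum of Cauchy kernels, which gives
`6 r / |w|³`; replacing `|w|` by `r + |w| ≤ (3/2) |w|` costs less than a factor `4`. The bound is
uniform in `δ`. -/
theorem norm_beurlingReg_sub_le {δ r : ℝ} (hδ : 0 < δ) (hr : 0 < r) {z w : ℂ} (h : ‖z - w‖ ≤ r)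
    (hw : 2 * r ≤ ‖w‖) :
    ‖beurlingReg δ z - beurlingReg δ w‖ ≤ 24 * (r / (r + ‖w‖) ^ 3) := by
  have hw0 : 0 < ‖w‖ := by linarith
  have hz : ‖w‖ / 2 ≤ ‖z‖ := by
    have := norm_le_norm_sub_add w z
    rw [norm_sub_rev] at this
    linarith
  have hz0 : 0 < ‖z‖ := by linarith
  have hzn : z ≠ 0 := norm_pos_iff.1 hz0
  have hwn : w ≠ 0 := norm_pos_iff.1 hw0
  have e : beurlingReg δ z - beurlingReg δ w
      = (cauchyReg δ z - cauchyReg δ w) * (cauchyReg δ z + cauchyReg δ w) := by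
    simp only [beurlingReg]; ring
  rw [e, norm_mul]
  have h1 : ‖cauchyReg δ z - cauchyReg δ w‖ ≤ 2 * r / ‖w‖ ^ 2 := by
    refine (norm_cauchyReg_sub_le hδ hzn hwn).trans ?_
    rw [div_le_div_iff₀ (by positivity) (by positivity)]
    calc ‖z - w‖ * ‖w‖ ^ 2 ≤ r * ‖w‖ ^ 2 := by gcongr
      _ = 2 * r * (‖w‖ / 2 * ‖w‖) := by ring
      _ ≤ _ := by gcongr
  have h2 : ‖cauchyReg δ z + cauchyReg δ w‖ ≤ 3 / ‖w‖ := by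
    refine (norm_add_le _ _).trans ?_
    have h3 : ‖cauchyReg δ z‖ ≤ 2 / ‖w‖ := by
      refine (norm_cauchyReg_le hzn).trans ?_
      rw [div_le_div_iff₀ hz0 hw0]; linarith
    have h4 := norm_cauchyReg_le (δ := δ) hwn
    calc _ ≤ 2 / ‖w‖ + 1 / ‖w‖ := add_le_add h3 h4
      _ = _ := by ring
  calc _ ≤ 2 * r / ‖w‖ ^ 2 * (3 / ‖w‖) := by gcongr
    _ = 6 * (r / ‖w‖ ^ 3) := by field_simp; norm_num
    _ ≤ 24 * (r / (r + ‖w‖) ^ 3) := by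
      rw [← mul_div_assoc, ← mul_div_assoc, div_le_div_iff₀ (by positivity) (by positivity)]
      have h5 : (r + ‖w‖) ^ 3 ≤ (3 / 2 * ‖w‖) ^ 3 := by gcongr; linarith
      have h6 : (3 / 2 * ‖w‖) ^ 3 ≤ 4 * ‖w‖ ^ 3 := by
        have : 0 ≤ ‖w‖ ^ 3 := by positivity
        nlinarith
      calc 6 * r * (r + ‖w‖) ^ 3 ≤ 6 * r * (4 * ‖w‖ ^ 3) := by gcongr; exact h5.trans h6
        _ = _ := by ring

/-! ### Whitney decompositions -/

/-- A partition of a set into pieces comparable with balls whose radius is comparable with the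
distance to the complement. -/
structure WhitneyCover (Ω : Set ℂ) where
  /-- the index type -/
  ι : Type
  /-- the index type is countable -/
  countable : Countable ι
  /-- the centres -/
  c : ι → ℂ
  /-- the radii -/
  r : ι → ℝ
  /-- the pieces -/
  Q : ι → Set ℂ
  r_pos : ∀ i, 0 < r i
  measurableSet : ∀ i, MeasurableSet (Q i)
  disjoint : Pairwise (Function.onFun Disjoint Q)
  iUnion_eq : ⋃ i, Q i = Ω
  subset : ∀ i, Q i ⊆ Metric.closedBall (c i) (r i)
  double_subset : ∀ i, Metric.closedBall (c i) (2 * r i) ⊆ Ω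
  exists_notMem : ∀ i, ∃ w, w ∉ Ω ∧ ‖w - c i‖ ≤ 4 * r i
  volume_le : ∀ i, volume (Metric.closedBall (c i) (r i)) ≤ 25 * volume (Q i)

/-- With `d` the distance to the complement, Vitali's lemma selects disjoint balls of radius `d /
20` whose fivefold enlargements, of radius `d / 4`, cover the set. Each piece contains its small
ball, hence the factor `25`, and the complement is at distance exactly `4 · (d / 4)` from the
centre. -/
theorem exists_whitneyCover {Ω : Set ℂ} (hΩ : IsOpen Ω) (hfin : volume Ω ≠ ∞) :
    Nonempty (WhitneyCover Ω) := by
  have hne : (Ωᶜ).Nonempty := by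
    by_contra h
    rw [Set.not_nonempty_iff_eq_empty, Set.compl_empty_iff] at h
    exact hfin (by rw [h]; exact measure_univ_of_isAddLeftInvariant _)
  set d : ℂ → ℝ := fun x => Metric.infDist x Ωᶜ with hd
  have hdpos : ∀ x ∈ Ω, 0 < d x := fun x hx =>
    (hΩ.isClosed_compl.notMem_iff_infDist_pos hne).1 (by simpa using hx)
  have hsub : ∀ x, ∀ s < d x, Metric.closedBall x s ⊆ Ω := by
    intro x s hs y hy
    by_contra hy'
    have := Metric.infDist_le_dist_of_mem (x := x) (s := Ωᶜ) hy'
    rw [Metric.mem_closedBall, dist_comm] at hy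
    linarith
  -- Vitali's lemma needs bounded radii; a large distance to the complement would put a disc of area
  -- exceeding that of `Ω` inside `Ω`.
  obtain ⟨R, hR⟩ : ∃ R : ℝ, ∀ x ∈ Ω, d x ≤ R := by
    refine ⟨2 * (volume Ω).toReal + 2, fun x hx => ?_⟩
    by_contra hlt
    push Not at hlt
    have h0 : 0 ≤ (volume Ω).toReal := ENNReal.toReal_nonneg
    have h1 := measure_mono (μ := volume) (hsub x ((volume Ω).toReal + 1) (by linarith))
    rw [Complex.volume_closedBall] at h1
    have h2 := ENNReal.toReal_mono hfin h1
    rw [ENNReal.toReal_mul, ENNReal.toReal_pow, ENNReal.toReal_ofReal (by positivity)] at h2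
    have h3 : (NNReal.pi : ℝ≥0∞).toReal = Real.pi := rfl
    rw [h3] at h2
    nlinarith [Real.pi_gt_three]
  obtain ⟨u, huΩ, hdisj, hcov⟩ := Vitali.exists_disjoint_subfamily_covering_enlargement_closedBall
    Ω (fun x => x) (fun x => d x / 20) (R / 20)
    (fun x hx => by have := hR x hx; linarith) 5 (by norm_num)
  have hρ : ∀ i : u, 0 < d i / 20 := fun i => by have := hdpos i (huΩ i.2); linarith
  have hcount : u.Countable := hdisj.countable_of_nonempty_interior fun j hj =>
    ⟨j, mem_interior.2 ⟨Metric.ball j (d j / 20), Metric.ball_subset_closedBall,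
      Metric.isOpen_ball, Metric.mem_ball_self (hρ ⟨j, hj⟩)⟩⟩
  have hcu : Countable u := hcount.to_subtype
  obtain ⟨e, he⟩ := hcu.exists_injective_nat
  let S : u → Set ℂ := fun i => Metric.closedBall (i : ℂ) (d i / 20)
  let B : u → Set ℂ := fun i => Metric.closedBall (i : ℂ) (d i / 4)
  have hSB : ∀ i, S i ⊆ B i := fun i => Metric.closedBall_subset_closedBall (by
    have := hρ i; linarith)
  have hSd : ∀ i j, i ≠ j → Disjoint (S i) (S j) := fun i j hij =>
    hdisj i.2 j.2 fun h => hij (Subtype.ext h)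
  -- Points of the small balls go to their own piece; every other point goes to the first enlarged
  -- ball containing it, in the order given by the enumeration `e`.
  let Q : u → Set ℂ := fun i => S i ∪ (B i \ ((⋃ j, S j) ∪ ⋃ (j) (_ : e j < e i), B j))
  have hQB : ∀ i, Q i ⊆ B i := fun i => Set.union_subset (hSB i) Set.sdiff_subset
  have hBΩ : ∀ i, B i ⊆ Ω := fun i => hsub _ _ (by have := hρ i; linarith)
  refine ⟨⟨u, hcu, fun i => i, fun i => d i / 4, Q, fun i => by have := hρ i; linarith, fun i => ?_,
    fun i j hij => ?_, ?_, hQB, fun i => hsub _ _ (by have := hρ i; linarith), fun i => ?_,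
    fun i => ?_⟩⟩
  · refine Metric.isClosed_closedBall.measurableSet.union
      (Metric.isClosed_closedBall.measurableSet.diff (MeasurableSet.union ?_ ?_))
    · exact MeasurableSet.iUnion fun j => Metric.isClosed_closedBall.measurableSet
    · exact MeasurableSet.iUnion fun j => MeasurableSet.iUnion fun _ =>
        Metric.isClosed_closedBall.measurableSet
  · rw [Function.onFun, Set.disjoint_left]
    rintro x (hx | hx) (hy | hy)
    · exact Set.disjoint_left.1 (hSd i j hij) hx hy
    · exact hy.2 (Or.inl (Set.mem_iUnion.2 ⟨i, hx⟩))
    · exact hx.2 (Or.inl (Set.mem_iUnion.2 ⟨j, hy⟩))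
    · rcases lt_trichotomy (e i) (e j) with h | h | h
      · exact hy.2 (Or.inr (Set.mem_iUnion₂.2 ⟨i, h, hx.1⟩))
      · exact hij (he h)
      · exact hx.2 (Or.inr (Set.mem_iUnion₂.2 ⟨j, h, hy.1⟩))
  · refine Set.Subset.antisymm (Set.iUnion_subset fun i => (hQB i).trans (hBΩ i)) fun x hx => ?_
    by_cases hxS : x ∈ ⋃ j, S j
    · obtain ⟨j, hj⟩ := Set.mem_iUnion.1 hxS
      exact Set.mem_iUnion.2 ⟨j, Or.inl hj⟩
    · have hex : ∃ n, ∃ i, e i = n ∧ x ∈ B i := by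
        obtain ⟨b, hb, hxb⟩ := hcov x hx
        refine ⟨_, ⟨b, hb⟩, rfl, ?_⟩
        have := hxb (Metric.mem_closedBall_self (by have := hdpos x hx; positivity))
        have h5 : 5 * (d b / 20) = d b / 4 := by ring
        rwa [h5] at this
      classical
      obtain ⟨i, hi, hxi⟩ := Nat.find_spec hex
      refine Set.mem_iUnion.2 ⟨i, Or.inr ⟨hxi, ?_⟩⟩
      rintro (h | h)
      · exact hxS h
      · obtain ⟨j, hj, hxj⟩ := Set.mem_iUnion₂.1 h
        rw [hi] at hj
        exact Nat.find_min hex hj ⟨j, rfl, hxj⟩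
  · obtain ⟨w, hw, hw'⟩ := hΩ.isClosed_compl.exists_infDist_eq_dist hne (i : ℂ)
    refine ⟨w, hw, ?_⟩
    rw [← dist_eq_norm, dist_comm, ← hw']
    simp only [hd]
    linarith
  · refine le_trans (le_of_eq ?_) (mul_le_mul_right (measure_mono Set.subset_union_left) _)
    have h5 : d i / 4 = 5 * (d i / 20) := by ring
    simp only [S]
    rw [Complex.volume_closedBall, Complex.volume_closedBall, h5, ENNReal.ofReal_mul (by norm_num),
      mul_pow]
    norm_num
    ring

end BeurlingWeight

/-! ### Calderón–Zygmund decomposition and the weak type (1,1) estimate. -/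

namespace BeurlingWeight

open ComplexConjugate

/-- An integrable function is almost everywhere bounded by its maximal function. -/
theorem ae_enorm_le_maxFn {f : ℂ → ℂ} (hf : Integrable f) :
    ∀ᵐ x, ‖f x‖ₑ ≤ maxFn (fun y => ‖f y‖ₑ) x := by
  have hm := hf.aestronglyMeasurable.enorm
  set g := hm.mk with hg
  have hae : (fun y => ‖f y‖ₑ) =ᵐ[volume] g := hm.ae_eq_mk
  have hfin : ∫⁻ y, g y ≠ ∞ := by
    rw [← lintegral_congr_ae hae]; exact hf.2.ne
  filter_upwards [(Besicovitch.vitaliFamily (volume : Measure ℂ)).ae_tendsto_lintegral_div'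
    hm.measurable_mk hfin, hae] with x hx hxe
  rw [maxFn_congr hae, hxe]
  have ht := hx.comp (Besicovitch.tendsto_filterAt volume x)
  refine le_of_tendsto ht ?_
  filter_upwards [self_mem_nhdsWithin] with r hr
  have hr' : 0 < r := hr
  have hcl : Metric.ball x r =ᵐ[volume] Metric.closedBall x r := by
    rw [← Metric.ball_union_sphere]
    refine (union_ae_eq_left_of_ae_eq_empty ?_).symm
    exact ae_eq_empty.2 (Measure.addHaar_sphere volume x r)
  rw [Function.comp_apply, ← setLIntegral_congr hcl, ← measure_congr hcl]
  refine ENNReal.div_le_of_le_mul ?_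
  rw [mul_comm]
  exact lintegral_ball_le_maxFn _ (Metric.mem_ball_self hr')

namespace WhitneyCover

variable {Ω : Set ℂ} (W : WhitneyCover Ω) (f : ℂ → ℂ)

instance : Countable W.ι := W.countable

theorem subset_set (i : W.ι) : W.Q i ⊆ Ω :=
  (Set.subset_iUnion W.Q i).trans_eq W.iUnion_eq

theorem volume_ne_top (i : W.ι) : volume (W.Q i) ≠ ∞ :=
  ((measure_mono (W.subset i)).trans_lt measure_closedBall_lt_top).ne

theorem volume_ne_zero (i : W.ι) : volume (W.Q i) ≠ 0 := by
  intro h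
  have h1 := W.volume_le i
  rw [h, mul_zero] at h1
  exact (Metric.measure_closedBall_pos volume (W.c i) (W.r_pos i)).not_ge h1

theorem measurableSet_set (W : WhitneyCover Ω) : MeasurableSet Ω :=
  W.iUnion_eq ▸ MeasurableSet.iUnion W.measurableSet

theorem unique {i j : W.ι} {y : ℂ} (hi : y ∈ W.Q i) (hj : y ∈ W.Q j) : i = j := by
  by_contra h
  exact Set.disjoint_left.1 (W.disjoint h) hi hj

open Classical in
/-- The good part of the Calderón–Zygmund decomposition of `f`. -/
noncomputable def good (y : ℂ) : ℂ :=
  if h : ∃ i, y ∈ W.Q i then ⨍ x in W.Q h.choose, f x else f y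

theorem good_of_mem {i : W.ι} {y : ℂ} (hy : y ∈ W.Q i) : W.good f y = ⨍ x in W.Q i, f x := by
  have h : ∃ i, y ∈ W.Q i := ⟨i, hy⟩
  rw [good, dif_pos h, W.unique h.choose_spec hy]

theorem good_of_notMem {y : ℂ} (hy : y ∉ Ω) : W.good f y = f y := by
  rw [good, dif_neg]
  rintro ⟨i, hi⟩
  exact hy (W.subset_set i hi)

theorem enorm_average_mul_le (i : W.ι) :
    ‖⨍ x in W.Q i, f x‖ₑ * volume (W.Q i) ≤ ∫⁻ y in W.Q i, ‖f y‖ₑ := by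
  rw [setAverage_eq, enorm_smul, mul_comm, ← mul_assoc]
  have h : volume (W.Q i) * ‖(volume.real (W.Q i))⁻¹‖ₑ = 1 := by
    rw [enorm_inv, Real.enorm_of_nonneg measureReal_nonneg, measureReal_def,
      ENNReal.ofReal_toReal (W.volume_ne_top i),
      ENNReal.mul_inv_cancel (W.volume_ne_zero i) (W.volume_ne_top i)]
    rw [measureReal_def]
    exact (ENNReal.toReal_pos (W.volume_ne_zero i) (W.volume_ne_top i)).ne'
  rw [h, one_mul]
  exact enorm_integral_le_lintegral_enorm _

theorem lintegral_good_piece_le (i : W.ι) :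
    ∫⁻ y in W.Q i, ‖W.good f y‖ₑ ≤ ∫⁻ y in W.Q i, ‖f y‖ₑ := by
  calc _ = ∫⁻ y in W.Q i, ‖⨍ x in W.Q i, f x‖ₑ := by
        refine setLIntegral_congr_fun (W.measurableSet i) fun y hy => ?_
        simp only [W.good_of_mem f hy]
    _ = ‖⨍ x in W.Q i, f x‖ₑ * volume (W.Q i) := by rw [setLIntegral_const]
    _ ≤ _ := W.enorm_average_mul_le f i

theorem lintegral_eq_tsum (g : ℂ → ℝ≥0∞) :
    ∫⁻ y in Ω, g y = ∑' i, ∫⁻ y in W.Q i, g y := by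
  rw [← lintegral_iUnion W.measurableSet W.disjoint, W.iUnion_eq]

theorem lintegral_good_le : ∫⁻ y, ‖W.good f y‖ₑ ≤ ∫⁻ y, ‖f y‖ₑ := by
  rw [← lintegral_add_compl _ W.measurableSet_set, ← lintegral_add_compl (fun y => ‖f y‖ₑ)
    W.measurableSet_set, W.lintegral_eq_tsum, W.lintegral_eq_tsum]
  refine add_le_add (ENNReal.tsum_le_tsum fun i => W.lintegral_good_piece_le f i) (le_of_eq ?_)
  refine setLIntegral_congr_fun W.measurableSet_set.compl fun y hy => ?_
  simp only [W.good_of_notMem f hy]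

variable {f}

theorem integrable_good (hf : Integrable f) : Integrable (W.good f) := by
  refine ⟨?_, (W.lintegral_good_le f).trans_lt hf.2⟩
  rw [← Measure.restrict_univ (μ := volume), ← Set.union_compl_self Ω,
    aestronglyMeasurable_union_iff]
  constructor
  · have h : AEStronglyMeasurable (W.good f) (volume.restrict (⋃ i, W.Q i)) := ?_
    · rwa [W.iUnion_eq] at h
    rw [aestronglyMeasurable_iUnion_iff]
    intro i
    refine (aestronglyMeasurable_const (b := ⨍ x in W.Q i, f x)).congr ?_
    filter_upwards [ae_restrict_mem (W.measurableSet i)] with y hy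
    exact (W.good_of_mem f hy).symm
  · refine hf.aestronglyMeasurable.restrict.congr ?_
    filter_upwards [ae_restrict_mem W.measurableSet_set.compl] with y hy
    exact (W.good_of_notMem f hy).symm

theorem setIntegral_good (i : W.ι) : ∫ y in W.Q i, W.good f y = ∫ y in W.Q i, f y := by
  rw [setIntegral_congr_fun (W.measurableSet i) fun y hy => W.good_of_mem f hy,
    setIntegral_const]
  have := W.volume_ne_top i
  have : IsFiniteMeasure (volume.restrict (W.Q i)) := ⟨by simpa using this.lt_top⟩
  have h := measure_smul_average (volume.restrict (W.Q i)) f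
  simpa [measureReal_def] using h

/-- The ball of radius `8 r` about the centre contains both the piece and a point outside `Ω`, where
the maximal function is at most `a`. Its area is at most `64 · 25 = 1600` times that of the piece.
-/
theorem enorm_average_le {a : ℝ≥0∞} (hΩ : ∀ w ∉ Ω, maxFn (fun y => ‖f y‖ₑ) w ≤ a) (i : W.ι) :
    ‖⨍ x in W.Q i, f x‖ₑ ≤ 1600 * a := by
  obtain ⟨w, hw, hwi⟩ := W.exists_notMem i
  have hr := W.r_pos i
  have hmem : w ∈ Metric.ball (W.c i) (8 * W.r i) := by
    rw [Metric.mem_ball, dist_eq_norm]; linarith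
  have hv : volume (Metric.ball (W.c i) (8 * W.r i))
      = 64 * volume (Metric.closedBall (W.c i) (W.r i)) := by
    rw [Complex.volume_ball, Complex.volume_closedBall, ENNReal.ofReal_mul (by norm_num), mul_pow]
    norm_num
    ring
  have h : ‖⨍ x in W.Q i, f x‖ₑ * volume (W.Q i) ≤ 1600 * a * volume (W.Q i) := by
    calc _ ≤ ∫⁻ y in W.Q i, ‖f y‖ₑ := W.enorm_average_mul_le f i
      _ ≤ ∫⁻ y in Metric.ball (W.c i) (8 * W.r i), ‖f y‖ₑ :=
          lintegral_mono_set ((W.subset i).trans (Metric.closedBall_subset_ball (by linarith)))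
      _ ≤ volume (Metric.ball (W.c i) (8 * W.r i)) * maxFn (fun y => ‖f y‖ₑ) w :=
          lintegral_ball_le_maxFn (fun y => ‖f y‖ₑ) hmem
      _ ≤ 64 * (25 * volume (W.Q i)) * a := by
          rw [hv]
          gcongr
          · exact W.volume_le i
          · exact hΩ w hw
      _ = _ := by ring
  exact (ENNReal.mul_le_mul_iff_left (W.volume_ne_zero i) (W.volume_ne_top i)).1 h

theorem ae_enorm_good_le {a : ℝ≥0∞} (hf : Integrable f)
    (hΩ : ∀ w ∉ Ω, maxFn (fun y => ‖f y‖ₑ) w ≤ a) : ∀ᵐ y, ‖W.good f y‖ₑ ≤ 1600 * a := by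
  filter_upwards [ae_enorm_le_maxFn hf] with y hy
  by_cases h : y ∈ Ω
  · rw [← W.iUnion_eq] at h
    obtain ⟨i, hi⟩ := Set.mem_iUnion.1 h
    rw [W.good_of_mem f hi]
    exact W.enorm_average_le hΩ i
  · rw [W.good_of_notMem f h]
    calc _ ≤ a := hy.trans (hΩ y h)
      _ = 1 * a := (one_mul a).symm
      _ ≤ _ := by gcongr; norm_num

variable (f) in
/-- A majorant for the action of the kernels on the bad part of the Calderón–Zygmund
decomposition. -/
noncomputable def badMajorant (x : ℂ) : ℝ≥0∞ :=
  ∑' i, ENNReal.ofReal (tailKer (W.r i) (W.c i) x) * (48 * ∫⁻ y in W.Q i, ‖f y‖ₑ)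

theorem measurable_badMajorant : Measurable (W.badMajorant f) := by
  refine Measurable.tsum fun i => Measurable.mul_const ?_ _
  exact ENNReal.measurable_ofReal.comp (continuous_tailKer (W.r_pos i) (W.c i)).measurable

theorem lintegral_badMajorant_le : ∫⁻ x, W.badMajorant f x ≤ 12288 * ∫⁻ y, ‖f y‖ₑ := by
  have hm : ∀ i, Measurable fun x => ENNReal.ofReal (tailKer (W.r i) (W.c i) x) := fun i =>
    ENNReal.measurable_ofReal.comp (continuous_tailKer (W.r_pos i) (W.c i)).measurable
  calc _ = ∑' i, ∫⁻ x, ENNReal.ofReal (tailKer (W.r i) (W.c i) x) *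
        (48 * ∫⁻ y in W.Q i, ‖f y‖ₑ) :=
        lintegral_tsum fun i => ((hm i).mul_const _).aemeasurable
    _ ≤ ∑' i, 12288 * ∫⁻ y in W.Q i, ‖f y‖ₑ := by
        refine ENNReal.tsum_le_tsum fun i => ?_
        rw [lintegral_mul_const _ (hm i)]
        calc _ ≤ 256 * (48 * ∫⁻ y in W.Q i, ‖f y‖ₑ) := by
              gcongr; exact lintegral_tailKer_le_const (W.r_pos i) _
          _ = _ := by rw [← mul_assoc]; norm_num
    _ = 12288 * ∫⁻ y in Ω, ‖f y‖ₑ := by rw [ENNReal.tsum_mul_left, W.lintegral_eq_tsum]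
    _ ≤ _ := mul_le_mul_right (setLIntegral_le_lintegral _ _) _

/-- The bad part has mean zero on the piece, so the kernel may be replaced by its difference from
the value at the centre. A point outside `Ω` is at distance at least `2 r` from the centre, so the
smoothness bound applies; `48 = 24 · 2`, since the good part has no more mass than `f`. -/
theorem enorm_integral_bad_piece_le (hf : Integrable f) {x : ℂ} (hx : x ∉ Ω) {δ : ℝ} (hδ : 0 < δ)
    (i : W.ι) : ‖∫ y in W.Q i, beurlingReg δ (x - y) * (f y - W.good f y)‖ₑ
      ≤ ENNReal.ofReal (tailKer (W.r i) (W.c i) x) * (48 * ∫⁻ y in W.Q i, ‖f y‖ₑ) := by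
  have hk := decays_beurlingReg hδ
  have hb := hf.sub (W.integrable_good hf)
  have hxc : 2 * W.r i ≤ ‖x - W.c i‖ := by
    by_contra h
    push Not at h
    exact hx (W.double_subset i (by rw [Metric.mem_closedBall, dist_eq_norm]; exact h.le))
  have h0 : ∫ y in W.Q i, beurlingReg δ (x - W.c i) * (f y - W.good f y) = 0 := by
    rw [integral_const_mul, integral_sub hf.integrableOn (W.integrable_good hf).integrableOn,
      W.setIntegral_good, sub_self, mul_zero]
  have h1 : ∫ y in W.Q i, beurlingReg δ (x - y) * (f y - W.good f y)
      = ∫ y in W.Q i, (beurlingReg δ (x - y) - beurlingReg δ (x - W.c i)) *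
          (f y - W.good f y) := by
    simp_rw [sub_mul (beurlingReg δ _)]
    have i1 := integrable_kconv hk hb x
    have i2 := hb.const_mul (beurlingReg δ (x - W.c i))
    simp only [Pi.sub_apply] at i1 i2
    rw [integral_sub i1.integrableOn i2.integrableOn, h0, sub_zero]
  rw [h1]
  calc _ ≤ ∫⁻ y in W.Q i, ‖(beurlingReg δ (x - y) - beurlingReg δ (x - W.c i)) *
          (f y - W.good f y)‖ₑ := enorm_integral_le_lintegral_enorm _
    _ ≤ ∫⁻ y in W.Q i, (24 * ENNReal.ofReal (tailKer (W.r i) (W.c i) x)) *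
          (‖f y‖ₑ + ‖W.good f y‖ₑ) := by
        refine setLIntegral_mono_ae' (W.measurableSet i) (ae_of_all _ fun y hy => ?_)
        rw [enorm_mul]
        gcongr
        · rw [← ofReal_norm, ← ENNReal.ofReal_ofNat 24, ← ENNReal.ofReal_mul (by norm_num)]
          apply ENNReal.ofReal_le_ofReal
          rw [tailKer_comm]
          refine norm_beurlingReg_sub_le hδ (W.r_pos i) ?_ hxc
          have := W.subset i hy
          rw [Metric.mem_closedBall, dist_eq_norm, norm_sub_rev] at this
          simpa using this
        · exact enorm_sub_le
    _ ≤ (24 * ENNReal.ofReal (tailKer (W.r i) (W.c i) x)) *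
          ((∫⁻ y in W.Q i, ‖f y‖ₑ) + ∫⁻ y in W.Q i, ‖f y‖ₑ) := by
        rw [lintegral_const_mul' _ _ (by finiteness),
          lintegral_add_left' hf.aestronglyMeasurable.enorm.restrict]
        exact mul_le_mul_right (add_le_add le_rfl (W.lintegral_good_piece_le f i)) _
    _ = _ := by ring

theorem regMax_le_of_notMem (hf : Integrable f) {x : ℂ} (hx : x ∉ Ω) :
    regMax f x ≤ regMax (W.good f) x + W.badMajorant f x := by
  refine iSup₂_le fun δ hδ => ?_
  have hk := decays_beurlingReg hδ
  have hg := W.integrable_good hf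
  have hb := hf.sub hg
  have h1 : kconv (beurlingReg δ) f x = kconv (beurlingReg δ) (W.good f) x
      + ∑' i, ∫ y in W.Q i, beurlingReg δ (x - y) * (f y - W.good f y) := by
    have hint := integrable_kconv hk hb x
    simp only [Pi.sub_apply] at hint
    rw [← integral_iUnion W.measurableSet W.disjoint hint.integrableOn, W.iUnion_eq,
      setIntegral_eq_integral_of_forall_compl_eq_zero, ← sub_eq_iff_eq_add', kconv, kconv,
      ← integral_sub (integrable_kconv hk hf x) (integrable_kconv hk hg x)]
    · simp_rw [mul_sub]
    · intro y hy
      rw [W.good_of_notMem f hy, sub_self, mul_zero]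
  rw [h1]
  refine (enorm_add_le _ _).trans (add_le_add (le_regMax _ _ hδ) ?_)
  exact enorm_tsum_le_tsum_enorm.trans
    (ENNReal.tsum_le_tsum fun i => W.enorm_integral_bad_piece_le hf hx hδ i)

end WhitneyCover

/-- The constant in the weak type `(1,1)` estimate for the maximal operator. -/
noncomputable def regConst₁ : ℝ≥0∞ := 4 * besN + 6400 * regConst₂ + 24576

theorem regConst₁_ne_top : regConst₁ ≠ ∞ := by
  have := regConst₂_ne_top
  unfold regConst₁
  finiteness

/-- The decomposition is taken at height `a` on the set where the maximal function exceeds `a`,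
whose measure the maximal theorem controls. Off that set, the good part, bounded by `1600 a`, is
handled by the `L²` estimate and Chebyshev at level `a / 2`, giving `4 · 1600 = 6400`; the bad part
is handled by its integrable majorant, giving `2 · 12288`. -/
theorem regMax_weak {f : ℂ → ℂ} (hf : Integrable f) (a : ℝ≥0∞) :
    a * volume {x | a < regMax f x} ≤ regConst₁ * ∫⁻ y, ‖f y‖ₑ := by
  rcases eq_or_ne a 0 with rfl | ha0
  · simp
  rcases eq_or_ne a ∞ with rfl | hat
  · simp
  set Ω : Set ℂ := {x | a < maxFn (fun y => ‖f y‖ₑ) x} with hΩ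
  set F := ∫⁻ y, ‖f y‖ₑ
  have hw : a * volume Ω ≤ 4 * besN * F := maxFn_weak _ a
  have hF : F ≠ ∞ := hf.2.ne
  have hfin : volume Ω ≠ ∞ := by
    intro h
    rw [h, ENNReal.mul_top ha0, top_le_iff] at hw
    exact (by finiteness : 4 * (besN : ℝ≥0∞) * F ≠ ∞) hw
  obtain ⟨W⟩ := exists_whitneyCover (isOpen_lt_maxFn _ a) hfin
  have hle : ∀ w ∉ Ω, maxFn (fun y => ‖f y‖ₑ) w ≤ a := fun w hw => not_lt.1 hw
  have hg := W.integrable_good hf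
  have ha2 : a / 2 ≠ 0 := by simp [ha0]
  have ha2' : a / 2 ≠ ∞ := ENNReal.div_ne_top hat (by norm_num)
  have e2 : a = 2 * (a / 2) := by rw [ENNReal.mul_div_cancel (by norm_num) (by norm_num)]
  have hsub : {x | a < regMax f x} ⊆ Ω ∪
      ({x | a / 2 ≤ regMax (W.good f) x} ∪ {x | a / 2 ≤ W.badMajorant f x}) := by
    intro x hx
    by_cases hxΩ : x ∈ Ω
    · exact Or.inl hxΩ
    · right
      by_contra h
      simp only [Set.mem_union, Set.mem_ofPred_eq, not_or, not_le] at h hx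
      have := W.regMax_le_of_notMem hf hxΩ
      have h3 := (hx.trans_le this).trans (ENNReal.add_lt_add h.1 h.2)
      rw [ENNReal.add_halves] at h3
      exact lt_irrefl _ h3
  have hbad : a * volume {x | a / 2 ≤ W.badMajorant f x} ≤ 24576 * F := by
    calc _ = 2 * (a / 2 * volume {x | a / 2 ≤ W.badMajorant f x}) := by
          nth_rw 1 [e2]; rw [mul_assoc]
      _ ≤ 2 * (12288 * F) := by
          exact mul_le_mul_right ((mul_meas_ge_le_lintegral W.measurable_badMajorant _).trans
            W.lintegral_badMajorant_le) _
      _ = _ := by rw [← mul_assoc]; norm_num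
  have hgood : a * volume {x | a / 2 ≤ regMax (W.good f) x} ≤ 6400 * regConst₂ * F := by
    have hset : {x | a / 2 ≤ regMax (W.good f) x}
        = {x | (a / 2) ^ (2 : ℝ) ≤ regMax (W.good f) x ^ (2 : ℝ)} := by
      ext x
      simp only [Set.mem_ofPred_eq]
      exact (ENNReal.rpow_le_rpow_iff (by norm_num)).symm
    have h1 : (a / 2) ^ (2 : ℝ) * volume {x | a / 2 ≤ regMax (W.good f) x}
        ≤ regConst₂ * (1600 * a * F) := by
      rw [hset]
      refine (mul_meas_ge_le_lintegral ((measurable_regMax hg).pow_const _) _).trans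
        ((lintegral_regMax_sq_le hg).trans ?_)
      gcongr
      calc _ ≤ ∫⁻ y, 1600 * a * ‖W.good f y‖ₑ := by
            refine lintegral_mono_ae ?_
            filter_upwards [W.ae_enorm_good_le hf hle] with y hy
            rw [show (2 : ℝ) = ((2 : ℕ) : ℝ) by norm_num, ENNReal.rpow_natCast, sq]
            gcongr
        _ = 1600 * a * ∫⁻ y, ‖W.good f y‖ₑ := lintegral_const_mul' _ _ (by finiteness)
        _ ≤ _ := by gcongr; exact W.lintegral_good_le f
    have h2 : (a / 2) * (a * volume {x | a / 2 ≤ regMax (W.good f) x})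
        ≤ (a / 2) * (6400 * regConst₂ * F) := by
      calc _ = 2 * ((a / 2) ^ (2 : ℝ) * volume {x | a / 2 ≤ regMax (W.good f) x}) := by
            rw [show (2 : ℝ) = ((2 : ℕ) : ℝ) by norm_num, ENNReal.rpow_natCast, sq]
            nth_rw 2 [e2]
            ring
        _ ≤ 2 * (regConst₂ * (1600 * (2 * (a / 2)) * F)) := by
            rw [← e2]; gcongr
        _ = _ := by ring
    exact (ENNReal.mul_le_mul_iff_right ha2 ha2').1 h2
  calc _ ≤ a * (volume Ω + (volume {x | a / 2 ≤ regMax (W.good f) x}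
        + volume {x | a / 2 ≤ W.badMajorant f x})) := by
        gcongr
        exact (measure_mono hsub).trans ((measure_union_le _ _).trans
          (add_le_add le_rfl (measure_union_le _ _)))
    _ ≤ 4 * besN * F + (6400 * regConst₂ * F + 24576 * F) := by
        rw [mul_add, mul_add]
        exact add_le_add hw (add_le_add hgood hbad)
    _ = _ := by rw [regConst₁]; ring

end BeurlingWeight

namespace BeurlingWeight

open ComplexConjugate

/-! ### The good-λ inequality -/

theorem beurlingReg_eq_mul (δ : ℝ) (z : ℂ) :
    beurlingReg δ z = conj z ^ 2 * (((‖z‖ ^ 2 + δ ^ 2) ^ 2)⁻¹ : ℝ) := by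
  rw [beurlingReg, cauchyReg, regDen_eq, ← inv_pow]; push_cast; ring

theorem norm_beurlingReg_le_tail {δ R : ℝ} (hR : 0 < R) (h : R ≤ δ) {z : ℂ} (hz : ‖z‖ ≤ R) :
    ‖beurlingReg δ z‖ ≤ ‖massReg R z‖ := by
  rw [norm_beurlingReg, norm_massReg]
  have := norm_nonneg z
  gcongr

theorem norm_beurlingReg_sub_le_massReg {δ R : ℝ} (hδ : 0 ≤ δ) (h : δ ≤ R) {z : ℂ}
    (hR : 0 < R) (hz : R < ‖z‖) : ‖beurlingReg δ z - beurlingReg R z‖ ≤ 3 * ‖massReg R z‖ := by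
  have hz0 : 0 < ‖z‖ := hR.trans hz
  set s := ‖z‖ ^ 2 with hs
  have hs0 : 0 < s := by positivity
  have hRs : R ^ 2 ≤ s := by rw [hs]; gcongr
  have hdR : δ ^ 2 ≤ R ^ 2 := by gcongr
  have e : beurlingReg δ z - beurlingReg R z
      = conj z ^ 2 * ((((s + δ ^ 2) ^ 2)⁻¹ - ((s + R ^ 2) ^ 2)⁻¹ : ℝ) : ℂ) := by
    rw [beurlingReg_eq_mul, beurlingReg_eq_mul, ← mul_sub, hs]; push_cast; rfl
  have h1 : ((s + R ^ 2) ^ 2)⁻¹ ≤ ((s + δ ^ 2) ^ 2)⁻¹ := by gcongr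
  have h2 : ((s + δ ^ 2) ^ 2)⁻¹ ≤ (s ^ 2)⁻¹ := by
    gcongr
    nlinarith [sq_nonneg δ]
  rw [e, norm_mul, norm_pow, Complex.norm_conj, Complex.norm_real, Real.norm_of_nonneg (by linarith),
    norm_massReg, ← hs]
  calc s * (((s + δ ^ 2) ^ 2)⁻¹ - ((s + R ^ 2) ^ 2)⁻¹)
      ≤ s * ((s ^ 2)⁻¹ - ((s + R ^ 2) ^ 2)⁻¹) := by gcongr
    _ = R ^ 2 * (2 * s + R ^ 2) / (s * (s + R ^ 2) ^ 2) := by field_simp; ring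
    _ ≤ R ^ 2 * (3 * s) / (s * (s + R ^ 2) ^ 2) := by gcongr; linarith
    _ = _ := by field_simp

/-- Cutting off a regularised kernel at the scale `R` amounts to regularising it at the scale
`max δ R`, up to an error controlled by the tail kernel. -/
theorem norm_indicator_beurlingReg_sub_le {δ R : ℝ} (hδ : 0 ≤ δ) (hR : 0 < R) (x y : ℂ) :
    ‖{ξ : ℂ | R < ‖x - ξ‖}.indicator (fun ξ => beurlingReg δ (x - ξ)) y
      - beurlingReg (max δ R) (x - y)‖ ≤ 12 * tailKer R x y := by
  have hm := norm_massReg_le hR x y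
  by_cases hy : R < ‖x - y‖
  · rw [Set.indicator_of_mem (by exact hy)]
    rcases le_total δ R with h | h
    · rw [max_eq_right h]
      have := norm_beurlingReg_sub_le_massReg hδ h hR hy
      linarith
    · rw [max_eq_left h, sub_self, norm_zero]
      have := tailKer_nonneg hR x y
      positivity
  · rw [Set.indicator_of_notMem (by exact hy), zero_sub, norm_neg]
    have := norm_beurlingReg_le_tail hR (le_max_right δ R) (not_lt.1 hy)
    have := tailKer_nonneg hR x y
    linarith

theorem lintegral_indicator_beurlingReg_sub_le {δ R : ℝ} (hδ : 0 ≤ δ) (hR : 0 < R) {f : ℂ → ℂ}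
    (hf : AEStronglyMeasurable f) {x x' : ℂ} (h : ‖x - x'‖ ≤ R) :
    ∫⁻ y, ‖({ξ : ℂ | R < ‖x - ξ‖}.indicator (fun ξ => beurlingReg δ (x - ξ)) y
      - beurlingReg (max δ R) (x - y)) * f y‖ₑ ≤ 3072 * maxFn (fun y => ‖f y‖ₑ) x' := by
  calc _ ≤ ∫⁻ y, 12 * (ENNReal.ofReal (tailKer R x y) * ‖f y‖ₑ) := by
        refine lintegral_mono fun y => ?_
        rw [enorm_mul, ← mul_assoc]
        gcongr
        rw [← ofReal_norm, ← ENNReal.ofReal_ofNat 12, ← ENNReal.ofReal_mul (by norm_num)]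
        exact ENNReal.ofReal_le_ofReal (norm_indicator_beurlingReg_sub_le hδ hR x y)
    _ ≤ 12 * (256 * maxFn (fun y => ‖f y‖ₑ) x') := by
        rw [lintegral_const_mul' _ _ (by norm_num)]
        gcongr
        exact lintegral_tailKer_le hf.enorm hR h
    _ = _ := by rw [← mul_assoc]; norm_num

theorem regMax_add_le {f g : ℂ → ℂ} (hf : Integrable f) (hg : Integrable g) (x : ℂ) :
    regMax (fun y => f y + g y) x ≤ regMax f x + regMax g x := by
  refine iSup₂_le fun δ hδ => ?_
  have hk := decays_beurlingReg hδ
  have e : kconv (beurlingReg δ) (fun y => f y + g y) x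
      = kconv (beurlingReg δ) f x + kconv (beurlingReg δ) g x := by
    rw [kconv, kconv, kconv, ← integral_add (integrable_kconv hk hf x) (integrable_kconv hk hg x)]
    simp_rw [mul_add]
  rw [e]
  exact (enorm_add_le _ _).trans (add_le_add (le_regMax _ _ hδ) (le_regMax _ _ hδ))

theorem measurableSet_far (x : ℂ) (R : ℝ) : MeasurableSet {y : ℂ | R < ‖x - y‖} :=
  (isOpen_lt continuous_const (by fun_prop)).measurableSet

/-- The action of the kernels on the part of `f` far from `w` is controlled by the maximal
operator at `w`. -/
theorem enorm_kconv_far_le {f : ℂ → ℂ} (hf : Integrable f) {δ R : ℝ} (hδ : 0 < δ) (hR : 0 < R)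
    {w x' : ℂ} (h : ‖w - x'‖ ≤ R) :
    ‖kconv (beurlingReg δ) ({y | R < ‖w - y‖}.indicator f) w‖ₑ
      ≤ regMax f w + 3072 * maxFn (fun y => ‖f y‖ₑ) x' := by
  have hm : 0 < max δ R := lt_max_of_lt_left hδ
  have hfar := hf.indicator (measurableSet_far w R)
  have i1 := integrable_kconv (decays_beurlingReg hδ) hfar w
  have i2 := integrable_kconv (decays_beurlingReg hm) hf w
  have e : kconv (beurlingReg δ) ({y | R < ‖w - y‖}.indicator f) w
      = kconv (beurlingReg (max δ R)) f w
        + ∫ y, ({ξ : ℂ | R < ‖w - ξ‖}.indicator (fun ξ => beurlingReg δ (w - ξ)) y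
            - beurlingReg (max δ R) (w - y)) * f y := by
    rw [← sub_eq_iff_eq_add', kconv, kconv, ← integral_sub i1 i2]
    refine integral_congr_ae (ae_of_all _ fun y => ?_)
    simp only [Set.indicator_apply]
    split_ifs <;> ring
  rw [e]
  refine (enorm_add_le _ _).trans (add_le_add (le_regMax _ _ hm) ?_)
  exact (enorm_integral_le_lintegral_enorm _).trans
    (lintegral_indicator_beurlingReg_sub_le hδ.le hR hf.aestronglyMeasurable h)

/-- The cut-off is centred at `w` for both evaluations, so only the smoothness of the kernel
matters; `6144 = 24 · 256`. -/
theorem enorm_kconv_far_sub_le {f : ℂ → ℂ} (hf : Integrable f) {δ r : ℝ} (hδ : 0 < δ) (hr : 0 < r)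
    {w x x' : ℂ} (h : ‖w - x'‖ ≤ r) (hx : ‖x - w‖ ≤ r) :
    ‖kconv (beurlingReg δ) ({y | 2 * r < ‖w - y‖}.indicator f) x
      - kconv (beurlingReg δ) ({y | 2 * r < ‖w - y‖}.indicator f) w‖ₑ
      ≤ 6144 * maxFn (fun y => ‖f y‖ₑ) x' := by
  have hfar := hf.indicator (measurableSet_far w (2 * r))
  have hk := decays_beurlingReg hδ
  rw [kconv, kconv, ← integral_sub (integrable_kconv hk hfar x) (integrable_kconv hk hfar w)]
  refine (enorm_integral_le_lintegral_enorm _).trans ?_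
  calc _ ≤ ∫⁻ y, 24 * (ENNReal.ofReal (tailKer r w y) * ‖f y‖ₑ) := by
        refine lintegral_mono fun y => ?_
        by_cases hy : 2 * r < ‖w - y‖
        · rw [Set.indicator_of_mem (by exact hy), ← sub_mul, enorm_mul, ← mul_assoc]
          gcongr
          rw [← ofReal_norm, ← ENNReal.ofReal_ofNat 24, ← ENNReal.ofReal_mul (by norm_num)]
          exact ENNReal.ofReal_le_ofReal
            (norm_beurlingReg_sub_le hδ hr (by simpa using hx) hy.le)
        · rw [Set.indicator_of_notMem (by exact hy)]
          simp
    _ ≤ 24 * (256 * maxFn (fun y => ‖f y‖ₑ) x') := by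
        rw [lintegral_const_mul' _ _ (by norm_num)]
        gcongr
        exact lintegral_tailKer_le hf.aestronglyMeasurable.enorm hr h
    _ = _ := by rw [← mul_assoc]; norm_num

/-- The inequality is localised to Whitney pieces of `{regMax f > a}`. On a piece meeting the
left-hand set, the part of `f` far from the piece is compared with a nearby point `w` outside, where
`regMax f ≤ a`; it therefore stays below `3 a / 2`. The near part must then exceed `a / 2`, and the
weak type bound makes this rare because the average of `|f|` there is at most `b a`. -/
theorem good_lambda {f : ℂ → ℂ} (hf : Integrable f) {a b : ℝ≥0∞} (ha0 : a ≠ 0) (hat : a ≠ ∞)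
    (hb : 9216 * (b * a) ≤ a / 2) :
    volume {x | 2 * a < regMax f x ∧ maxFn (fun y => ‖f y‖ₑ) x ≤ b * a}
      ≤ 20000 * regConst₁ * b * volume {x | a < regMax f x} := by
  set Ω : Set ℂ := {x | a < regMax f x} with hΩ
  have hfin : volume Ω ≠ ∞ := by
    intro h
    have hw := regMax_weak hf a
    rw [← hΩ, h, ENNReal.mul_top ha0, top_le_iff] at hw
    have h1 := regConst₁_ne_top
    have h2 : ∫⁻ y, ‖f y‖ₑ ≠ ∞ := hf.2.ne
    exact (by finiteness : regConst₁ * ∫⁻ y, ‖f y‖ₑ ≠ ∞) hw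
  obtain ⟨W⟩ := exists_whitneyCover (isOpen_lt_regMax hf a) hfin
  set E : Set ℂ := {x | 2 * a < regMax f x ∧ maxFn (fun y => ‖f y‖ₑ) x ≤ b * a} with hE
  have hEΩ : E ⊆ Ω := by
    intro x hx
    refine lt_of_le_of_lt ?_ hx.1
    rw [two_mul]; exact le_self_add
  have hpiece : ∀ i, volume (E ∩ W.Q i) ≤ 20000 * regConst₁ * b * volume (W.Q i) := by
    intro i
    rcases Set.eq_empty_or_nonempty (E ∩ W.Q i) with h | ⟨x', hx'E, hx'Q⟩
    · rw [h, measure_empty]; exact zero_le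
    obtain ⟨w, hw, hwi⟩ := W.exists_notMem i
    have hr := W.r_pos i
    have hball : ∀ x ∈ W.Q i, ‖x - w‖ ≤ 5 * W.r i := by
      intro x hx
      have h1 := W.subset i hx
      rw [Metric.mem_closedBall, dist_eq_norm] at h1
      have h2 := norm_sub_le_norm_sub_add_norm_sub x (W.c i) w
      rw [norm_sub_rev (W.c i) w] at h2
      linarith
    have hx'w : ‖w - x'‖ ≤ 5 * W.r i := by rw [norm_sub_rev]; exact hball x' hx'Q
    -- Points of the piece are within `5 r` of `w`, and the smoothness estimate needs the support of
    -- the far part to be at twice that distance.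
    set R := 2 * (5 * W.r i) with hR
    have hR0 : 0 < R := by positivity
    set f₂ : ℂ → ℂ := {y | R < ‖w - y‖}.indicator f with hf₂
    set f₁ : ℂ → ℂ := {y | R < ‖w - y‖}ᶜ.indicator f with hf₁
    have hi₂ : Integrable f₂ := hf.indicator (measurableSet_far w R)
    have hi₁ : Integrable f₁ := hf.indicator (measurableSet_far w R).compl
    have hsum : (fun y => f₁ y + f₂ y) = f := by
      ext y
      simp only [hf₁, hf₂]
      rw [add_comm]
      exact congrFun (Set.indicator_self_add_compl _ f) y
    have hfar : ∀ x ∈ W.Q i, regMax f₂ x ≤ a + a / 2 := by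
      intro x hx
      refine iSup₂_le fun δ hδ => ?_
      have h1 := enorm_kconv_far_sub_le hf hδ (by positivity : 0 < 5 * W.r i) hx'w (hball x hx)
      have h2 := enorm_kconv_far_le hf hδ hR0 (hx'w.trans (by linarith))
      have hMa := hx'E.2
      calc ‖kconv (beurlingReg δ) f₂ x‖ₑ
          = ‖(kconv (beurlingReg δ) f₂ x - kconv (beurlingReg δ) f₂ w)
              + kconv (beurlingReg δ) f₂ w‖ₑ := by rw [sub_add_cancel]
        _ ≤ 6144 * maxFn (fun y => ‖f y‖ₑ) x'
              + (regMax f w + 3072 * maxFn (fun y => ‖f y‖ₑ) x') :=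
            (enorm_add_le _ _).trans (add_le_add h1 h2)
        _ ≤ 6144 * (b * a) + (a + 3072 * (b * a)) := by
            gcongr
            exact not_lt.1 hw
        _ = a + 9216 * (b * a) := by ring
        _ ≤ _ := by gcongr
    have hsub : E ∩ W.Q i ⊆ {x | a / 2 < regMax f₁ x} := by
      intro x ⟨hxE, hxQ⟩
      have h1 := regMax_add_le hi₁ hi₂ x
      rw [hsum] at h1
      by_contra h
      simp only [Set.mem_ofPred_eq, not_lt] at h
      have h2 := hxE.1.trans_le (h1.trans (add_le_add h (hfar x hxQ)))
      rw [add_left_comm, ENNReal.add_halves, two_mul] at h2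
      exact lt_irrefl _ h2
    -- The ball of radius `2 R = 20 r` has 400 times the area of the Whitney ball, which is at most
    -- 25 times that of the piece.
    have hint : ∫⁻ y, ‖f₁ y‖ₑ ≤ 10000 * volume (W.Q i) * (b * a) := by
      have hv : volume (Metric.ball w (2 * R))
          = 400 * volume (Metric.closedBall (W.c i) (W.r i)) := by
        rw [Complex.volume_ball, Complex.volume_closedBall, hR, ← mul_assoc, ← mul_assoc,
          ENNReal.ofReal_mul (by norm_num), mul_pow]
        norm_num
        ring
      calc ∫⁻ y, ‖f₁ y‖ₑ = ∫⁻ y in {y | R < ‖w - y‖}ᶜ, ‖f y‖ₑ := by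
            rw [← lintegral_indicator (measurableSet_far w R).compl]
            refine lintegral_congr fun y => ?_
            simp only [hf₁]
            rw [enorm_indicator_eq_indicator_enorm]
        _ ≤ ∫⁻ y in Metric.ball w (2 * R), ‖f y‖ₑ := by
            refine lintegral_mono_set fun y hy => ?_
            simp only [Set.mem_compl_iff, Set.mem_ofPred_eq, not_lt] at hy
            rw [Metric.mem_ball, dist_eq_norm, norm_sub_rev]
            linarith
        _ ≤ volume (Metric.ball w (2 * R)) * maxFn (fun y => ‖f y‖ₑ) x' := by
            refine lintegral_ball_le_maxFn (fun y => ‖f y‖ₑ) ?_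
            rw [Metric.mem_ball, dist_eq_norm, norm_sub_rev]
            linarith
        _ ≤ 400 * (25 * volume (W.Q i)) * (b * a) := by
            rw [hv]
            gcongr
            · exact W.volume_le i
            · exact hx'E.2
        _ = _ := by ring
    have ha2 : a / 2 ≠ 0 := by simp [ha0]
    have ha2' : a / 2 ≠ ∞ := ENNReal.div_ne_top hat (by norm_num)
    refine (ENNReal.mul_le_mul_iff_right ha2 ha2').1 ?_
    have e2 : a = 2 * (a / 2) := by rw [ENNReal.mul_div_cancel (by norm_num) (by norm_num)]
    calc _ ≤ a / 2 * volume {x | a / 2 < regMax f₁ x} := by gcongr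
      _ ≤ regConst₁ * (10000 * volume (W.Q i) * (b * (2 * (a / 2)))) := by
          rw [← e2]
          exact (regMax_weak hi₁ _).trans (mul_le_mul_right hint _)
      _ = _ := by ring
  calc volume E ≤ volume (⋃ i, E ∩ W.Q i) := by
        refine measure_mono ?_
        rw [← Set.inter_iUnion, W.iUnion_eq]
        exact Set.subset_inter le_rfl hEΩ
    _ ≤ ∑' i, volume (E ∩ W.Q i) := measure_iUnion_le _
    _ ≤ ∑' i, 20000 * regConst₁ * b * volume (W.Q i) := ENNReal.tsum_le_tsum hpiece
    _ = _ := by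
        rw [ENNReal.tsum_mul_left, ← measure_iUnion W.disjoint W.measurableSet, W.iUnion_eq]

/-! ### Strong type estimates -/

/-- The parameter of the good-λ inequality. -/
noncomputable def goodParam (p : ℝ) : ℝ≥0∞ :=
  min (18432)⁻¹ ((2 ^ p)⁻¹ / 2 / (20000 * regConst₁ + 1))

theorem goodParam_ne_zero (p : ℝ) : goodParam p ≠ 0 := by
  have h := regConst₁_ne_top
  have h2 : (2 : ℝ≥0∞) ^ p ≠ ∞ := by finiteness
  have h3 : 20000 * regConst₁ + 1 ≠ ∞ := by finiteness
  unfold goodParam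
  refine (lt_min (by norm_num) ?_).ne'
  refine ENNReal.div_pos (ENNReal.div_pos ?_ (by norm_num)).ne' h3
  simp [h2]

theorem goodParam_ne_top (p : ℝ) : goodParam p ≠ ∞ :=
  ((min_le_left _ _).trans_lt (by norm_num)).ne

theorem goodParam_small (p : ℝ) (a : ℝ≥0∞) : 9216 * (goodParam p * a) ≤ a / 2 := by
  calc 9216 * (goodParam p * a) ≤ 9216 * ((18432)⁻¹ * a) := by
        gcongr; exact min_le_left _ _
    _ = a / 2 := by
        rw [← mul_assoc, ENNReal.div_eq_inv_mul]
        congr 1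
        rw [show (18432 : ℝ≥0∞) = 9216 * 2 by norm_num,
          ENNReal.mul_inv (by norm_num) (by norm_num), ← mul_assoc,
          ENNReal.mul_inv_cancel (by norm_num) (by norm_num), one_mul]

/-- Doubling the level costs a factor `2^(-p)` in the `p`-th moment; half of it is kept free, so
that the good-λ term can be absorbed. -/
theorem mul_goodParam_le (p : ℝ) : 20000 * regConst₁ * goodParam p ≤ (2 ^ p)⁻¹ / 2 := by
  have h := regConst₁_ne_top
  calc _ ≤ (20000 * regConst₁ + 1) * ((2 ^ p)⁻¹ / 2 / (20000 * regConst₁ + 1)) := by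
        gcongr
        · exact le_self_add
        · exact min_le_right _ _
    _ = _ := ENNReal.mul_div_cancel (by simp) (by finiteness)

/-- The constant in the strong type estimate for the maximal operator. -/
noncomputable def regConst (p : ℝ) : ℝ≥0∞ :=
  2 * 2 ^ p * ((goodParam p)⁻¹ ^ p * maxConst p)

theorem regConst_ne_top {p : ℝ} (hp : 1 < p) : regConst p ≠ ∞ := by
  have h1 := maxConst_ne_top hp
  have h2 : (goodParam p)⁻¹ ≠ ∞ := by simpa using goodParam_ne_zero p
  have h3 : (2 : ℝ≥0∞) ^ p ≠ ∞ := by finiteness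
  have h4 : (goodParam p)⁻¹ ^ p ≠ ∞ := ENNReal.rpow_ne_top_of_nonneg (by linarith) h2
  unfold regConst
  finiteness

/-- A priori finiteness, required for absorption. The truncation bounds the levels above, and near
level zero the weak type bound leaves the density `s^(p-2)`, integrable because `p > 1`. -/
theorem lintegral_min_regMax_lt_top {f : ℂ → ℂ} (hf : Integrable f) {p : ℝ} (hp : 1 < p) (N : ℕ) :
    ∫⁻ x, min (regMax f x) N ^ p < ∞ := by
  have hm : Measurable fun x => min (regMax f x) (N : ℝ≥0∞) :=
    (measurable_regMax hf).min measurable_const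
  have hC := regConst₁_ne_top
  have hF : ∫⁻ y, ‖f y‖ₑ ≠ ∞ := hf.2.ne
  set D : ℝ≥0∞ := ENNReal.ofReal (p / (p - 1)) * (regConst₁ * ∫⁻ y, ‖f y‖ₑ) with hD
  have hDt : D ≠ ∞ := by finiteness
  rw [lintegral_rpow_eq volume (by linarith) hm]
  calc _ ≤ ∫⁻ s in Set.Ioi (0 : ℝ), (Set.Ioc 0 (N : ℝ)).indicator
          (fun s => D * powDens (p - 1) s) s := by
        refine setLIntegral_mono_ae' measurableSet_Ioi (ae_of_all _ fun s hs => ?_)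
        have hs0 : 0 < s := hs
        by_cases hsN : s ≤ N
        · rw [Set.indicator_of_mem (by exact ⟨hs0, hsN⟩), powDens_eq hp hs0]
          calc _ = ENNReal.ofReal (p / (p - 1)) * powDens (p - 1) s *
                (ENNReal.ofReal s * volume {x | ENNReal.ofReal s < min (regMax f x) N}) := by ring
            _ ≤ ENNReal.ofReal (p / (p - 1)) * powDens (p - 1) s *
                (regConst₁ * ∫⁻ y, ‖f y‖ₑ) := by
                refine mul_le_mul_right (le_trans ?_ (regMax_weak hf (ENNReal.ofReal s))) _
                gcongr
                exact min_le_left _ _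
            _ = _ := by rw [hD]; ring
        · rw [Set.indicator_of_notMem (by simp [hsN])]
          have : {x | ENNReal.ofReal s < min (regMax f x) N} = ∅ := by
            ext x
            simp only [Set.mem_ofPred_eq, Set.mem_empty_iff_false, iff_false, not_lt]
            refine (min_le_right _ _).trans ?_
            rw [← ENNReal.ofReal_natCast]
            exact ENNReal.ofReal_le_ofReal (not_le.1 hsN).le
          rw [this, measure_empty, mul_zero]
    _ ≤ ∫⁻ s in Set.Ioc 0 (N : ℝ), D * powDens (p - 1) s := by
        rw [← lintegral_indicator measurableSet_Ioc]
        exact setLIntegral_le_lintegral _ _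
    _ = D * ENNReal.ofReal ((N : ℝ) ^ (p - 1)) := by
        rw [lintegral_const_mul' _ _ hDt, lintegral_powDens_Ioc (by linarith) (by positivity)]
    _ < ∞ := by finiteness

/-- The good-λ inequality is integrated over all levels. It survives truncation: below `N` the upper
level sets of `H` and of `regMax f` coincide, and above `N` there is nothing to prove. -/
theorem lintegral_min_regMax_le {f : ℂ → ℂ} (hf : Integrable f) {p : ℝ} (hp : 1 < p) (N : ℕ) :
    ∫⁻ x, min (regMax f x) N ^ p ≤ regConst p * ∫⁻ x, ‖f x‖ₑ ^ p := by
  have hp0 : 0 < p := by linarith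
  set H : ℂ → ℝ≥0∞ := fun x => min (regMax f x) N with hH
  set M : ℂ → ℝ≥0∞ := maxFn fun y => ‖f y‖ₑ with hM
  set γ := goodParam p
  have hγ0 : γ ≠ 0 := goodParam_ne_zero p
  have hγt : γ ≠ ∞ := goodParam_ne_top p
  have hm : Measurable H := (measurable_regMax hf).min measurable_const
  have h2p0 : (2 : ℝ≥0∞) ^ p ≠ 0 := by simp
  have h2pt : (2 : ℝ≥0∞) ^ p ≠ ∞ := by finiteness
  have hfin : ∫⁻ x, H x ^ p ≠ ∞ := (lintegral_min_regMax_lt_top hf hp N).ne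
  have hV : ∀ s : ℝ, 0 < s → volume {x | ENNReal.ofReal s < 2⁻¹ * H x}
      ≤ (2 ^ p)⁻¹ / 2 * volume {x | ENNReal.ofReal s < H x}
        + volume {x | ENNReal.ofReal s < γ⁻¹ * M x} := by
    intro s hs
    set a := ENNReal.ofReal s with ha
    have ha0 : a ≠ 0 := by simpa [ha] using hs
    have hat : a ≠ ∞ := ENNReal.ofReal_ne_top
    by_cases hsN : a < N
    · have hsub : {x | a < 2⁻¹ * H x} ⊆ {x | 2 * a < regMax f x ∧ M x ≤ γ * a}
          ∪ {x | a < γ⁻¹ * M x} := by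
        intro x hx
        have h1 : 2 * a < regMax f x := by
          have h2 : a < 2⁻¹ * H x := hx
          rw [mul_comm, ← div_eq_mul_inv, ENNReal.lt_div_iff_mul_lt (by simp) (by simp)] at h2
          rw [mul_comm]
          exact h2.trans_le (min_le_left _ _)
        by_cases h : M x ≤ γ * a
        · exact Or.inl ⟨h1, h⟩
        · right
          simp only [Set.mem_ofPred_eq]
          rw [mul_comm, ← div_eq_mul_inv, ENNReal.lt_div_iff_mul_lt (by simp [hγ0]) (by simp [hγt]),
            mul_comm]
          exact not_le.1 h
      have hset : {x | a < H x} = {x | a < regMax f x} := by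
        ext x; simp [hH, hsN]
      rw [hset]
      calc _ ≤ volume {x | 2 * a < regMax f x ∧ M x ≤ γ * a} + volume {x | a < γ⁻¹ * M x} :=
            (measure_mono hsub).trans (measure_union_le _ _)
        _ ≤ _ := by
            refine add_le_add ((good_lambda hf ha0 hat (goodParam_small p a)).trans ?_) le_rfl
            exact mul_le_mul_left (mul_goodParam_le p) _
    · have : {x | a < 2⁻¹ * H x} = ∅ := by
        ext x
        simp only [Set.mem_ofPred_eq, Set.mem_empty_iff_false, iff_false, not_lt]
        calc 2⁻¹ * H x ≤ 1 * N := by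
              gcongr
              · norm_num
              · exact min_le_right _ _
          _ ≤ a := by rw [one_mul]; exact not_lt.1 hsN
      rw [this, measure_empty]
      exact zero_le
  have key : (2 ^ p)⁻¹ * ∫⁻ x, H x ^ p ≤ ((2 ^ p)⁻¹ / 2 * ∫⁻ x, H x ^ p)
      + γ⁻¹ ^ p * ∫⁻ x, M x ^ p := by
    have hγi : γ⁻¹ ^ p ≠ ∞ := ENNReal.rpow_ne_top_of_nonneg hp0.le (by simpa using hγ0)
    calc (2 ^ p)⁻¹ * ∫⁻ x, H x ^ p = ∫⁻ x, (2⁻¹ * H x) ^ p := by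
          simp_rw [ENNReal.mul_rpow_of_nonneg _ _ hp0.le]
          rw [lintegral_const_mul' _ _ (by simp), ENNReal.inv_rpow]
      _ = ∫⁻ s in Set.Ioi (0 : ℝ), powDens p s * volume {x | ENNReal.ofReal s < 2⁻¹ * H x} :=
          lintegral_rpow_eq volume hp0 (hm.const_mul _)
      _ ≤ ∫⁻ s in Set.Ioi (0 : ℝ), ((2 ^ p)⁻¹ / 2 * (powDens p s *
            volume {x | ENNReal.ofReal s < H x})
            + powDens p s * volume {x | ENNReal.ofReal s < γ⁻¹ * M x}) := by
          refine setLIntegral_mono_ae' measurableSet_Ioi (ae_of_all _ fun s hs => ?_)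
          calc _ ≤ powDens p s * ((2 ^ p)⁻¹ / 2 * volume {x | ENNReal.ofReal s < H x}
                + volume {x | ENNReal.ofReal s < γ⁻¹ * M x}) := mul_le_mul_right (hV s hs) _
            _ = _ := by ring
      _ = _ := by
          have hmeas : Measurable fun s => volume {x | ENNReal.ofReal s < γ⁻¹ * M x} := by
            refine Antitone.measurable fun s t hst => measure_mono fun x hx => ?_
            exact (ENNReal.ofReal_le_ofReal hst).trans_lt hx
          have hmeas' : Measurable fun s => powDens p s *
            volume {x | ENNReal.ofReal s < γ⁻¹ * M x} := (measurable_powDens p).mul hmeas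
          rw [lintegral_add_right _ hmeas', lintegral_const_mul',
            ← lintegral_rpow_eq volume hp0 hm,
            ← lintegral_rpow_eq volume hp0 ((measurable_maxFn _).const_mul _)]
          · simp_rw [ENNReal.mul_rpow_of_nonneg _ _ hp0.le]
            rw [lintegral_const_mul' _ _ hγi]
          · exact ENNReal.div_ne_top (by simp) (by norm_num)
  set I := ∫⁻ x, H x ^ p
  -- Half of the left-hand side is cancelled against the right, which is legitimate because `I` is
  -- finite.
  have hhalf : (2 ^ p)⁻¹ / 2 * I ≤ γ⁻¹ ^ p * ∫⁻ x, M x ^ p := by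
    have e : (2 ^ p)⁻¹ * I = (2 ^ p)⁻¹ / 2 * I + (2 ^ p)⁻¹ / 2 * I := by
      rw [← add_mul, ENNReal.add_halves]
    rw [e] at key
    refine (ENNReal.add_le_add_iff_left (a := (2 ^ p)⁻¹ / 2 * I) ?_).1 key
    have : (2 ^ p : ℝ≥0∞)⁻¹ / 2 ≠ ∞ := ENNReal.div_ne_top (by simp) (by norm_num)
    finiteness
  calc I = 2 * 2 ^ p * ((2 ^ p)⁻¹ / 2 * I) := by
        rw [← mul_assoc, div_eq_mul_inv]
        have : (2 * 2 ^ p * ((2 ^ p)⁻¹ * 2⁻¹) : ℝ≥0∞) = 1 := by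
          rw [mul_assoc, ← mul_assoc (2 ^ p), ENNReal.mul_inv_cancel h2p0 h2pt, one_mul,
            ENNReal.mul_inv_cancel (by norm_num) (by norm_num)]
        rw [this, one_mul]
    _ ≤ 2 * 2 ^ p * (γ⁻¹ ^ p * (maxConst p * ∫⁻ x, ‖f x‖ₑ ^ p)) := by
        refine mul_le_mul_right (hhalf.trans (mul_le_mul_right ?_ _)) _
        exact maxFn_strong_ae hf.aestronglyMeasurable.enorm hp
    _ = _ := by rw [regConst]; ring

theorem regMax_strong {f : ℂ → ℂ} (hf : Integrable f) {p : ℝ} (hp : 1 < p) :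
    ∫⁻ x, regMax f x ^ p ≤ regConst p * ∫⁻ x, ‖f x‖ₑ ^ p := by
  have hp0 : 0 < p := by linarith
  have h : ∀ x, regMax f x ^ p = ⨆ N : ℕ, min (regMax f x) (N : ℝ≥0∞) ^ p := by
    intro x
    refine le_antisymm ?_ (iSup_le fun N => ENNReal.rpow_le_rpow (min_le_left _ _) hp0.le)
    rw [← ENNReal.le_rpow_inv_iff hp0]
    refine le_of_forall_lt fun c hc => ?_
    obtain ⟨N, hN⟩ := ENNReal.exists_nat_gt (hc.trans_le le_top).ne
    have h1 : c < min (regMax f x) N := lt_min hc hN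
    refine h1.trans_le ?_
    rw [ENNReal.le_rpow_inv_iff hp0]
    exact le_iSup (fun N : ℕ => min (regMax f x) (N : ℝ≥0∞) ^ p) N
  simp_rw [h]
  rw [lintegral_iSup]
  · exact iSup_le fun N => lintegral_min_regMax_le hf hp N
  · exact fun N => ((measurable_regMax hf).min measurable_const).pow_const _
  · intro m n hmn x
    simp only
    gcongr

end BeurlingWeight

namespace BeurlingWeight

open ComplexConjugate

/-! ### The truncated Beurling transforms -/

theorem beurlingReg_zero (z : ℂ) : beurlingReg 0 z = (z ^ 2)⁻¹ := by
  rcases eq_or_ne z 0 with rfl | hz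
  · simp [beurlingReg, cauchyReg]
  · have : conj z ≠ 0 := by simpa using hz
    rw [beurlingReg, cauchyReg, regDen]
    simp only [Complex.ofReal_zero]
    field_simp
    ring

theorem norm_inv_sq_le {δ : ℝ} (hδ : 0 < δ) {w : ℂ} (hw : δ < ‖w‖) : ‖(w ^ 2)⁻¹‖ ≤ (δ ^ 2)⁻¹ := by
  rw [norm_inv, norm_pow]
  gcongr

theorem indicator_far_mul (δ : ℝ) (f : ℂ → ℂ) (z ξ : ℂ) :
    {ξ : ℂ | δ < ‖z - ξ‖}.indicator (fun ξ => f ξ / (z - ξ) ^ 2) ξ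
      = {ξ : ℂ | δ < ‖z - ξ‖}.indicator (fun ξ => ((z - ξ) ^ 2)⁻¹) ξ * f ξ := by
  simp only [Set.indicator_apply]
  split_ifs
  · rw [div_eq_mul_inv, mul_comm]
  · simp

theorem norm_indicator_far_le {δ : ℝ} (hδ : 0 < δ) (z ξ : ℂ) :
    ‖{ξ : ℂ | δ < ‖z - ξ‖}.indicator (fun ξ => ((z - ξ) ^ 2)⁻¹) ξ‖ ≤ (δ ^ 2)⁻¹ := by
  by_cases h : δ < ‖z - ξ‖
  · rw [Set.indicator_of_mem (by exact h)]
    exact norm_inv_sq_le hδ h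
  · rw [Set.indicator_of_notMem (by exact h), norm_zero]
    positivity

theorem measurable_indicator_far (δ : ℝ) (z : ℂ) :
    Measurable ({ξ : ℂ | δ < ‖z - ξ‖}.indicator (fun ξ => ((z - ξ) ^ 2)⁻¹)) := by
  refine Measurable.indicator ?_ (measurableSet_far z δ)
  fun_prop

theorem integrable_indicator_far {f : ℂ → ℂ} (hf : Integrable f) {δ : ℝ} (hδ : 0 < δ) (z : ℂ) :
    Integrable fun ξ => {ξ : ℂ | δ < ‖z - ξ‖}.indicator (fun ξ => ((z - ξ) ^ 2)⁻¹) ξ * f ξ :=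
  hf.bdd_mul (measurable_indicator_far δ z).aestronglyMeasurable
    (ae_of_all _ fun ξ => norm_indicator_far_le hδ z ξ)

theorem integrableOn_far {f : ℂ → ℂ} (hf : Integrable f) {δ : ℝ} (hδ : 0 < δ) (z : ℂ) :
    IntegrableOn (fun ξ => f ξ / (z - ξ) ^ 2) {ξ : ℂ | δ < ‖z - ξ‖} := by
  rw [← integrable_indicator_iff (measurableSet_far z δ)]
  exact (integrable_indicator_far hf hδ z).congr
    (ae_of_all _ fun ξ => (indicator_far_mul δ f z ξ).symm)

theorem truncBeurling_eq (δ : ℝ) (f : ℂ → ℂ) (z : ℂ) : truncBeurling δ f z = (-1 / (Real.pi : ℂ)) *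
    ∫ ξ, {ξ : ℂ | δ < ‖z - ξ‖}.indicator (fun ξ => ((z - ξ) ^ 2)⁻¹) ξ * f ξ := by
  rw [truncBeurling, ← integral_indicator (measurableSet_far z δ)]
  simp_rw [indicator_far_mul]

theorem enorm_neg_inv_pi_le : ‖(-1 / (Real.pi : ℂ))‖ₑ ≤ 1 := by
  rw [← ofReal_norm, ← ENNReal.ofReal_one]
  apply ENNReal.ofReal_le_ofReal
  rw [norm_div, norm_neg, norm_one, Complex.norm_real, Real.norm_of_nonneg Real.pi_pos.le,
    div_le_one Real.pi_pos]
  linarith [Real.pi_gt_three]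

/-- The truncated kernel is the kernel with regularisation parameter `0` cut off at scale `δ`, hence
equals the kernel regularised at `δ` up to a tail controlled by the maximal function. -/
theorem enorm_truncBeurling_le {f : ℂ → ℂ} (hf : Integrable f) {δ : ℝ} (hδ : 0 < δ) (z : ℂ) :
    ‖truncBeurling δ f z‖ₑ ≤ regMax f z + 3072 * maxFn (fun y => ‖f y‖ₑ) z := by
  have i1 := integrable_indicator_far hf hδ z
  have i2 := integrable_kconv (decays_beurlingReg hδ) hf z
  have e : ∫ ξ, {ξ : ℂ | δ < ‖z - ξ‖}.indicator (fun ξ => ((z - ξ) ^ 2)⁻¹) ξ * f ξ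
      = kconv (beurlingReg δ) f z
        + ∫ y, ({ξ : ℂ | δ < ‖z - ξ‖}.indicator (fun ξ => beurlingReg 0 (z - ξ)) y
            - beurlingReg (max 0 δ) (z - y)) * f y := by
    simp_rw [beurlingReg_zero]
    rw [← sub_eq_iff_eq_add', kconv, ← integral_sub i1 i2, max_eq_right hδ.le]
    simp_rw [sub_mul]
  rw [truncBeurling_eq, enorm_mul, e]
  refine (mul_le_mul_left enorm_neg_inv_pi_le _).trans ?_
  rw [one_mul]
  refine (enorm_add_le _ _).trans (add_le_add (le_regMax _ _ hδ) ?_)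
  exact (enorm_integral_le_lintegral_enorm _).trans
    (lintegral_indicator_beurlingReg_sub_le le_rfl hδ hf.aestronglyMeasurable
      (by simpa using hδ.le))

theorem maxBeurling_le {f : ℂ → ℂ} (hf : Integrable f) (z : ℂ) :
    maxBeurling f z ≤ regMax f z + 3072 * maxFn (fun y => ‖f y‖ₑ) z :=
  iSup₂_le fun _ hδ => enorm_truncBeurling_le hf hδ z

/-- The cut-off jumps only on the circle of radius `δ` about the point, a null set, so dominated
convergence applies. -/
theorem continuous_truncBeurling {f : ℂ → ℂ} (hf : Integrable f) {δ : ℝ} (hδ : 0 < δ) :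
    Continuous (truncBeurling δ f) := by
  have h : Continuous fun z =>
      ∫ ξ, {ξ : ℂ | δ < ‖z - ξ‖}.indicator (fun ξ => ((z - ξ) ^ 2)⁻¹) ξ * f ξ := by
    refine continuous_iff_continuousAt.2 fun z₀ => ?_
    refine continuousAt_of_dominated (bound := fun ξ => (δ ^ 2)⁻¹ * ‖f ξ‖)
      (Eventually.of_forall fun z => (integrable_indicator_far hf hδ z).aestronglyMeasurable)
      (Eventually.of_forall fun z => ae_of_all _ fun ξ => ?_) (hf.norm.const_mul _) ?_
    · rw [norm_mul]; gcongr; exact norm_indicator_far_le hδ z ξ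
    · have hs : ∀ᵐ ξ : ℂ, ξ ∉ Metric.sphere z₀ δ :=
        measure_eq_zero_iff_ae_notMem.1 (Measure.addHaar_sphere volume z₀ δ)
      filter_upwards [hs] with ξ hξ
      rw [Metric.mem_sphere, dist_eq_norm, norm_sub_rev] at hξ
      refine ContinuousAt.mul ?_ continuousAt_const
      rcases lt_or_gt_of_ne hξ with h | h
      · have hev : ∀ᶠ z in 𝓝 z₀, ‖z - ξ‖ < δ :=
          (isOpen_lt (by fun_prop) continuous_const).mem_nhds h
        refine (continuousAt_const (y := (0 : ℂ))).congr ?_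
        filter_upwards [hev] with z hz
        rw [Set.indicator_of_notMem]
        exact not_lt.2 hz.le
      · have hev : ∀ᶠ z in 𝓝 z₀, δ < ‖z - ξ‖ :=
          (isOpen_lt continuous_const (by fun_prop)).mem_nhds h
        have hne : (z₀ - ξ) ^ 2 ≠ 0 := pow_ne_zero _ (norm_pos_iff.1 (hδ.trans h))
        refine (ContinuousAt.inv₀ (f := fun z : ℂ => (z - ξ) ^ 2) (by fun_prop) hne).congr ?_
        filter_upwards [hev] with z hz
        rw [Set.indicator_of_mem (by exact hz)]
        rfl
  have e : truncBeurling δ f = fun z => (-1 / (Real.pi : ℂ)) *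
      ∫ ξ, {ξ : ℂ | δ < ‖z - ξ‖}.indicator (fun ξ => ((z - ξ) ^ 2)⁻¹) ξ * f ξ :=
    funext fun z => truncBeurling_eq δ f z
  rw [e]
  exact continuous_const.mul h

theorem lt_maxBeurling_iff {f : ℂ → ℂ} {x : ℂ} {a : ℝ≥0∞} :
    a < maxBeurling f x ↔ ∃ δ : ℝ, 0 < δ ∧ a < ‖truncBeurling δ f x‖ₑ := by
  simp only [maxBeurling, lt_iSup_iff, exists_prop]

theorem measurable_maxBeurling {f : ℂ → ℂ} (hf : Integrable f) : Measurable (maxBeurling f) := by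
  refine measurable_of_Ioi fun a => IsOpen.measurableSet ?_
  have : maxBeurling f ⁻¹' Set.Ioi a
      = ⋃ (δ : ℝ) (_ : 0 < δ), {x | a < ‖truncBeurling δ f x‖ₑ} := by
    ext x; simp [lt_maxBeurling_iff]
  rw [this]
  refine isOpen_iUnion fun δ => isOpen_iUnion fun hδ => ?_
  exact isOpen_lt continuous_const (continuous_truncBeurling hf hδ).enorm

/-- The constant in the unweighted weak type estimate. -/
noncomputable def beurConst₁ : ℝ≥0∞ := 2 * regConst₁ + 24576 * besN

theorem beurConst₁_ne_top : beurConst₁ ≠ ∞ := by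
  have := regConst₁_ne_top
  unfold beurConst₁
  finiteness

theorem maxBeurling_weak {f : ℂ → ℂ} (hf : Integrable f) (a : ℝ≥0∞) :
    a * volume {x | a < maxBeurling f x} ≤ beurConst₁ * ∫⁻ y, ‖f y‖ₑ := by
  set F := ∫⁻ y, ‖f y‖ₑ
  set M : ℂ → ℝ≥0∞ := maxFn fun y => ‖f y‖ₑ
  have hsub : {x | a < maxBeurling f x} ⊆ {x | a / 2 < regMax f x} ∪ {x | a / 6144 < M x} := by
    intro x hx
    by_contra h
    simp only [Set.mem_union, Set.mem_ofPred_eq, not_or, not_lt] at h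
    have h1 : a < maxBeurling f x := hx
    have h2 := h1.trans_le ((maxBeurling_le hf x).trans
      (add_le_add h.1 (mul_le_mul_right h.2 _)))
    have h3 : (3072 : ℝ≥0∞) * (a / 6144) = a / 2 := by
      rw [show (6144 : ℝ≥0∞) = 3072 * 2 by norm_num]
      rw [div_eq_mul_inv, ENNReal.mul_inv (by simp) (by simp), mul_left_comm, ← mul_assoc 3072,
        ENNReal.mul_inv_cancel (by simp) (by simp), one_mul, div_eq_mul_inv]
    rw [h3, ENNReal.add_halves] at h2
    exact lt_irrefl _ h2
  have h1 := regMax_weak hf (a / 2)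
  have h2 := maxFn_weak (fun y => ‖f y‖ₑ) (a / 6144)
  calc _ ≤ a * (volume {x | a / 2 < regMax f x} + volume {x | a / 6144 < M x}) := by
        gcongr
        exact (measure_mono hsub).trans (measure_union_le _ _)
    _ = 2 * (a / 2 * volume {x | a / 2 < regMax f x})
          + 6144 * (a / 6144 * volume {x | a / 6144 < M x}) := by
        rw [mul_add, ← mul_assoc, ← mul_assoc,
          ENNReal.mul_div_cancel (by norm_num) (by norm_num),
          ENNReal.mul_div_cancel (by norm_num) (by norm_num)]
    _ ≤ 2 * (regConst₁ * F) + 6144 * (4 * besN * F) := by gcongr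
    _ = _ := by rw [beurConst₁]; ring

/-- The constant in the unweighted strong type estimate. -/
noncomputable def beurConst (p : ℝ) : ℝ≥0∞ :=
  2 ^ (p - 1) * (regConst p + 3072 ^ p * maxConst p)

theorem beurConst_ne_top {p : ℝ} (hp : 1 < p) : beurConst p ≠ ∞ := by
  have h1 := regConst_ne_top hp
  have h2 := maxConst_ne_top hp
  have h3 : (2 : ℝ≥0∞) ^ (p - 1) ≠ ∞ := ENNReal.rpow_ne_top_of_nonneg (by linarith) (by norm_num)
  have h4 : (3072 : ℝ≥0∞) ^ p ≠ ∞ := ENNReal.rpow_ne_top_of_nonneg (by linarith) (by norm_num)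
  unfold beurConst
  finiteness

theorem maxBeurling_strong {f : ℂ → ℂ} (hf : Integrable f) {p : ℝ} (hp : 1 < p) :
    ∫⁻ x, maxBeurling f x ^ p ≤ beurConst p * ∫⁻ x, ‖f x‖ₑ ^ p := by
  have hp0 : 0 < p := by linarith
  have h2t : (2 : ℝ≥0∞) ^ (p - 1) ≠ ∞ := ENNReal.rpow_ne_top_of_nonneg (by linarith) (by norm_num)
  calc _ ≤ ∫⁻ x, 2 ^ (p - 1) * (regMax f x ^ p +
          3072 ^ p * maxFn (fun y => ‖f y‖ₑ) x ^ p) := by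
        refine lintegral_mono fun x => ?_
        refine (ENNReal.rpow_le_rpow (maxBeurling_le hf x) hp0.le).trans ?_
        rw [← ENNReal.mul_rpow_of_nonneg _ _ hp0.le]
        exact ENNReal.rpow_add_le_mul_rpow_add_rpow _ _ hp.le
    _ = 2 ^ (p - 1) * ((∫⁻ x, regMax f x ^ p) +
          3072 ^ p * ∫⁻ x, maxFn (fun y => ‖f y‖ₑ) x ^ p) := by
        rw [lintegral_const_mul' _ _ h2t, lintegral_add_left ((measurable_regMax hf).pow_const _),
          lintegral_const_mul' _ _ (ENNReal.rpow_ne_top_of_nonneg hp0.le (by norm_num))]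
    _ ≤ 2 ^ (p - 1) * ((regConst p * ∫⁻ x, ‖f x‖ₑ ^ p) +
          3072 ^ p * (maxConst p * ∫⁻ x, ‖f x‖ₑ ^ p)) := by
        gcongr
        · exact regMax_strong hf hp
        · exact maxFn_strong_ae hf.aestronglyMeasurable.enorm hp
    _ = _ := by rw [beurConst]; ring

/-! ### Existence of principal values -/

theorem truncBeurling_sub_eq {f : ℂ → ℂ} (hf : Integrable f) {δ δ' : ℝ} (hδ : 0 < δ) (h : δ ≤ δ')
    (z : ℂ) : truncBeurling δ f z - truncBeurling δ' f z = (-1 / (Real.pi : ℂ)) *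
      ∫ ξ in {ξ : ℂ | δ < ‖z - ξ‖} \ {ξ : ℂ | δ' < ‖z - ξ‖}, f ξ / (z - ξ) ^ 2 := by
  rw [setIntegral_sdiff (measurableSet_far z δ') (integrableOn_far hf hδ z)
    fun ξ hξ => h.trans_lt hξ, truncBeurling, truncBeurling, mul_sub]

/-- A quarter turn preserves the annulus and changes the sign of `w⁻²`. -/
theorem integral_annulus_inv_sq (δ δ' : ℝ) (z : ℂ) :
    ∫ ξ in {ξ : ℂ | δ < ‖z - ξ‖} \ {ξ : ℂ | δ' < ‖z - ξ‖}, ((z - ξ) ^ 2)⁻¹ = 0 := by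
  have hm : MeasurableSet ({ξ : ℂ | δ < ‖z - ξ‖} \ {ξ : ℂ | δ' < ‖z - ξ‖}) :=
    (measurableSet_far z δ).diff (measurableSet_far z δ')
  set g : ℂ → ℂ := ({w : ℂ | δ < ‖w‖} \ {w : ℂ | δ' < ‖w‖}).indicator fun w => (w ^ 2)⁻¹ with hg
  have e : ∫ ξ in {ξ : ℂ | δ < ‖z - ξ‖} \ {ξ : ℂ | δ' < ‖z - ξ‖}, ((z - ξ) ^ 2)⁻¹
      = ∫ w, g w := by
    rw [← integral_sub_left_eq_self g volume z, ← integral_indicator hm]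
    refine integral_congr_ae (ae_of_all _ fun ξ => ?_)
    simp [hg, Set.indicator_apply]
  rw [e]
  set u : Circle := Circle.exp (Real.pi / 2)
  have hu : (u : ℂ) = Complex.I := by
    simp only [u, Circle.coe_exp]
    push_cast
    exact Complex.exp_pi_div_two_mul_I
  have hrot := (rotation u).measurePreserving.integral_comp
    (rotation u).toHomeomorph.measurableEmbedding g
  have hneg : ∀ w, g (rotation u w) = -g w := by
    intro w
    rw [rotation_apply, hu]
    simp only [hg, Set.indicator_apply, Set.mem_sdiff, Set.mem_ofPred_eq, norm_mul, Complex.norm_I,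
      one_mul]
    split_ifs
    · rw [mul_pow, Complex.I_sq, neg_one_mul, inv_neg]
    · simp
  simp_rw [hneg] at hrot
  rw [integral_neg] at hrot
  exact self_eq_neg.1 hrot.symm

theorem lintegral_ball_inv_norm_le {R : ℝ} (hR : 0 ≤ R) :
    ∫⁻ w in {w : ℂ | ‖w‖ ≤ R}, (‖w‖ₑ)⁻¹ ≤ ENNReal.ofReal (2 * Real.pi * R) := by
  have hm : MeasurableSet {w : ℂ | ‖w‖ ≤ R} :=
    (isClosed_le continuous_norm continuous_const).measurableSet
  rw [← lintegral_indicator hm, ← Complex.lintegral_comp_polarCoord_symm]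
  calc _ ≤ ∫⁻ p in polarCoord.target, (Set.Ioc 0 R ×ˢ Set.Ioo (-Real.pi) Real.pi).indicator 1 p := by
        refine setLIntegral_mono_ae' polarCoord.open_target.measurableSet (ae_of_all _ fun p hp => ?_)
        rw [polarCoord_target] at hp
        have h0 : 0 < p.1 := hp.1
        by_cases hpR : p.1 ≤ R
        · rw [Set.indicator_of_mem (by
            simpa [Complex.norm_polarCoord_symm, abs_of_pos h0] using hpR),
            Set.indicator_of_mem (by exact ⟨⟨h0, hpR⟩, hp.2⟩), ← ofReal_norm,
            Complex.norm_polarCoord_symm, abs_of_pos h0, smul_eq_mul, Pi.one_apply,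
            ENNReal.mul_inv_cancel (by simpa using h0) ENNReal.ofReal_ne_top]
        · rw [Set.indicator_of_notMem (by
            simpa [Complex.norm_polarCoord_symm, abs_of_pos h0] using hpR)]
          simp
    _ ≤ ∫⁻ p, (Set.Ioc 0 R ×ˢ Set.Ioo (-Real.pi) Real.pi).indicator 1 p :=
        setLIntegral_le_lintegral _ _
    _ = _ := by
        rw [lintegral_indicator_one (measurableSet_Ioc.prod measurableSet_Ioo),
          Measure.volume_eq_prod, Measure.prod_prod, Real.volume_Ioc, Real.volume_Ioo,
          ← ENNReal.ofReal_mul (by linarith)]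
        congr 1
        ring

/-- The kernel has zero integral over annuli, so `g z` may be subtracted; the Lipschitz bound then
leaves the locally integrable kernel `1 / |z - ξ|`, whose integral over a disc of radius `δ'` is of
order `δ'`. -/
theorem enorm_truncBeurling_sub_le_of_lipschitz {g : ℂ → ℂ} (hg : Integrable g) {L : ℝ≥0}
    (hL : LipschitzWith L g) {δ δ' : ℝ} (hδ : 0 < δ) (h : δ ≤ δ') (z : ℂ) :
    ‖truncBeurling δ g z - truncBeurling δ' g z‖ₑ ≤ L * ENNReal.ofReal (2 * Real.pi * δ') := by
  have hm : MeasurableSet ({ξ : ℂ | δ < ‖z - ξ‖} \ {ξ : ℂ | δ' < ‖z - ξ‖}) :=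
    (measurableSet_far z δ).diff (measurableSet_far z δ')
  set A := {ξ : ℂ | δ < ‖z - ξ‖} \ {ξ : ℂ | δ' < ‖z - ξ‖} with hA
  have hAfin : volume A < ∞ := by
    refine (measure_mono fun ξ hξ => ?_).trans_lt
      (measure_closedBall_lt_top (x := z) (r := δ'))
    rw [Metric.mem_closedBall, dist_eq_norm, norm_sub_rev]
    exact not_lt.1 hξ.2
  have i1 : IntegrableOn (fun ξ => g ξ / (z - ξ) ^ 2) A :=
    (integrableOn_far hg hδ z).mono_set Set.sdiff_subset
  have i2 : IntegrableOn (fun ξ => g z * ((z - ξ) ^ 2)⁻¹) A := by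
    refine Integrable.const_mul ?_ _
    refine Measure.integrableOn_of_bounded (M := (δ ^ 2)⁻¹) hAfin.ne (by fun_prop) ?_
    filter_upwards [ae_restrict_mem hm] with ξ hξ
    exact norm_inv_sq_le hδ hξ.1
  have e : ∫ ξ in A, g ξ / (z - ξ) ^ 2 = ∫ ξ in A, (g ξ - g z) * ((z - ξ) ^ 2)⁻¹ := by
    have i1' : IntegrableOn (fun ξ => g ξ * ((z - ξ) ^ 2)⁻¹) A := by
      simpa [div_eq_mul_inv] using i1
    simp_rw [sub_mul]
    rw [integral_sub i1' i2, integral_const_mul,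
      integral_annulus_inv_sq, mul_zero, sub_zero]
    simp_rw [div_eq_mul_inv]
  rw [truncBeurling_sub_eq hg hδ h, enorm_mul, e]
  refine (mul_le_mul_left enorm_neg_inv_pi_le _).trans ?_
  rw [one_mul]
  calc _ ≤ ∫⁻ ξ in A, ‖(g ξ - g z) * ((z - ξ) ^ 2)⁻¹‖ₑ := enorm_integral_le_lintegral_enorm _
    _ ≤ ∫⁻ ξ in A, L * (‖z - ξ‖ₑ)⁻¹ := by
        refine setLIntegral_mono_ae' hm (ae_of_all _ fun ξ hξ => ?_)
        have hpos : 0 < ‖z - ξ‖ := hδ.trans hξ.1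
        have hne : z - ξ ≠ 0 := norm_pos_iff.1 hpos
        have he0 : ‖z - ξ‖ₑ ≠ 0 := by simpa using hne
        have hLip : ‖g ξ - g z‖ₑ ≤ L * ‖z - ξ‖ₑ := by
          have := hL ξ z
          rwa [edist_eq_enorm_sub, edist_eq_enorm_sub, ← neg_sub z ξ, enorm_neg] at this
        rw [enorm_mul, enorm_inv (pow_ne_zero _ hne), enorm_pow]
        calc _ ≤ L * ‖z - ξ‖ₑ * (‖z - ξ‖ₑ ^ 2)⁻¹ := by gcongr
          _ = L * (‖z - ξ‖ₑ)⁻¹ := by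
              rw [sq, ENNReal.mul_inv (Or.inl he0) (Or.inl enorm_ne_top), mul_assoc,
                ← mul_assoc (‖z - ξ‖ₑ), ENNReal.mul_inv_cancel he0 enorm_ne_top, one_mul]
    _ = L * ∫⁻ ξ in A, (‖z - ξ‖ₑ)⁻¹ := lintegral_const_mul' _ _ (by simp)
    _ ≤ L * ∫⁻ w in {w : ℂ | ‖w‖ ≤ δ'}, (‖w‖ₑ)⁻¹ := by
        refine mul_le_mul_right ?_ _
        have hm' : MeasurableSet {w : ℂ | ‖w‖ ≤ δ'} :=
          (isClosed_le continuous_norm continuous_const).measurableSet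
        rw [← lintegral_indicator hm, ← lintegral_indicator hm',
          ← lintegral_sub_left_eq_self _ z]
        refine lintegral_mono fun ξ => ?_
        simp only [Set.indicator_apply]
        by_cases hξ : z - ξ ∈ A
        · have h1 : ‖ξ‖ ≤ δ' := by
            simpa [sub_sub_cancel] using hξ.2
          rw [if_pos hξ, if_pos (by exact h1), sub_sub_cancel]
        · rw [if_neg hξ]; exact zero_le
    _ ≤ _ := by
        gcongr
        exact lintegral_ball_inv_norm_le (hδ.le.trans h)

theorem truncBeurling_sub_fun {f g : ℂ → ℂ} (hf : Integrable f) (hg : Integrable g) {δ : ℝ}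
    (hδ : 0 < δ) (z : ℂ) : truncBeurling δ (fun y => f y - g y) z
      = truncBeurling δ f z - truncBeurling δ g z := by
  simp only [truncBeurling_eq]
  rw [← mul_sub, ← integral_sub (integrable_indicator_far hf hδ z)
    (integrable_indicator_far hg hδ z)]
  simp_rw [mul_sub]

theorem le_maxBeurling (f : ℂ → ℂ) (z : ℂ) {δ : ℝ} (hδ : 0 < δ) :
    ‖truncBeurling δ f z‖ₑ ≤ maxBeurling f z :=
  le_iSup₂_of_le δ hδ le_rfl

/-- The set where the truncated transforms oscillate by more than `4 a` near `0`. -/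
def oscSet (f : ℂ → ℂ) (a : ℝ≥0∞) : Set ℂ :=
  {z | ∀ r : ℝ, 0 < r → ∃ δ δ' : ℝ, 0 < δ ∧ δ ≤ δ' ∧ δ' < r ∧
    4 * a < ‖truncBeurling δ f z - truncBeurling δ' f z‖ₑ}

/-- At small scales the Lipschitz part oscillates by at most `a`; if the maximal transform of `f -
g` were at most `a`, the total oscillation would be at most `3 a`. -/
theorem oscSet_subset {f g : ℂ → ℂ} (hf : Integrable f) (hg : Integrable g) {L : ℝ≥0}
    (hL : LipschitzWith L g) {a : ℝ≥0∞} (ha : a ≠ 0) :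
    oscSet f a ⊆ {z | a < maxBeurling (fun y => f y - g y) z} := by
  intro z hz
  by_contra h
  simp only [Set.mem_ofPred_eq, not_lt] at h
  obtain ⟨r, hr, hra⟩ : ∃ r : ℝ, 0 < r ∧ L * ENNReal.ofReal (2 * Real.pi * r) ≤ a := by
    have ht : Tendsto (fun r : ℝ => L * ENNReal.ofReal (2 * Real.pi * r)) (𝓝[>] 0) (𝓝 0) := by
      have hc : Continuous fun r : ℝ => L * ENNReal.ofReal (2 * Real.pi * r) :=
        ENNReal.continuous_const_mul (by simp) |>.comp
          (ENNReal.continuous_ofReal.comp (by fun_prop))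
      have := (hc.tendsto 0).mono_left (nhdsWithin_le_nhds (s := Set.Ioi 0))
      simpa using this
    obtain ⟨r, hr1, hr2⟩ :=
      ((ht.eventually_lt_const (pos_iff_ne_zero.2 ha)).and self_mem_nhdsWithin).exists
    exact ⟨r, hr2, hr1.le⟩
  obtain ⟨δ, δ', hδ, hδδ', hδ'r, hlt⟩ := hz r hr
  have hδ' := hδ.trans_le hδδ'
  have e : truncBeurling δ f z - truncBeurling δ' f z
      = (truncBeurling δ (fun y => f y - g y) z - truncBeurling δ' (fun y => f y - g y) z)
        + (truncBeurling δ g z - truncBeurling δ' g z) := by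
    rw [truncBeurling_sub_fun hf hg hδ, truncBeurling_sub_fun hf hg hδ']
    ring
  rw [e] at hlt
  refine absurd hlt (not_lt.2 ?_)
  calc _ ≤ (a + a) + a := by
        refine (enorm_add_le _ _).trans (add_le_add (enorm_sub_le.trans (add_le_add
          ((le_maxBeurling _ z hδ).trans h) ((le_maxBeurling _ z hδ').trans h))) ?_)
        refine (enorm_truncBeurling_sub_le_of_lipschitz hg hL hδ hδδ' z).trans (le_trans ?_ hra)
        gcongr
    _ = 3 * a := by ring
    _ ≤ 4 * a := by gcongr; norm_num

/-- Smooth compactly supported functions are Lipschitz and dense in `L¹`; the weak type bound for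
the error makes the oscillation set arbitrarily small. -/
theorem volume_oscSet {f : ℂ → ℂ} (hf : Integrable f) {a : ℝ≥0∞} (ha : a ≠ 0) :
    volume (oscSet f a) = 0 := by
  have hC := beurConst₁_ne_top
  have key : ∀ η : ℝ, 0 < η → a * volume (oscSet f a) ≤ beurConst₁ * ENNReal.ofReal η := by
    intro η hη
    obtain ⟨g, hgc, hgs, hfg⟩ := (memLp_one_iff_integrable.2 hf).exist_eLpNorm_sub_le
      ENNReal.one_ne_top le_rfl hη
    obtain ⟨L, hL⟩ := ContDiff.lipschitzWith_of_hasCompactSupport hgc hgs (by simp)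
    have hg : Integrable g := hgs.continuous.integrable_of_hasCompactSupport hgc
    calc _ ≤ a * volume {z | a < maxBeurling (fun y => f y - g y) z} := by
          gcongr; exact oscSet_subset hf hg hL ha
      _ ≤ beurConst₁ * ∫⁻ y, ‖f y - g y‖ₑ := maxBeurling_weak (hf.sub hg) a
      _ ≤ _ := by
          gcongr
          rwa [eLpNorm_one_eq_lintegral_enorm] at hfg
  have ht : Tendsto (fun η : ℝ => beurConst₁ * ENNReal.ofReal η) (𝓝[>] 0) (𝓝 0) := by
    have hc : Continuous fun η : ℝ => beurConst₁ * ENNReal.ofReal η :=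
      (ENNReal.continuous_const_mul hC).comp ENNReal.continuous_ofReal
    have := (hc.tendsto 0).mono_left (nhdsWithin_le_nhds (s := Set.Ioi 0))
    simpa using this
  have h0 : a * volume (oscSet f a) ≤ 0 := ge_of_tendsto ht (by
    filter_upwards [self_mem_nhdsWithin] with η hη using key η hη)
  simpa [ha] using h0

theorem ae_beurlingConverges {f : ℂ → ℂ} (hf : Integrable f) : ∀ᵐ z, BeurlingConverges f z := by
  have h : ∀ n : ℕ, ∀ᵐ z, z ∉ oscSet f ((n : ℝ≥0∞) + 1)⁻¹ := fun n =>
    measure_eq_zero_iff_ae_notMem.1 (volume_oscSet hf (by simp))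
  filter_upwards [ae_all_iff.2 h] with z hz
  refine tendsto_nhds_limUnder (cauchy_map_iff_exists_tendsto.1 ?_)
  refine Metric.cauchy_iff.2 ⟨inferInstance, fun η hη => ?_⟩
  -- The Cauchy criterion at accuracy `η` follows from the level `1 / (n + 1)` as soon as `4 / (n +
  -- 1) < η`.
  obtain ⟨n, hn⟩ := exists_nat_gt (4 / η)
  have hz' := hz n
  simp only [oscSet, Set.mem_ofPred_eq, not_forall, not_exists, not_and, not_lt] at hz'
  obtain ⟨r, hr, hzr⟩ := hz'
  have hbound : ∀ δ δ' : ℝ, 0 < δ → δ ≤ δ' → δ' < r →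
      dist (truncBeurling δ f z) (truncBeurling δ' f z) < η := by
    intro δ δ' h1 h2 h3
    have h4 := hzr δ δ' h1 h2 h3
    rw [dist_eq_norm]
    have h5 : (4 : ℝ≥0∞) * ((n : ℝ≥0∞) + 1)⁻¹ = ENNReal.ofReal (4 * ((n : ℝ) + 1)⁻¹) := by
      rw [ENNReal.ofReal_mul (by norm_num), ENNReal.ofReal_inv_of_pos (by positivity),
        ENNReal.ofReal_add (by positivity) (by norm_num)]
      simp
    rw [h5, ← ofReal_norm, ENNReal.ofReal_le_ofReal_iff (by positivity)] at h4
    refine h4.trans_lt ?_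
    rw [div_lt_iff₀ hη] at hn
    rw [← div_eq_mul_inv, div_lt_iff₀ (by positivity)]
    nlinarith
  refine ⟨(fun δ => truncBeurling δ f z) '' Set.Ioo 0 r,
    image_mem_map (Ioo_mem_nhdsGT hr), ?_⟩
  rintro _ ⟨δ, hδ, rfl⟩ _ ⟨δ', hδ', rfl⟩
  rcases le_total δ δ' with hle | hle
  · exact hbound δ δ' hδ.1 hle hδ'.2
  · rw [dist_comm]; exact hbound δ' δ hδ'.1 hle hδ.2

theorem aestronglyMeasurable_beurling {f : ℂ → ℂ} (hf : Integrable f) {μ : Measure ℂ}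
    (hμ : μ ≪ volume) : AEStronglyMeasurable (beurling f) μ := by
  obtain ⟨e, -, he, he0⟩ := exists_seq_strictAnti_tendsto (0 : ℝ)
  refine aestronglyMeasurable_of_tendsto_ae atTop (f := fun n => truncBeurling (e n) f)
    (fun n => (continuous_truncBeurling hf (he n)).aestronglyMeasurable) ?_
  filter_upwards [hμ.ae_le (ae_beurlingConverges hf)] with z hz
  exact hz.comp (tendsto_nhdsWithin_iff.2 ⟨he0, Eventually.of_forall he⟩)

theorem enorm_beurling_le {f : ℂ → ℂ} {z : ℂ} (hz : BeurlingConverges f z) :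
    ‖beurling f z‖ₑ ≤ maxBeurling f z := by
  refine le_of_tendsto hz.enorm ?_
  filter_upwards [self_mem_nhdsWithin] with δ hδ using le_maxBeurling f z hδ

end BeurlingWeight


namespace BeurlingWeight

open ComplexConjugate

/-! ### Dyadic squares -/

namespace DyadicSquare

theorem mem_toSet {P : DyadicSquare} {z : ℂ} : z ∈ P.toSet ↔
    (P.corner.re ≤ z.re ∧ z.re < P.corner.re + P.side) ∧
      (P.corner.im ≤ z.im ∧ z.im < P.corner.im + P.side) := by
  rw [toSet, Complex.mem_reProdIm]; rfl

theorem mem_triple {P : DyadicSquare} {z : ℂ} : z ∈ P.triple ↔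
    (P.corner.re - P.side ≤ z.re ∧ z.re < P.corner.re + 2 * P.side) ∧
      (P.corner.im - P.side ≤ z.im ∧ z.im < P.corner.im + 2 * P.side) := by
  rw [triple, Complex.mem_reProdIm]; rfl

theorem toSet_subset_triple (P : DyadicSquare) : P.toSet ⊆ P.triple := by
  intro z hz
  rw [mem_toSet] at hz
  rw [mem_triple]
  have := P.side_pos
  refine ⟨⟨?_, ?_⟩, ?_, ?_⟩ <;> linarith [hz.1.1, hz.1.2, hz.2.1, hz.2.2]

theorem measurableSet_toSet (P : DyadicSquare) : MeasurableSet P.toSet :=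
  (measurableSet_Ico.preimage Complex.measurable_re).inter
    (measurableSet_Ico.preimage Complex.measurable_im)

theorem side_le_norm_sub {P : DyadicSquare} {z y : ℂ} (hz : z ∈ P.toSet) (hy : y ∉ P.triple) :
    P.side ≤ ‖z - y‖ := by
  rw [mem_toSet] at hz
  by_contra! h
  have h1 := abs_lt.1 ((Complex.abs_re_le_norm (z - y)).trans_lt h)
  have h2 := abs_lt.1 ((Complex.abs_im_le_norm (z - y)).trans_lt h)
  rw [Complex.sub_re] at h1
  rw [Complex.sub_im] at h2
  refine hy (mem_triple.2 ⟨⟨?_, ?_⟩, ?_, ?_⟩) <;> linarith [hz.1.1, hz.1.2, hz.2.1, hz.2.2]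

theorem volume_toSet (P : DyadicSquare) : volume P.toSet = ENNReal.ofReal (P.side ^ 2) := by
  have h := Complex.volume_preserving_equiv_real_prod.measure_preimage_equiv
    (Set.Ico P.corner.re (P.corner.re + P.side) ×ˢ Set.Ico P.corner.im (P.corner.im + P.side))
  rw [Measure.volume_eq_prod, Measure.prod_prod, Real.volume_Ico, Real.volume_Ico,
    ← ENNReal.ofReal_mul (by linarith [P.side_pos])] at h
  have e : P.toSet = Complex.measurableEquivRealProd ⁻¹'
      (Set.Ico P.corner.re (P.corner.re + P.side) ×ˢ
        Set.Ico P.corner.im (P.corner.im + P.side)) := by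
    ext z; rw [toSet, Complex.mem_reProdIm]; rfl
  rw [e, h]
  congr 1
  ring

theorem subset_of_mem_of_le {P Q : DyadicSquare} {z : ℂ} (hP : z ∈ P.toSet) (hQ : z ∈ Q.toSet)
    (h : P.k ≤ Q.k) : P.toSet ⊆ Q.toSet := by
  obtain ⟨n, hn⟩ := Int.eq_ofNat_of_zero_le (sub_nonneg.2 h)
  have hs : Q.side = P.side * ((2 ^ n : ℤ) : ℝ) := by
    rw [side, side, show Q.k = P.k + n by omega, zpow_add₀ (by norm_num)]
    simp
  have hp := P.side_pos
  -- One coordinate at a time: in units of the smaller side all end points are integers, so a strict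
  -- inequality between them improves by one.
  have key : ∀ (a b : ℤ) (x : ℝ), a * P.side ≤ x → x < a * P.side + P.side → b * Q.side ≤ x →
      x < b * Q.side + Q.side → b * Q.side ≤ a * P.side ∧
        a * P.side + P.side ≤ b * Q.side + Q.side := by
    intro a b x h1 h2 h3 h4
    rw [hs] at h3 h4 ⊢
    have e1 : b * (2 ^ n : ℤ) < a + 1 := by
      have : ((b * (2 ^ n : ℤ) : ℤ) : ℝ) * P.side < ((a + 1 : ℤ) : ℝ) * P.side := by
        push_cast at *
        linarith
      exact_mod_cast lt_of_mul_lt_mul_right this hp.le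
    have e2 : a < (b + 1) * (2 ^ n : ℤ) := by
      have : ((a : ℤ) : ℝ) * P.side < (((b + 1) * (2 ^ n : ℤ) : ℤ) : ℝ) * P.side := by
        push_cast at *
        linarith
      exact_mod_cast lt_of_mul_lt_mul_right this hp.le
    have f1 : ((b * (2 ^ n : ℤ) : ℤ) : ℝ) ≤ ((a : ℤ) : ℝ) := by exact_mod_cast Int.lt_add_one_iff.1 e1
    have f2 : ((a + 1 : ℤ) : ℝ) ≤ (((b + 1) * (2 ^ n : ℤ) : ℤ) : ℝ) := by
      exact_mod_cast Int.add_one_le_iff.2 e2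
    have g1 := mul_le_mul_of_nonneg_right f1 hp.le
    have g2 := mul_le_mul_of_nonneg_right f2 hp.le
    push_cast at *
    constructor <;> linarith
  intro w hw
  rw [mem_toSet] at hP hQ hw ⊢
  simp only [corner] at *
  have k1 := key P.m Q.m z.re hP.1.1 hP.1.2 hQ.1.1 hQ.1.2
  have k2 := key P.n Q.n z.im hP.2.1 hP.2.2 hQ.2.1 hQ.2.2
  refine ⟨⟨?_, ?_⟩, ?_, ?_⟩ <;> linarith [hw.1.1, hw.1.2, hw.2.1, hw.2.2]

/-- The dyadic square of side length `2 ^ j` that lies `a` columns to the right and `b` rows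
above the one which contains `y`. -/
noncomputable def near (y : ℂ) (j a b : ℤ) : DyadicSquare :=
  ⟨j, ⌊y.re / (2 : ℝ) ^ j⌋ + a, ⌊y.im / (2 : ℝ) ^ j⌋ + b⟩

theorem side_near (y : ℂ) (j a b : ℤ) : (near y j a b).side = (2 : ℝ) ^ j := rfl

theorem exists_mem_near {y z : ℂ} {j : ℤ} (h : ‖z - y‖ ≤ (2 : ℝ) ^ j) :
    ∃ a ∈ Finset.Icc (-1 : ℤ) 1, ∃ b ∈ Finset.Icc (-1 : ℤ) 1, z ∈ (near y j a b).toSet := by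
  have hS : (0 : ℝ) < 2 ^ j := by positivity
  have key : ∀ u v : ℝ, |u - v| ≤ 2 ^ j → ∃ a ∈ Finset.Icc (-1 : ℤ) 1,
      ((⌊v / (2 : ℝ) ^ j⌋ + a : ℤ) : ℝ) * 2 ^ j ≤ u ∧
        u < ((⌊v / (2 : ℝ) ^ j⌋ + a : ℤ) : ℝ) * 2 ^ j + 2 ^ j := by
    intro u v huv
    refine ⟨⌊u / (2 : ℝ) ^ j⌋ - ⌊v / (2 : ℝ) ^ j⌋, ?_, ?_⟩
    · have h1 := abs_le.1 huv
      have h2 : u / 2 ^ j ≤ v / 2 ^ j + 1 := by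
        rw [div_add_one hS.ne']
        exact div_le_div_of_nonneg_right (by linarith) hS.le
      have h3 : v / 2 ^ j ≤ u / 2 ^ j + 1 := by
        rw [div_add_one hS.ne']
        exact div_le_div_of_nonneg_right (by linarith) hS.le
      have h4 := Int.floor_le_floor h2
      have h5 := Int.floor_le_floor h3
      rw [Int.floor_add_one] at h4 h5
      rw [Finset.mem_Icc]
      omega
    · rw [add_sub_cancel]
      have h1 := Int.floor_le (u / 2 ^ j)
      have h2 := Int.lt_floor_add_one (u / 2 ^ j)
      rw [le_div_iff₀ hS] at h1
      rw [div_lt_iff₀ hS] at h2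
      exact ⟨h1, by linarith⟩
  obtain ⟨a, ha, ha'⟩ := key z.re y.re (by
    simpa using (Complex.abs_re_le_norm (z - y)).trans h)
  obtain ⟨b, hb, hb'⟩ := key z.im y.im (by
    simpa using (Complex.abs_im_le_norm (z - y)).trans h)
  exact ⟨a, ha, b, hb, mem_toSet.2 ⟨ha', hb'⟩⟩

theorem norm_center_near_sub_le {y : ℂ} {j a b : ℤ} (ha : a ∈ Finset.Icc (-1 : ℤ) 1)
    (hb : b ∈ Finset.Icc (-1 : ℤ) 1) : ‖y - (near y j a b).center‖ ≤ 4 * (2 : ℝ) ^ j := by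
  have hS : (0 : ℝ) < 2 ^ j := by positivity
  have key : ∀ (v : ℝ) (a : ℤ), a ∈ Finset.Icc (-1 : ℤ) 1 →
      |v - (((⌊v / (2 : ℝ) ^ j⌋ + a : ℤ) : ℝ) * 2 ^ j + 2 ^ j / 2)| ≤ 2 * 2 ^ j := by
    intro v a ha
    rw [Finset.mem_Icc] at ha
    have a1 : (-1 : ℝ) ≤ a := by exact_mod_cast ha.1
    have a2 : (a : ℝ) ≤ 1 := by exact_mod_cast ha.2
    have h1 := Int.floor_le (v / 2 ^ j)
    have h2 := Int.lt_floor_add_one (v / 2 ^ j)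
    rw [le_div_iff₀ hS] at h1
    rw [div_lt_iff₀ hS] at h2
    push_cast
    rw [abs_le]
    constructor <;> nlinarith
  refine (Complex.norm_le_abs_re_add_abs_im _).trans ?_
  have k1 := key y.re a ha
  have k2 := key y.im b hb
  simp only [Complex.sub_re, Complex.sub_im, center, corner, side, near] at *
  linarith

theorem norm_sub_center_le {P : DyadicSquare} {y : ℂ} (hy : y ∈ P.toSet) :
    ‖y - P.center‖ ≤ P.side := by
  refine (Complex.norm_le_abs_re_add_abs_im _).trans ?_
  rw [mem_toSet] at hy
  simp only [Complex.sub_re, Complex.sub_im, center]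
  have h1 : |y.re - (P.corner.re + P.side / 2)| ≤ P.side / 2 := by
    rw [abs_le]; constructor <;> linarith [hy.1.1, hy.1.2]
  have h2 : |y.im - (P.corner.im + P.side / 2)| ≤ P.side / 2 := by
    rw [abs_le]; constructor <;> linarith [hy.2.1, hy.2.2]
  linarith

end DyadicSquare

theorem DisjointTriples.side_le_norm_sub {F : Finset DyadicSquare} (hF : DisjointTriples F)
    {P Q : DyadicSquare} (hP : P ∈ F) (hQ : Q ∈ F) (hPQ : P ≠ Q) {z y : ℂ} (hz : z ∈ P.toSet)
    (hy : y ∈ Q.toSet) : P.side ≤ ‖z - y‖ :=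
  DyadicSquare.side_le_norm_sub hz fun h =>
    Set.disjoint_left.1 (hF P hP Q hQ hPQ) h (Q.toSet_subset_triple hy)

/-! ### The weight -/

theorem hval_nonneg (t : ℝ) (ε : ℂ → ℝ → ℝ≥0) (P : DyadicSquare) : 0 ≤ hval t ε P := by
  rw [hval_eq, gauge]
  have := P.side_pos
  positivity

/-- The value of the weight on a square of the family. -/
noncomputable def sqWeight (t : ℝ) (ε : ℂ → ℝ → ℝ≥0) (P : DyadicSquare) : ℝ :=
  hval t ε P / P.side ^ 2

theorem sqWeight_nonneg (t : ℝ) (ε : ℂ → ℝ → ℝ≥0) (P : DyadicSquare) : 0 ≤ sqWeight t ε P :=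
  div_nonneg (hval_nonneg t ε P) (sq_nonneg _)

theorem ofReal_weight (t : ℝ) (ε : ℂ → ℝ → ℝ≥0) (F : Finset DyadicSquare) (z : ℂ) :
    ENNReal.ofReal (weight t ε F z)
      = ∑ P ∈ F, P.toSet.indicator (fun _ => ENNReal.ofReal (sqWeight t ε P)) z := by
  have h : weight t ε F z = ∑ P ∈ F, P.toSet.indicator (fun _ => sqWeight t ε P) z := rfl
  rw [h, ENNReal.ofReal_sum_of_nonneg fun P _ =>
    Set.indicator_nonneg (fun _ _ => sqWeight_nonneg t ε P) z]
  refine Finset.sum_congr rfl fun P _ => ?_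
  by_cases hz : z ∈ P.toSet <;> simp [hz]

theorem measurable_ofReal_weight (t : ℝ) (ε : ℂ → ℝ → ℝ≥0) (F : Finset DyadicSquare) :
    Measurable fun z => ENNReal.ofReal (weight t ε F z) := by
  simp_rw [ofReal_weight]
  exact Finset.measurable_fun_sum _ fun P _ => measurable_const.indicator P.measurableSet_toSet

theorem sqWeight_le_weight {t : ℝ} {ε : ℂ → ℝ → ℝ≥0} {F : Finset DyadicSquare} {P : DyadicSquare}
    (hP : P ∈ F) {z : ℂ} (hz : z ∈ P.toSet) :
    ENNReal.ofReal (sqWeight t ε P) ≤ ENNReal.ofReal (weight t ε F z) := by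
  rw [ofReal_weight]
  refine le_trans ?_ (Finset.single_le_sum (f := fun P : DyadicSquare =>
    P.toSet.indicator (fun _ => ENNReal.ofReal (sqWeight t ε P)) z) (fun _ _ => zero_le) hP)
  rw [Set.indicator_of_mem hz]

theorem weightMeasure_eq_sum (t : ℝ) (ε : ℂ → ℝ → ℝ≥0) (F : Finset DyadicSquare) :
    weightMeasure t ε F
      = ∑ P ∈ F, ENNReal.ofReal (sqWeight t ε P) • (volume : Measure ℂ).restrict P.toSet := by
  refine Measure.ext fun s hs => ?_
  rw [weightMeasure, withDensity_apply _ hs]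
  simp_rw [ofReal_weight]
  rw [lintegral_finsetSum _ fun P _ => measurable_const.indicator P.measurableSet_toSet,
    Measure.finsetSum_apply]
  refine Finset.sum_congr rfl fun P _ => ?_
  rw [lintegral_indicator P.measurableSet_toSet, setLIntegral_const,
    Measure.restrict_apply P.measurableSet_toSet, Measure.smul_apply, Measure.restrict_apply hs,
    smul_eq_mul, Set.inter_comm]

theorem lintegral_weightMeasure (t : ℝ) (ε : ℂ → ℝ → ℝ≥0) (F : Finset DyadicSquare)
    (X : ℂ → ℝ≥0∞) : ∫⁻ z, X z ∂(weightMeasure t ε F)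
      = ∑ P ∈ F, ENNReal.ofReal (sqWeight t ε P) * ∫⁻ z in P.toSet, X z := by
  rw [weightMeasure_eq_sum, lintegral_finsetSum_measure]
  simp_rw [lintegral_smul_measure, smul_eq_mul]

theorem weightMeasure_apply (t : ℝ) (ε : ℂ → ℝ → ℝ≥0) (F : Finset DyadicSquare) {s : Set ℂ}
    (hs : MeasurableSet s) : weightMeasure t ε F s
      = ∑ P ∈ F, ENNReal.ofReal (sqWeight t ε P) * volume (s ∩ P.toSet) := by
  rw [weightMeasure_eq_sum, Measure.finsetSum_apply]
  simp_rw [Measure.smul_apply, smul_eq_mul, Measure.restrict_apply hs]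

theorem weightMeasure_ac (t : ℝ) (ε : ℂ → ℝ → ℝ≥0) (F : Finset DyadicSquare) :
    weightMeasure t ε F ≪ volume := withDensity_absolutelyContinuous _ _

theorem sqWeight_mul_volume (t : ℝ) (ε : ℂ → ℝ → ℝ≥0) (P : DyadicSquare) :
    ENNReal.ofReal (sqWeight t ε P) * volume P.toSet = ENNReal.ofReal (hval t ε P) := by
  rw [P.volume_toSet, ← ENNReal.ofReal_mul (sqWeight_nonneg t ε P), sqWeight,
    div_mul_cancel₀ _ (pow_ne_zero _ P.side_pos.ne')]

instance isFiniteMeasure_weightMeasure (t : ℝ) (ε : ℂ → ℝ → ℝ≥0) (F : Finset DyadicSquare) :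
    IsFiniteMeasure (weightMeasure t ε F) := by
  refine ⟨?_⟩
  rw [weightMeasure_apply _ _ _ MeasurableSet.univ]
  simp_rw [Set.univ_inter, sqWeight_mul_volume]
  exact ENNReal.sum_lt_top.2 fun _ _ => ENNReal.ofReal_lt_top

theorem measurableSet_unionSet (F : Finset DyadicSquare) : MeasurableSet (unionSet F) :=
  Finset.measurableSet_biUnion _ fun P _ => P.measurableSet_toSet

theorem mem_unionSet {F : Finset DyadicSquare} {z : ℂ} :
    z ∈ unionSet F ↔ ∃ P ∈ F, z ∈ P.toSet := by
  simp [unionSet]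

theorem ae_mem_unionSet (t : ℝ) (ε : ℂ → ℝ → ℝ≥0) (F : Finset DyadicSquare) :
    ∀ᵐ z ∂(weightMeasure t ε F), z ∈ unionSet F := by
  rw [ae_iff]
  have hm : MeasurableSet {z | z ∉ unionSet F} := (measurableSet_unionSet F).compl
  rw [weightMeasure_apply _ _ _ hm]
  refine Finset.sum_eq_zero fun P hP => ?_
  have : {z | z ∉ unionSet F} ∩ P.toSet = ∅ := by
    ext z
    simp only [Set.mem_inter_iff, Set.mem_ofPred_eq, Set.mem_empty_iff_false, iff_false, not_and]
    exact fun h1 h2 => h1 (mem_unionSet.2 ⟨P, hP, h2⟩)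
  simp [this]

/-! ### The packing condition and the growth of the weight -/

theorem weightMeasure_apply_le (t : ℝ) (ε : ℂ → ℝ → ℝ≥0) (F G : Finset DyadicSquare) {s : Set ℂ}
    (hs : MeasurableSet s) (h : ∀ P ∈ F, ∀ z ∈ P.toSet, z ∈ s → P ∈ G) :
    weightMeasure t ε F s ≤ ENNReal.ofReal (∑ P ∈ G, hval t ε P) := by
  classical
  rw [weightMeasure_apply _ _ _ hs, ENNReal.ofReal_sum_of_nonneg fun P _ => hval_nonneg t ε P]
  calc _ ≤ ∑ P ∈ F, if P ∈ G then ENNReal.ofReal (hval t ε P) else 0 := by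
        refine Finset.sum_le_sum fun P hP => ?_
        split_ifs with hG
        · rw [← sqWeight_mul_volume]
          gcongr
          exact Set.inter_subset_right
        · have : s ∩ P.toSet = ∅ := by
            ext z
            simp only [Set.mem_inter_iff, Set.mem_empty_iff_false, iff_false, not_and]
            exact fun h1 h2 => hG (h P hP z h2 h1)
          simp [this]
    _ ≤ _ := by
        rw [← Finset.sum_filter]
        exact Finset.sum_le_sum_of_subset fun P hP => (Finset.mem_filter.1 hP).2

theorem MemG1.le {C : ℝ} {ε : ℂ → ℝ → ℝ≥0} (h : MemG1 C ε) {x y : ℂ} {r s : ℝ} (hr : 0 < r)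
    (hxy : ‖x - y‖ ≤ 2 * r) (h1 : r / 2 ≤ s) (h2 : s ≤ 2 * r) : (ε y s : ℝ) ≤ C * ε x r :=
  (h.2 x y r s hr hxy h1 h2).2

theorem sqrt_two_bounds : 1 ≤ Real.sqrt 2 ∧ Real.sqrt 2 ≤ 2 := by
  have h := Real.sq_sqrt (show (0 : ℝ) ≤ 2 by norm_num)
  have h0 := Real.sqrt_nonneg 2
  constructor <;> nlinarith

theorem hval_near_le {t C₁ : ℝ} (ht0 : 0 < t) {ε : ℂ → ℝ → ℝ≥0} (h1 : MemG1 C₁ ε) {y : ℂ}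
    {j a b : ℤ} (ha : a ∈ Finset.Icc (-1 : ℤ) 1) (hb : b ∈ Finset.Icc (-1 : ℤ) 1) {R : ℝ}
    (hR : (2 : ℝ) ^ j = 2 * R) :
    hval t ε (DyadicSquare.near y j a b) ≤ (2 * R) ^ t * (C₁ ^ 4 * ε y R) := by
  have hS : (0 : ℝ) < 2 ^ j := by positivity
  have hR0 : 0 < R := by linarith
  have hC := h1.1
  obtain ⟨s1, s2⟩ := sqrt_two_bounds
  have hsp : 0 < Real.sqrt 2 := by linarith
  rw [hval_eq, gauge, DyadicSquare.side_near, hR]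
  set c := (DyadicSquare.near y j a b).center with hc
  have hyc : ‖y - c‖ ≤ 4 * (2 * R) := by
    rw [← hR]; exact DyadicSquare.norm_center_near_sub_le ha hb
  have hle : 2 * R / Real.sqrt 2 ≤ 2 * R := div_le_self (by linarith) s1
  have hge : R ≤ 2 * R / Real.sqrt 2 := by
    rw [le_div_iff₀ hsp]; nlinarith
  -- Four moves, each costing `C₁`: the radius at `y` grows to `2 R` and then `4 R`, which is enough
  -- to reach the centre `c` at distance at most `8 R`; at `c` the radius is finally adjusted to
  -- that of the circumscribed ball.
  have e1 : (ε y (2 * R) : ℝ) ≤ C₁ * ε y R :=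
    h1.le hR0 (by simpa using hR0.le) (by linarith) le_rfl
  have e2 : (ε y (4 * R) : ℝ) ≤ C₁ * ε y (2 * R) :=
    h1.le (by linarith) (by simpa using hR0.le) (by linarith) (by linarith)
  have e3 : (ε c (2 * R) : ℝ) ≤ C₁ * ε y (4 * R) :=
    h1.le (by linarith) (by linarith) (by linarith) (by linarith)
  have e4 : (ε c (2 * R / Real.sqrt 2) : ℝ) ≤ C₁ * ε c (2 * R) :=
    h1.le (by linarith) (by simpa using hR0.le) (by linarith) (by linarith)
  have e5 : (ε c (2 * R / Real.sqrt 2) : ℝ) ≤ C₁ ^ 4 * ε y R := by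
    calc (ε c (2 * R / Real.sqrt 2) : ℝ) ≤ C₁ * (C₁ * (C₁ * (C₁ * ε y R))) := by
          refine e4.trans (mul_le_mul_of_nonneg_left ?_ hC.le)
          refine e3.trans (mul_le_mul_of_nonneg_left ?_ hC.le)
          exact e2.trans (mul_le_mul_of_nonneg_left e1 hC.le)
      _ = _ := by ring
  exact mul_le_mul (Real.rpow_le_rpow (by positivity) hle ht0.le) e5 (by positivity)
    (by positivity)

theorem sum_biUnion_le_sum_sum {ι α : Type*} [DecidableEq α] {g : α → ℝ} (hg : ∀ a, 0 ≤ g a)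
    (s : Finset ι) (u : ι → Finset α) :
    ∑ a ∈ s.biUnion u, g a ≤ ∑ i ∈ s, ∑ a ∈ u i, g a := by
  classical
  induction s using Finset.induction_on with
  | empty => simp
  | insert i s hi ih =>
    rw [Finset.biUnion_insert, Finset.sum_insert hi]
    have h1 := Finset.sum_union_inter (s₁ := u i) (s₂ := s.biUnion u) (f := g)
    have h2 : 0 ≤ ∑ a ∈ u i ∩ s.biUnion u, g a := Finset.sum_nonneg fun a _ => hg a
    linarith

/-- A square other than `P` that meets the ball has side at most its distance to `y`, by
disjointness of the triples, hence at most `2 R`; `P` itself is smaller as well. Each such square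
therefore lies in one of the nine dyadic squares of side `2 R` around `y`, and packing applies to
each of these. -/
theorem weightMeasure_closedBall_le {t C₁ Cpack : ℝ} (ht0 : 0 < t) {ε : ℂ → ℝ → ℝ≥0}
    {F : Finset DyadicSquare} (h1 : MemG1 C₁ ε) (hF : DisjointTriples F)
    (hp : Packing t ε Cpack F) {P : DyadicSquare} (hP : P ∈ F) {y : ℂ} (hy : y ∈ P.toSet)
    (k : ℕ) : weightMeasure t ε F (Metric.closedBall y (2 * (2 ^ k * P.side)))
      ≤ ENNReal.ofReal (9 * (|Cpack| * ((2 * (2 ^ k * P.side)) ^ t *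
        (C₁ ^ 4 * ε y (2 ^ k * P.side))))) := by
  classical
  set R := 2 ^ k * P.side with hRdef
  set j : ℤ := P.k + k + 1 with hj
  have hR : (2 : ℝ) ^ j = 2 * R := by
    rw [hRdef, hj, DyadicSquare.side, zpow_add₀ (by norm_num), zpow_add₀ (by norm_num)]
    simp
    ring
  set G : Finset DyadicSquare := (Finset.Icc (-1 : ℤ) 1 ×ˢ Finset.Icc (-1 : ℤ) 1).biUnion fun q =>
    F.filter fun P => P.toSet ⊆ (DyadicSquare.near y j q.1 q.2).toSet with hG
  refine (weightMeasure_apply_le t ε F G Metric.isClosed_closedBall.measurableSet ?_).trans ?_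
  · intro Q hQ z hz hzB
    rw [Metric.mem_closedBall, dist_eq_norm, ← hR] at hzB
    obtain ⟨a, ha, b, hb, hab⟩ := DyadicSquare.exists_mem_near hzB
    rw [hG, Finset.mem_biUnion]
    refine ⟨(a, b), Finset.mk_mem_product ha hb, Finset.mem_filter.2 ⟨hQ, ?_⟩⟩
    refine DyadicSquare.subset_of_mem_of_le hz hab ?_
    change Q.k ≤ j
    by_cases hPQ : Q = P
    · rw [hPQ]; omega
    · have := (hF.side_le_norm_sub hQ hP hPQ hz hy).trans hzB
      exact (zpow_le_zpow_iff_right₀ (by norm_num)).1 this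
  · refine ENNReal.ofReal_le_ofReal ?_
    calc ∑ Q ∈ G, hval t ε Q ≤ ∑ q ∈ Finset.Icc (-1 : ℤ) 1 ×ˢ Finset.Icc (-1 : ℤ) 1,
          ∑ Q ∈ F.filter fun P => P.toSet ⊆ (DyadicSquare.near y j q.1 q.2).toSet,
            hval t ε Q := by
          rw [hG]
          exact sum_biUnion_le_sum_sum (fun Q => hval_nonneg t ε Q) _ _
      _ ≤ ∑ q ∈ Finset.Icc (-1 : ℤ) 1 ×ˢ Finset.Icc (-1 : ℤ) 1,
          |Cpack| * ((2 * R) ^ t * (C₁ ^ 4 * ε y R)) := by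
          refine Finset.sum_le_sum fun q hq => ?_
          obtain ⟨ha, hb⟩ := Finset.mem_product.1 hq
          have := hp (DyadicSquare.near y j q.1 q.2)
          calc _ ≤ Cpack * hval t ε (DyadicSquare.near y j q.1 q.2) := by convert this
            _ ≤ |Cpack| * hval t ε (DyadicSquare.near y j q.1 q.2) :=
                mul_le_mul_of_nonneg_right (le_abs_self _) (hval_nonneg _ _ _)
            _ ≤ _ := mul_le_mul_of_nonneg_left (hval_near_le ht0 h1 ha hb hR) (abs_nonneg _)
      _ = _ := by
          rw [Finset.sum_const, nsmul_eq_mul]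
          simp

/-- The constant in the summed growth condition. -/
noncomputable def growthConst (t C₁ C₂ Cpack : ℝ) : ℝ :=
  9 * |Cpack| * C₁ ^ 5 * C₂ * 2 ^ t * Real.sqrt 2 ^ t

/-- Since `(2^k ℓ)^(t-2) = ℓ^(t-2) 2^(-k(2-t))`, the growth bound turns the series into the one in
the class `𝒢₂(t)`. Its sum is controlled by `ε(y, ℓ)`; one more use of `𝒢₁` passes to the
circumscribed ball of `P`, where `h(P) / ℓ²` is the weight. -/
theorem tsum_weightMeasure_closedBall_le {t C₁ C₂ Cpack : ℝ} (ht0 : 0 < t) {ε : ℂ → ℝ → ℝ≥0}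
    {F : Finset DyadicSquare} (h1 : MemG1 C₁ ε) (h2 : MemG2 t C₂ ε) (hF : DisjointTriples F)
    (hp : Packing t ε Cpack F) {P : DyadicSquare} (hP : P ∈ F) {y : ℂ} (hy : y ∈ P.toSet) :
    ∑' k : ℕ, ENNReal.ofReal (((2 ^ k * P.side) ^ 2)⁻¹) *
        weightMeasure t ε F (Metric.closedBall y (2 * (2 ^ k * P.side)))
      ≤ ENNReal.ofReal (growthConst t C₁ C₂ Cpack) * ENNReal.ofReal (weight t ε F y) := by
  have hl := P.side_pos
  have hC₁ := h1.1
  have hC₂ := h2.1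
  obtain ⟨s1, s2⟩ := sqrt_two_bounds
  have hsp : 0 < Real.sqrt 2 := by linarith
  obtain ⟨hsum, hle⟩ := h2.2 y P.side hl
  have hA : 0 ≤ growthConst t C₁ C₂ Cpack := by unfold growthConst; positivity
  set B : ℝ := 9 * |Cpack| * C₁ ^ 4 * 2 ^ t * P.side ^ t / P.side ^ 2 with hB
  have hB0 : 0 ≤ B := by positivity
  have hterm : ∀ k : ℕ, ENNReal.ofReal (((2 ^ k * P.side) ^ 2)⁻¹) *
        weightMeasure t ε F (Metric.closedBall y (2 * (2 ^ k * P.side)))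
      ≤ ENNReal.ofReal (B * ((2 : ℝ) ^ (-((k : ℝ) * (2 - t))) * (ε y (2 ^ k * P.side) : ℝ))) := by
    intro k
    refine (mul_le_mul_right (weightMeasure_closedBall_le ht0 h1 hF hp hP hy k) _).trans ?_
    rw [← ENNReal.ofReal_mul (by positivity)]
    refine ENNReal.ofReal_le_ofReal (le_of_eq ?_)
    have e1 : (2 * (2 ^ k * P.side)) ^ t = 2 ^ t * (2 : ℝ) ^ ((k : ℝ) * t) * P.side ^ t := by
      rw [Real.mul_rpow (by norm_num) (by positivity), Real.mul_rpow (by positivity) hl.le,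
        ← Real.rpow_natCast, ← Real.rpow_mul (by norm_num), mul_assoc]
    have e2 : (2 : ℝ) ^ (-((k : ℝ) * (2 - t))) = (2 : ℝ) ^ ((k : ℝ) * t) / (2 ^ k) ^ 2 := by
      rw [show -((k : ℝ) * (2 - t)) = (k : ℝ) * t - (k : ℝ) * 2 by ring,
        Real.rpow_sub (by norm_num), Real.rpow_mul (by norm_num) (k : ℝ) 2, Real.rpow_natCast]
      norm_num
    rw [e1, e2, hB]
    field_simp
  refine (ENNReal.tsum_le_tsum hterm).trans ?_
  rw [← ENNReal.ofReal_tsum_of_nonneg (fun k => by positivity) (hsum.mul_left B), tsum_mul_left]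
  refine le_trans ?_ (mul_le_mul_right (sqWeight_le_weight hP hy) _)
  rw [← ENNReal.ofReal_mul hA]
  refine ENNReal.ofReal_le_ofReal ?_
  have hε : (ε y P.side : ℝ) ≤ C₁ * ε P.center (P.side / Real.sqrt 2) := by
    have hge : P.side / 2 ≤ P.side / Real.sqrt 2 := div_le_div_of_nonneg_left hl.le hsp s2
    refine h1.le (by positivity) ?_ ?_ (by linarith)
    · rw [norm_sub_rev]
      exact (DyadicSquare.norm_sub_center_le hy).trans (by linarith)
    · have : P.side / Real.sqrt 2 ≤ P.side := div_le_self hl.le s1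
      linarith
  calc _ ≤ B * (C₂ * (C₁ * ε P.center (P.side / Real.sqrt 2))) := by
        refine mul_le_mul_of_nonneg_left (hle.trans ?_) hB0
        exact mul_le_mul_of_nonneg_left hε hC₂.le
    _ = _ := by
        rw [hB, growthConst, sqWeight, hval_eq, gauge, Real.div_rpow hl.le hsp.le]
        field_simp

end BeurlingWeight


namespace BeurlingWeight

open ComplexConjugate

/-! ### Interaction between different squares -/

/-- The pairs of points that lie in different squares of the family. -/
def farSet (F : Finset DyadicSquare) : Set (ℂ × ℂ) :=
  ⋃ P ∈ F, ⋃ Q ∈ F, {q | P ≠ Q ∧ q.1 ∈ P.toSet ∧ q.2 ∈ Q.toSet}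

/-- The kernel `|z - y|⁻²` for points in different squares of the family. -/
noncomputable def farKer (F : Finset DyadicSquare) (z y : ℂ) : ℝ≥0∞ :=
  (farSet F).indicator (fun q => (‖q.1 - q.2‖ₑ ^ 2)⁻¹) (z, y)

/-- The integral operator with kernel `farKer F`. -/
noncomputable def farOp (F : Finset DyadicSquare) (g : ℂ → ℝ≥0∞) (μ : Measure ℂ) (z : ℂ) :
    ℝ≥0∞ := ∫⁻ y, farKer F z y * g y ∂μ

theorem mem_farSet {F : Finset DyadicSquare} {z y : ℂ} : (z, y) ∈ farSet F ↔
    ∃ P ∈ F, ∃ Q ∈ F, P ≠ Q ∧ z ∈ P.toSet ∧ y ∈ Q.toSet := by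
  simp only [farSet, Set.mem_iUnion, Set.mem_ofPred_eq, exists_prop]

theorem measurableSet_farSet (F : Finset DyadicSquare) : MeasurableSet (farSet F) := by
  refine Finset.measurableSet_biUnion _ fun P _ => Finset.measurableSet_biUnion _ fun Q _ => ?_
  exact (MeasurableSet.const _).inter ((measurable_fst P.measurableSet_toSet).inter
    (measurable_snd Q.measurableSet_toSet))

theorem measurable_farKer (F : Finset DyadicSquare) :
    Measurable (Function.uncurry (farKer F)) := by
  have : Function.uncurry (farKer F)
      = (farSet F).indicator (fun q => (‖q.1 - q.2‖ₑ ^ 2)⁻¹) := rfl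
  rw [this]
  exact Measurable.indicator (by fun_prop) (measurableSet_farSet F)

theorem farKer_comm (F : Finset DyadicSquare) (z y : ℂ) : farKer F z y = farKer F y z := by
  have h : (z, y) ∈ farSet F ↔ (y, z) ∈ farSet F := by
    simp only [mem_farSet]
    constructor <;> rintro ⟨P, hP, Q, hQ, h1, h2, h3⟩ <;> exact ⟨Q, hQ, P, hP, h1.symm, h3, h2⟩
  by_cases hz : (z, y) ∈ farSet F
  · rw [farKer, farKer, Set.indicator_of_mem hz, Set.indicator_of_mem (h.1 hz), ← enorm_neg,
      neg_sub]
  · rw [farKer, farKer, Set.indicator_of_notMem hz, Set.indicator_of_notMem (mt h.2 hz)]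

theorem farKer_of_notMem {F : Finset DyadicSquare} {z y : ℂ} (h : z ∉ unionSet F) :
    farKer F z y = 0 := by
  rw [farKer, Set.indicator_of_notMem]
  rw [mem_farSet]
  rintro ⟨P, hP, -, -, -, hz, -⟩
  exact h (mem_unionSet.2 ⟨P, hP, hz⟩)

/-- A crude bound depending on the family, used only for the a priori finiteness needed in the
duality argument. -/
theorem farKer_le {F : Finset DyadicSquare} (hF : DisjointTriples F) (z y : ℂ) :
    farKer F z y ≤ ∑ P ∈ F, (ENNReal.ofReal P.side ^ 2)⁻¹ := by
  by_cases h : (z, y) ∈ farSet F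
  · rw [farKer, Set.indicator_of_mem h]
    obtain ⟨P, hP, Q, hQ, hPQ, hz, hy⟩ := mem_farSet.1 h
    refine le_trans ?_ (Finset.single_le_sum (f := fun P : DyadicSquare =>
      (ENNReal.ofReal P.side ^ 2)⁻¹) (fun _ _ => zero_le) hP)
    simp only
    gcongr
    rw [← ofReal_norm]
    exact ENNReal.ofReal_le_ofReal (hF.side_le_norm_sub hP hQ hPQ hz hy)
  · rw [farKer, Set.indicator_of_notMem h]; exact zero_le

theorem measurable_farOp (F : Finset DyadicSquare) {g : ℂ → ℝ≥0∞} (hg : Measurable g)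
    (μ : Measure ℂ) [SFinite μ] : Measurable (farOp F g μ) :=
  ((measurable_farKer F).mul (hg.comp measurable_snd)).lintegral_prod_right'

theorem farOp_of_notMem {F : Finset DyadicSquare} {z : ℂ} (h : z ∉ unionSet F)
    (g : ℂ → ℝ≥0∞) (μ : Measure ℂ) : farOp F g μ z = 0 := by
  simp [farOp, farKer_of_notMem h]

/-- Points of other squares are at distance at least the side of `P`, so the decomposition into
dyadic annuli starts at that scale. -/
theorem farOp_le_tsum {F : Finset DyadicSquare} (hF : DisjointTriples F) {P : DyadicSquare}
    (hP : P ∈ F) {y : ℂ} (hy : y ∈ P.toSet) {g : ℂ → ℝ≥0∞} (hg : Measurable g) (μ : Measure ℂ) :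
    farOp F g μ y ≤ ∑' k : ℕ, ENNReal.ofReal (((2 ^ k * P.side) ^ 2)⁻¹) *
      ∫⁻ z in Metric.closedBall y (2 * (2 ^ k * P.side)), g z ∂μ := by
  have hl := P.side_pos
  have hm : ∀ k : ℕ, MeasurableSet (Metric.closedBall y (2 * (2 ^ k * P.side))) := fun k =>
    Metric.isClosed_closedBall.measurableSet
  calc farOp F g μ y ≤ ∫⁻ z, ∑' k : ℕ, ENNReal.ofReal (((2 ^ k * P.side) ^ 2)⁻¹) *
        (Metric.closedBall y (2 * (2 ^ k * P.side))).indicator g z ∂μ := by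
        refine lintegral_mono fun z => ?_
        by_cases h : (y, z) ∈ farSet F
        · obtain ⟨P', hP', Q, hQ, hPQ, hy', hz⟩ := mem_farSet.1 h
          -- Two different squares containing `y` would force a positive side to be at most the
          -- distance from `y` to itself.
          have hPP : P' = P := by
            by_contra hne
            have := hF.side_le_norm_sub hP' hP hne hy' hy
            rw [sub_self, norm_zero] at this
            exact absurd P'.side_pos (not_lt.2 this)
          subst hPP
          have hd := hF.side_le_norm_sub hP hQ hPQ hy hz
          obtain ⟨k, hk1, hk2⟩ : ∃ k : ℕ, 2 ^ k * P'.side ≤ ‖y - z‖ ∧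
              ‖y - z‖ ≤ 2 * (2 ^ k * P'.side) := by
            obtain ⟨k, h1, h2⟩ := exists_nat_pow_near (x := ‖y - z‖ / P'.side) (y := 2)
              ((one_le_div hl).2 hd) (by norm_num)
            rw [le_div_iff₀ hl] at h1
            rw [div_lt_iff₀ hl, pow_succ] at h2
            exact ⟨k, h1, by linarith⟩
          refine le_trans ?_ (ENNReal.le_tsum k)
          rw [Set.indicator_of_mem (by
            rw [Metric.mem_closedBall, dist_eq_norm, norm_sub_rev]; exact hk2),
            farKer, Set.indicator_of_mem h]
          refine mul_le_mul_left ?_ _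
          simp only
          rw [ENNReal.ofReal_inv_of_pos (by positivity), ENNReal.ofReal_pow (by positivity)]
          gcongr
          rw [← ofReal_norm]
          exact ENNReal.ofReal_le_ofReal hk1
        · rw [farKer, Set.indicator_of_notMem h, zero_mul]; exact zero_le
    _ = _ := by
        rw [lintegral_tsum fun k => ((hg.indicator (hm k)).const_mul _).aemeasurable]
        refine tsum_congr fun k => ?_
        rw [lintegral_const_mul _ (hg.indicator (hm k)), lintegral_indicator (hm k)]

/-- Tonelli and symmetry of the kernel. The two measures are kept distinct because the operator
integrates against Lebesgue measure while its transpose integrates against the weighted one. -/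
theorem lintegral_mul_farOp_comm (F : Finset DyadicSquare) {f g : ℂ → ℝ≥0∞} (hf : Measurable f)
    (hg : Measurable g) (μ ν : Measure ℂ) [SFinite μ] [SFinite ν] :
    ∫⁻ z, g z * farOp F f μ z ∂ν = ∫⁻ y, f y * farOp F g ν y ∂μ := by
  have hk := measurable_farKer F
  have hkz : ∀ z, Measurable (farKer F z) := fun z => hk.comp measurable_prodMk_left
  calc _ = ∫⁻ z, ∫⁻ y, g z * (farKer F z y * f y) ∂μ ∂ν := by
        refine lintegral_congr fun z => ?_
        rw [farOp, lintegral_const_mul _ (by fun_prop)]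
    _ = ∫⁻ y, ∫⁻ z, g z * (farKer F z y * f y) ∂ν ∂μ := by
        refine lintegral_lintegral_swap (Measurable.aemeasurable ?_)
        exact (hg.comp measurable_fst).mul (hk.mul (hf.comp measurable_snd))
    _ = _ := by
        refine lintegral_congr fun y => ?_
        rw [farOp, ← lintegral_const_mul _ (by fun_prop)]
        refine lintegral_congr fun z => ?_
        rw [farKer_comm]
        ring

section Growth

variable {t C₁ C₂ Cpack : ℝ} {ε : ℂ → ℝ → ℝ≥0} {F : Finset DyadicSquare}

/-- The hypothesis says that the centred maximal function of `g` with respect to the weight is at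
most `s` at `y`, phrased without division by ball masses. The annular series is then `s` times the
one controlled by the growth of the weight. -/
theorem farOp_le_of_forall_le (ht0 : 0 < t) (h1 : MemG1 C₁ ε) (h2 : MemG2 t C₂ ε)
    (hF : DisjointTriples F) (hp : Packing t ε Cpack F) {g : ℂ → ℝ≥0∞} (hg : Measurable g)
    {s : ℝ≥0∞} {y : ℂ} (hs : ∀ r : ℝ, 0 < r → ∫⁻ z in Metric.closedBall y r, g z
      ∂(weightMeasure t ε F) ≤ s * weightMeasure t ε F (Metric.closedBall y r)) :
    farOp F g (weightMeasure t ε F) y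
      ≤ s * (ENNReal.ofReal (growthConst t C₁ C₂ Cpack) * ENNReal.ofReal (weight t ε F y)) := by
  by_cases hy : y ∈ unionSet F
  · obtain ⟨P, hP, hyP⟩ := mem_unionSet.1 hy
    refine (farOp_le_tsum hF hP hyP hg _).trans ?_
    refine le_trans ?_ (mul_le_mul_right
      (tsum_weightMeasure_closedBall_le ht0 h1 h2 hF hp hP hyP) s)
    rw [← ENNReal.tsum_mul_left]
    refine ENNReal.tsum_le_tsum fun k => ?_
    rw [mul_left_comm s]
    refine mul_le_mul_right (hs _ ?_) _
    have := P.side_pos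
    positivity
  · rw [farOp_of_notMem hy]; exact zero_le

/-- By duality it suffices to apply the transposed operator to the constant `1`, all of whose
averages are at most `1`. -/
theorem lintegral_farOp_le (ht0 : 0 < t) (h1 : MemG1 C₁ ε) (h2 : MemG2 t C₂ ε)
    (hF : DisjointTriples F) (hp : Packing t ε Cpack F) {f : ℂ → ℝ≥0∞} (hf : Measurable f) :
    ∫⁻ z, farOp F f volume z ∂(weightMeasure t ε F)
      ≤ ENNReal.ofReal (growthConst t C₁ C₂ Cpack) * ∫⁻ z, f z ∂(weightMeasure t ε F) := by
  have h := lintegral_mul_farOp_comm F hf (measurable_const (a := (1 : ℝ≥0∞))) volume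
    (weightMeasure t ε F)
  simp_rw [one_mul] at h
  rw [h, weightMeasure, lintegral_withDensity_eq_lintegral_mul _ (measurable_ofReal_weight t ε F) hf,
    ← lintegral_const_mul _ ((measurable_ofReal_weight t ε F).mul hf)]
  refine lintegral_mono fun y => ?_
  have := farOp_le_of_forall_le ht0 h1 h2 hF hp (g := fun _ => 1) measurable_const (s := 1)
    (y := y) fun r _ => by simp
  refine (mul_le_mul_right this _).trans (le_of_eq ?_)
  simp only [Pi.mul_apply]
  ring

/-- The constant in the `L^p` estimate for the interaction between different squares, where `q` is
the exponent conjugate to `p`. -/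
noncomputable def farConst (t C₁ C₂ Cpack q : ℝ) : ℝ≥0∞ :=
  ENNReal.ofReal (growthConst t C₁ C₂ Cpack) *
    (ENNReal.ofReal (q / (q - 1)) * (2 * besN) * 2 ^ (q - 1)) ^ (1 / q)

theorem farConst_ne_top (t C₁ C₂ Cpack : ℝ) {q : ℝ} (hq : 1 < q) :
    farConst t C₁ C₂ Cpack q ≠ ∞ := by
  have h2 : (2 : ℝ≥0∞) ^ (q - 1) ≠ ∞ := ENNReal.rpow_ne_top_of_nonneg (by linarith) (by norm_num)
  have h3 : (ENNReal.ofReal (q / (q - 1)) * (2 * besN) * 2 ^ (q - 1)) ^ (1 / q) ≠ ∞ :=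
    ENNReal.rpow_ne_top_of_nonneg (by positivity) (by finiteness)
  unfold farConst
  finiteness

/-- The transposed operator applied to `g ω`, divided by the weight. -/
noncomputable def farQuot (t C₁ C₂ Cpack : ℝ) (ε : ℂ → ℝ → ℝ≥0) (F : Finset DyadicSquare)
    (g : ℂ → ℝ≥0∞) (y : ℂ) : ℝ≥0∞ :=
  farOp F g (weightMeasure t ε F) y /
    (ENNReal.ofReal (growthConst t C₁ C₂ Cpack) * ENNReal.ofReal (weight t ε F y))

/-- The quotient is dominated pointwise by the centred maximal function of `g` for the weighted
measure: if no ball about `y` has average at least `s`, then the quotient is at most `s`. -/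
theorem lintegral_farQuot_rpow_le (ht0 : 0 < t) (h1 : MemG1 C₁ ε) (h2 : MemG2 t C₂ ε)
    (hF : DisjointTriples F) (hp : Packing t ε Cpack F) {g : ℂ → ℝ≥0∞} (hg : Measurable g)
    {q : ℝ} (hq : 1 < q) :
    ∫⁻ y, farQuot t C₁ C₂ Cpack ε F g y ^ q ∂(weightMeasure t ε F)
      ≤ ENNReal.ofReal (q / (q - 1)) * (2 * besN) * 2 ^ (q - 1) *
        ∫⁻ y, g y ^ q ∂(weightMeasure t ε F) := by
  refine lintegral_rpow_le_of_centred _ (fun x r => measure_lt_top _ _) hq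
    ((measurable_farOp F hg _).div ((measurable_ofReal_weight t ε F).const_mul _)) hg
    fun y s hs hlt => ?_
  by_contra! hcon
  refine absurd hlt (not_lt.2 (ENNReal.div_le_of_le_mul ?_))
  exact farOp_le_of_forall_le ht0 h1 h2 hF hp hg fun r hr => (hcon r hr).le

/-- Only a vanishing denominator needs care. There the growth bound with `g = 1` forces the kernel
at `y` to vanish almost everywhere for the weighted measure, so both sides are zero. -/
theorem farOp_le_mul_farQuot (ht0 : 0 < t) (h1 : MemG1 C₁ ε) (h2 : MemG2 t C₂ ε)
    (hF : DisjointTriples F) (hp : Packing t ε Cpack F) {g : ℂ → ℝ≥0∞} (hg : Measurable g)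
    (y : ℂ) : farOp F g (weightMeasure t ε F) y
      ≤ ENNReal.ofReal (growthConst t C₁ C₂ Cpack) * ENNReal.ofReal (weight t ε F y) *
        farQuot t C₁ C₂ Cpack ε F g y := by
  set D := ENNReal.ofReal (growthConst t C₁ C₂ Cpack) * ENNReal.ofReal (weight t ε F y) with hD
  have hDt : D ≠ ∞ := by rw [hD]; finiteness
  by_cases h0 : D = 0
  · have hk : Measurable (farKer F y) := (measurable_farKer F).comp measurable_prodMk_left
    have h := farOp_le_of_forall_le ht0 h1 h2 hF hp (g := fun _ => 1) measurable_const (s := 1)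
      (y := y) fun r _ => by simp
    rw [← hD, h0, mul_zero, nonpos_iff_eq_zero, farOp,
      lintegral_eq_zero_iff (by fun_prop)] at h
    have h' : farOp F g (weightMeasure t ε F) y = 0 := by
      rw [farOp, lintegral_eq_zero_iff (by fun_prop)]
      filter_upwards [h] with z hz
      simp only [mul_one, Pi.zero_apply] at hz
      simp [hz]
    rw [h']; exact zero_le
  · rw [farQuot, ← hD, ENNReal.mul_div_cancel h0 hDt]

/-- Duality with the extremal test function `T^(p-1)`, whose `q`-th power integrates to `I` again.
Transposing, using the pointwise bound of the transpose by the weight times the quotient, and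
applying Hölder give `I` at most a constant times the norm of `f` times `I^(1/q)`. -/
theorem lintegral_farOp_rpow_le (ht0 : 0 < t) (h1 : MemG1 C₁ ε) (h2 : MemG2 t C₂ ε)
    (hF : DisjointTriples F) (hpk : Packing t ε Cpack F) {f : ℂ → ℝ≥0∞} (hf : Measurable f)
    (hfi : ∫⁻ y, f y ≠ ∞) {p q : ℝ} (hpq : p.HolderConjugate q) :
    (∫⁻ z, farOp F f volume z ^ p ∂(weightMeasure t ε F)) ^ (1 / p)
      ≤ farConst t C₁ C₂ Cpack q * (∫⁻ z, f z ^ p ∂(weightMeasure t ε F)) ^ (1 / p) := by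
  set ω := weightMeasure t ε F with hω
  set T := farOp F f volume with hT
  unfold farConst
  set A := ENNReal.ofReal (growthConst t C₁ C₂ Cpack) with hA
  set K := ENNReal.ofReal (q / (q - 1)) * (2 * besN) * 2 ^ (q - 1) with hK
  set I := ∫⁻ z, T z ^ p ∂ω with hI
  set g : ℂ → ℝ≥0∞ := fun z => T z ^ (p - 1) with hg
  have hp1 := hpq.lt
  have hp0 := hpq.pos
  have hTm : Measurable T := measurable_farOp F hf volume
  have hgm : Measurable g := hTm.pow_const _
  have hIfin : I ≠ ∞ := by
    have hb : ∀ z, T z ≤ (∑ P ∈ F, (ENNReal.ofReal P.side ^ 2)⁻¹) * ∫⁻ y, f y := by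
      intro z
      rw [← lintegral_const_mul _ hf]
      exact lintegral_mono fun y => mul_le_mul_left (farKer_le hF z y) _
    have hfin : (∑ P ∈ F, (ENNReal.ofReal P.side ^ 2)⁻¹) * ∫⁻ y, f y ≠ ∞ := by
      refine ENNReal.mul_ne_top (ENNReal.sum_ne_top.2 fun P _ => ?_) hfi
      exact ENNReal.inv_ne_top.2 (pow_ne_zero _ (by simpa using P.side_pos))
    refine ((lintegral_mono fun z => ENNReal.rpow_le_rpow (hb z) hp0.le).trans_lt ?_).ne
    rw [lintegral_const]
    exact ENNReal.mul_lt_top (ENNReal.rpow_lt_top_of_nonneg hp0.le hfin) (measure_lt_top _ _)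
  have hgq : ∫⁻ y, g y ^ q ∂ω = I := by
    refine lintegral_congr fun y => ?_
    rw [hg, ← ENNReal.rpow_mul, hpq.sub_one_mul_conj]
  have hI1 : I = ∫⁻ z, g z * T z ∂ω := by
    refine lintegral_congr fun z => ?_
    have h := ENNReal.rpow_add_of_nonneg (x := T z) (p - 1) 1 (by linarith) zero_le_one
    rwa [sub_add_cancel, ENNReal.rpow_one] at h
  have hQm : Measurable (farQuot t C₁ C₂ Cpack ε F g) :=
    (measurable_farOp F hgm _).div ((measurable_ofReal_weight t ε F).const_mul _)
  have hI2 : I ≤ A * ∫⁻ y, f y * farQuot t C₁ C₂ Cpack ε F g y ∂ω := by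
    have hw := lintegral_withDensity_eq_lintegral_mul (volume : Measure ℂ)
      (measurable_ofReal_weight t ε F) (hf.mul hQm)
    rw [← weightMeasure, ← hω] at hw
    simp only [Pi.mul_apply] at hw
    have hwm := measurable_ofReal_weight t ε F
    rw [hI1, lintegral_mul_farOp_comm F hf hgm, hw, ← lintegral_const_mul _ (by fun_prop)]
    refine lintegral_mono fun y => ?_
    refine (mul_le_mul_right (farOp_le_mul_farQuot ht0 h1 h2 hF hpk hgm y) _).trans (le_of_eq ?_)
    ring
  have hI3 : I ≤ A * K ^ (1 / q) * (∫⁻ z, f z ^ p ∂ω) ^ (1 / p) * I ^ (1 / q) := by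
    calc I ≤ A * ((∫⁻ z, f z ^ p ∂ω) ^ (1 / p) *
          (∫⁻ y, farQuot t C₁ C₂ Cpack ε F g y ^ q ∂ω) ^ (1 / q)) :=
          hI2.trans (mul_le_mul_right
            (ENNReal.lintegral_mul_le_Lp_mul_Lq ω hpq hf.aemeasurable hQm.aemeasurable) _)
      _ ≤ A * ((∫⁻ z, f z ^ p ∂ω) ^ (1 / p) * (K * I) ^ (1 / q)) := by
          refine mul_le_mul_right (mul_le_mul_right (ENNReal.rpow_le_rpow ?_
            (by have := hpq.symm.pos; positivity)) _) _
          rw [← hgq]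
          exact lintegral_farQuot_rpow_le ht0 h1 h2 hF hpk hgm hpq.symm.lt
      _ = _ := by
          rw [ENNReal.mul_rpow_of_nonneg _ _ (by have := hpq.symm.pos; positivity)]
          ring
  by_cases hI0 : I = 0
  · rw [hI0, ENNReal.zero_rpow_of_pos (by positivity)]; exact zero_le
  have hq0 : I ^ (1 / q) ≠ 0 := (ENNReal.rpow_pos (pos_iff_ne_zero.2 hI0) hIfin).ne'
  have hqt : I ^ (1 / q) ≠ ∞ := ENNReal.rpow_ne_top_of_nonneg
    (by have := hpq.symm.pos; positivity) hIfin
  have hsplit : I = I ^ (1 / p) * I ^ (1 / q) := by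
    rw [← ENNReal.rpow_add _ _ hI0 hIfin, one_div, one_div, hpq.inv_add_inv_eq_one,
      ENNReal.rpow_one]
  -- The factor `I^(1/q)` is cancelled; it is nonzero and finite by `hI0` and `hIfin`.
  refine (ENNReal.mul_le_mul_iff_left hq0 hqt).1 ?_
  rw [← hsplit]
  exact hI3

end Growth

end BeurlingWeight


namespace BeurlingWeight

open ComplexConjugate

/-! ### Weighted estimates -/

/-- Outside `P` the function lives on the other squares, where the truncated kernel is dominated in
modulus by `farKer`, whatever the truncation. -/
theorem maxBeurling_le_near_add_far {F : Finset DyadicSquare} {u : ℂ → ℂ} (hu : Integrable u)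
    (hs : ∀ y, y ∉ unionSet F → u y = 0) {P : DyadicSquare} (hP : P ∈ F) {z : ℂ}
    (hz : z ∈ P.toSet) : maxBeurling u z
      ≤ maxBeurling (P.toSet.indicator u) z + farOp F (fun y => ‖u y‖ₑ) volume z := by
  have hPu : Integrable (P.toSet.indicator u) := hu.indicator P.measurableSet_toSet
  refine iSup₂_le fun δ hδ => ?_
  have e : truncBeurling δ u z = truncBeurling δ (P.toSet.indicator u) z
      + truncBeurling δ (fun y => u y - P.toSet.indicator u y) z := by
    rw [truncBeurling_sub_fun hu hPu hδ]; ring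
  rw [e]
  refine (enorm_add_le _ _).trans (add_le_add (le_maxBeurling _ z hδ) ?_)
  rw [truncBeurling, enorm_mul]
  refine (mul_le_mul_left enorm_neg_inv_pi_le _).trans ?_
  rw [one_mul]
  refine (enorm_integral_le_lintegral_enorm _).trans ((setLIntegral_le_lintegral _ _).trans ?_)
  refine lintegral_mono fun y => ?_
  by_cases hy : y ∈ P.toSet
  · simp [hy]
  by_cases hyF : y ∈ unionSet F
  · obtain ⟨Q, hQ, hyQ⟩ := mem_unionSet.1 hyF
    have hPQ : P ≠ Q := fun h => hy (h ▸ hyQ)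
    have hm : (z, y) ∈ farSet F := mem_farSet.2 ⟨P, hP, Q, hQ, hPQ, hz, hyQ⟩
    rw [farKer, Set.indicator_of_mem hm, Set.indicator_of_notMem hy, sub_zero, div_eq_mul_inv,
      enorm_mul, mul_comm]
    refine mul_le_mul_left ?_ _
    by_cases h0 : (z - y) ^ 2 = 0
    · simp [h0]
    · rw [enorm_inv h0, enorm_pow]
  · simp [hy, hs y hyF]

theorem lintegral_enorm_indicator_rpow (P : DyadicSquare) (u : ℂ → ℂ) {p : ℝ} (hp : 0 < p) :
    ∫⁻ z, ‖P.toSet.indicator u z‖ₑ ^ p = ∫⁻ z in P.toSet, ‖u z‖ₑ ^ p := by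
  rw [← lintegral_indicator P.measurableSet_toSet]
  refine lintegral_congr fun z => ?_
  by_cases hz : z ∈ P.toSet <;> simp [hz, hp]

section Weighted

variable {t C₁ C₂ Cpack : ℝ} {ε : ℂ → ℝ → ℝ≥0} {F : Finset DyadicSquare}

/-- The constant in the weighted strong type estimate. -/
noncomputable def wConst (t C₁ C₂ Cpack p : ℝ) : ℝ≥0∞ :=
  2 ^ (p - 1) * (beurConst p + farConst t C₁ C₂ Cpack (p / (p - 1)) ^ p)

theorem wConst_ne_top (t C₁ C₂ Cpack : ℝ) {p : ℝ} (hp : 1 < p) : wConst t C₁ C₂ Cpack p ≠ ∞ := by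
  have h1 := beurConst_ne_top hp
  have h2 : (2 : ℝ≥0∞) ^ (p - 1) ≠ ∞ := ENNReal.rpow_ne_top_of_nonneg (by linarith) (by norm_num)
  have hq : 1 < p / (p - 1) := (Real.HolderConjugate.conjExponent hp).symm.lt
  have h3 : farConst t C₁ C₂ Cpack (p / (p - 1)) ^ p ≠ ∞ :=
    ENNReal.rpow_ne_top_of_nonneg (by linarith) (farConst_ne_top t C₁ C₂ Cpack hq)
  unfold wConst
  finiteness

/-- On each square the unweighted strong type estimate, applied to the restriction of `u` to that
square, is multiplied by the constant value of the weight; summing over squares restores the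
weighted norms, and the far part is already weighted. -/
theorem lintegral_maxBeurling_rpow_le (ht0 : 0 < t) (h1 : MemG1 C₁ ε) (h2 : MemG2 t C₂ ε)
    (hF : DisjointTriples F) (hpk : Packing t ε Cpack F) {u : ℂ → ℂ} (hum : Measurable u)
    (hu : Integrable u) (hs : ∀ y, y ∉ unionSet F → u y = 0) {p : ℝ} (hp : 1 < p) :
    ∫⁻ z, maxBeurling u z ^ p ∂(weightMeasure t ε F)
      ≤ wConst t C₁ C₂ Cpack p * ∫⁻ z, ‖u z‖ₑ ^ p ∂(weightMeasure t ε F) := by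
  have hp0 : 0 < p := by linarith
  have h2t : (2 : ℝ≥0∞) ^ (p - 1) ≠ ∞ := ENNReal.rpow_ne_top_of_nonneg (by linarith) (by norm_num)
  set T := farOp F (fun y => ‖u y‖ₑ) volume with hT
  have hTm : Measurable T := measurable_farOp F hum.enorm volume
  have hnear : ∀ P ∈ F, ∫⁻ z in P.toSet, maxBeurling u z ^ p
      ≤ 2 ^ (p - 1) * (beurConst p * (∫⁻ z in P.toSet, ‖u z‖ₑ ^ p)
        + ∫⁻ z in P.toSet, T z ^ p) := by
    intro P hP
    have hPu : Integrable (P.toSet.indicator u) := hu.indicator P.measurableSet_toSet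
    calc _ ≤ ∫⁻ z in P.toSet, 2 ^ (p - 1) *
          (maxBeurling (P.toSet.indicator u) z ^ p + T z ^ p) := by
          refine setLIntegral_mono_ae' P.measurableSet_toSet (ae_of_all _ fun z hz => ?_)
          exact (ENNReal.rpow_le_rpow (maxBeurling_le_near_add_far hu hs hP hz) hp0.le).trans
            (ENNReal.rpow_add_le_mul_rpow_add_rpow _ _ hp.le)
      _ = 2 ^ (p - 1) * ((∫⁻ z in P.toSet, maxBeurling (P.toSet.indicator u) z ^ p)
            + ∫⁻ z in P.toSet, T z ^ p) := by
          rw [lintegral_const_mul' _ _ h2t, lintegral_add_right _ (hTm.pow_const p)]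
      _ ≤ _ := by
          refine mul_le_mul_right (add_le_add_left ?_ _) _
          refine (setLIntegral_le_lintegral _ _).trans ((maxBeurling_strong hPu hp).trans ?_)
          rw [lintegral_enorm_indicator_rpow P u hp0]
  have hfar : ∫⁻ z, T z ^ p ∂(weightMeasure t ε F)
      ≤ farConst t C₁ C₂ Cpack (p / (p - 1)) ^ p * ∫⁻ z, ‖u z‖ₑ ^ p ∂(weightMeasure t ε F) := by
    have h := lintegral_farOp_rpow_le ht0 h1 h2 hF hpk hum.enorm hu.2.ne
      (Real.HolderConjugate.conjExponent hp)
    have h' := ENNReal.rpow_le_rpow h hp0.le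
    rwa [ENNReal.mul_rpow_of_nonneg _ _ hp0.le, ← ENNReal.rpow_mul, ← ENNReal.rpow_mul,
      one_div_mul_cancel hp0.ne', ENNReal.rpow_one, ENNReal.rpow_one] at h'
  calc _ = ∑ P ∈ F, ENNReal.ofReal (sqWeight t ε P) * ∫⁻ z in P.toSet, maxBeurling u z ^ p :=
        lintegral_weightMeasure _ _ _ _
    _ ≤ ∑ P ∈ F, ENNReal.ofReal (sqWeight t ε P) * (2 ^ (p - 1) *
          (beurConst p * (∫⁻ z in P.toSet, ‖u z‖ₑ ^ p) + ∫⁻ z in P.toSet, T z ^ p)) :=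
        Finset.sum_le_sum fun P hP => mul_le_mul_right (hnear P hP) _
    _ = 2 ^ (p - 1) * (beurConst p * (∫⁻ z, ‖u z‖ₑ ^ p ∂(weightMeasure t ε F))
          + ∫⁻ z, T z ^ p ∂(weightMeasure t ε F)) := by
        rw [lintegral_weightMeasure, lintegral_weightMeasure, Finset.mul_sum,
          ← Finset.sum_add_distrib, Finset.mul_sum]
        refine Finset.sum_congr rfl fun P _ => ?_
        ring
    _ ≤ _ := by
        refine (mul_le_mul_right (add_le_add_right hfar _) _).trans (le_of_eq ?_)
        rw [wConst]
        ring

/-- The constant in the weighted weak type estimate. -/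
noncomputable def wConst₁ (t C₁ C₂ Cpack : ℝ) : ℝ≥0∞ :=
  2 * (beurConst₁ + ENNReal.ofReal (growthConst t C₁ C₂ Cpack))

theorem wConst₁_ne_top (t C₁ C₂ Cpack : ℝ) : wConst₁ t C₁ C₂ Cpack ≠ ∞ := by
  have := beurConst₁_ne_top
  unfold wConst₁
  finiteness

/-- The level is split in halves: the near part uses the unweighted weak type estimate square by
square, the far part the `L¹` bound and Chebyshev. -/
theorem mul_weightMeasure_lt_maxBeurling_le (ht0 : 0 < t) (h1 : MemG1 C₁ ε) (h2 : MemG2 t C₂ ε)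
    (hF : DisjointTriples F) (hpk : Packing t ε Cpack F) {u : ℂ → ℂ} (hum : Measurable u)
    (hu : Integrable u) (hs : ∀ y, y ∉ unionSet F → u y = 0) (a : ℝ≥0∞) :
    a * weightMeasure t ε F {z | a < maxBeurling u z}
      ≤ wConst₁ t C₁ C₂ Cpack * ∫⁻ z, ‖u z‖ₑ ∂(weightMeasure t ε F) := by
  set T := farOp F (fun y => ‖u y‖ₑ) volume with hT
  have hTm : Measurable T := measurable_farOp F hum.enorm volume
  have hma : MeasurableSet {z | a < maxBeurling u z} :=
    measurableSet_lt measurable_const (measurable_maxBeurling hu)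
  have hmT : MeasurableSet {z | a / 2 ≤ T z} := measurableSet_le measurable_const hTm
  have hnear : ∀ P ∈ F, a * volume ({z | a < maxBeurling u z} ∩ P.toSet)
      ≤ 2 * (beurConst₁ * ∫⁻ z in P.toSet, ‖u z‖ₑ)
        + 2 * (a / 2 * volume ({z | a / 2 ≤ T z} ∩ P.toSet)) := by
    intro P hP
    have hPu : Integrable (P.toSet.indicator u) := hu.indicator P.measurableSet_toSet
    have hsub : {z | a < maxBeurling u z} ∩ P.toSet
        ⊆ {z | a / 2 < maxBeurling (P.toSet.indicator u) z} ∪ ({z | a / 2 ≤ T z} ∩ P.toSet) := by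
      rintro z ⟨hza, hzP⟩
      by_contra h
      simp only [Set.mem_union, Set.mem_inter_iff, Set.mem_ofPred_eq, not_or, not_lt, not_and,
        hzP, not_true, imp_false, not_le] at h
      have h3 : a < maxBeurling u z := hza
      have h4 := h3.trans_le ((maxBeurling_le_near_add_far hu hs hP hzP).trans
        (add_le_add h.1 h.2.le))
      rw [ENNReal.add_halves] at h4
      exact lt_irrefl _ h4
    have hw := maxBeurling_weak hPu (a / 2)
    have hI : ∫⁻ y, ‖P.toSet.indicator u y‖ₑ = ∫⁻ z in P.toSet, ‖u z‖ₑ := by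
      simpa using lintegral_enorm_indicator_rpow P u one_pos
    rw [hI] at hw
    calc _ ≤ a * (volume {z | a / 2 < maxBeurling (P.toSet.indicator u) z}
            + volume ({z | a / 2 ≤ T z} ∩ P.toSet)) :=
          mul_le_mul_right ((measure_mono hsub).trans (measure_union_le _ _)) _
      _ = 2 * (a / 2 * volume {z | a / 2 < maxBeurling (P.toSet.indicator u) z})
            + 2 * (a / 2 * volume ({z | a / 2 ≤ T z} ∩ P.toSet)) := by
          rw [mul_add, ← mul_assoc, ← mul_assoc, ENNReal.mul_div_cancel (by norm_num) (by norm_num)]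
      _ ≤ _ := add_le_add_left (mul_le_mul_right hw _) _
  have hfar : a / 2 * weightMeasure t ε F {z | a / 2 ≤ T z}
      ≤ ENNReal.ofReal (growthConst t C₁ C₂ Cpack) * ∫⁻ z, ‖u z‖ₑ ∂(weightMeasure t ε F) :=
    (mul_meas_ge_le_lintegral hTm _).trans (lintegral_farOp_le ht0 h1 h2 hF hpk hum.enorm)
  calc _ = ∑ P ∈ F, ENNReal.ofReal (sqWeight t ε P) *
          (a * volume ({z | a < maxBeurling u z} ∩ P.toSet)) := by
        rw [weightMeasure_apply _ _ _ hma, Finset.mul_sum]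
        exact Finset.sum_congr rfl fun P _ => mul_left_comm _ _ _
    _ ≤ ∑ P ∈ F, ENNReal.ofReal (sqWeight t ε P) * (2 * (beurConst₁ * ∫⁻ z in P.toSet, ‖u z‖ₑ)
          + 2 * (a / 2 * volume ({z | a / 2 ≤ T z} ∩ P.toSet))) :=
        Finset.sum_le_sum fun P hP => mul_le_mul_right (hnear P hP) _
    _ = 2 * (beurConst₁ * ∫⁻ z, ‖u z‖ₑ ∂(weightMeasure t ε F))
          + 2 * (a / 2 * weightMeasure t ε F {z | a / 2 ≤ T z}) := by
        rw [lintegral_weightMeasure, weightMeasure_apply _ _ _ hmT]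
        simp_rw [Finset.mul_sum]
        rw [← Finset.sum_add_distrib]
        refine Finset.sum_congr rfl fun P _ => ?_
        ring
    _ ≤ _ := by
        refine (add_le_add_right (mul_le_mul_right hfar _) _).trans (le_of_eq ?_)
        rw [wConst₁]
        ring

/-! ### Degenerate gauges and measurable representatives -/

theorem MemG1.eq_zero_of_eq_zero (h : MemG1 C₁ ε) {x y : ℂ} {r s : ℝ} (hr : 0 < r)
    (hxy : ‖x - y‖ ≤ 2 * r) (hrs : r / 2 ≤ s) (hsr : s ≤ 2 * r) (h0 : ε x r = 0) : ε y s = 0 := by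
  have := h.le hr hxy hrs hsr
  rw [h0, NNReal.coe_zero, mul_zero] at this
  exact_mod_cast le_antisymm this (ε y s).2

/-- Vanishing propagates between comparable balls: the radius at `x` is doubled until the ball is
large enough to move the centre to `y`, and then halved down to the scale `s`. -/
theorem MemG1.eq_zero (h : MemG1 C₁ ε) {x : ℂ} {r : ℝ} (hr : 0 < r) (h0 : ε x r = 0) (y : ℂ)
    {s : ℝ} (hs : 0 < s) : ε y s = 0 := by
  have hup : ∀ k : ℕ, ε x (2 ^ k * r) = 0 := by
    intro k
    induction k with
    | zero => simpa using h0
    | succ k ih =>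
      have hk : 0 < 2 ^ k * r := by positivity
      refine h.eq_zero_of_eq_zero hk (by simpa using hk.le) ?_ ?_ ih <;> rw [pow_succ] <;> linarith
  have hdown : ∀ (R : ℝ), 0 < R → ε y R = 0 → ∀ k : ℕ, ε y (R / 2 ^ k) = 0 := by
    intro R hR hR0 k
    induction k with
    | zero => simpa using hR0
    | succ k ih =>
      have hk : 0 < R / 2 ^ k := by positivity
      have e : R / 2 ^ (k + 1) = R / 2 ^ k / 2 := by rw [pow_succ, div_div]
      refine h.eq_zero_of_eq_zero hk (by simpa using hk.le) ?_ ?_ ih <;> rw [e]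
      linarith
  obtain ⟨k, hk⟩ := pow_unbounded_of_one_lt (max (‖x - y‖ / r) (s / r)) (one_lt_two (α := ℝ))
  have hk1 := (div_lt_iff₀ hr).1 ((le_max_left _ _).trans_lt hk)
  have hk2 := (div_lt_iff₀ hr).1 ((le_max_right _ _).trans_lt hk)
  have hR : 0 < 2 ^ k * r := by positivity
  have hyR : ε y (2 ^ k * r) = 0 :=
    h.eq_zero_of_eq_zero hR (by linarith) (by linarith) (by linarith) (hup k)
  obtain ⟨n, hn1, hn2⟩ := exists_nat_pow_near (x := 2 ^ k * r / s) (y := 2)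
    ((one_le_div hs).2 hk2.le) (by norm_num)
  rw [le_div_iff₀ hs] at hn1
  rw [div_lt_iff₀ hs] at hn2
  have hn : (0 : ℝ) < 2 ^ n := by positivity
  refine h.eq_zero_of_eq_zero (r := 2 ^ k * r / 2 ^ n) (by positivity)
    (by rw [sub_self, norm_zero]; positivity) ?_ ?_ (hdown _ hR hyR n)
  · rw [div_div, div_le_iff₀ (by positivity), ← pow_succ, mul_comm s]
    exact hn2.le
  · have h3 : s ≤ 2 ^ k * r / 2 ^ n := by rw [le_div_iff₀ hn, mul_comm]; exact hn1
    linarith [hs]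

theorem weightMeasure_eq_zero_or (h1 : MemG1 C₁ ε) (F : Finset DyadicSquare) :
    weightMeasure t ε F = 0 ∨ ∀ P, 0 < sqWeight t ε P := by
  by_cases h : ∀ P : DyadicSquare, ε P.center (P.side / Real.sqrt 2) ≠ 0
  · right
    intro P
    have h3 : (0 : ℝ) < ε P.center (P.side / Real.sqrt 2) := by
      exact_mod_cast pos_iff_ne_zero.2 (h P)
    have h4 := P.side_pos
    rw [sqWeight, hval_eq, gauge]
    positivity
  · left
    push Not at h
    obtain ⟨P, hP⟩ := h
    have h4 := P.side_pos
    have h0 : ∀ Q, sqWeight t ε Q = 0 := by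
      intro Q
      have h5 := Q.side_pos
      rw [sqWeight, hval_eq, gauge, h1.eq_zero (by positivity) hP Q.center (by positivity)]
      simp
    rw [weightMeasure_eq_sum]
    exact Finset.sum_eq_zero fun Q _ => by simp [h0 Q]

/-- On each of the finitely many squares Lebesgue measure is finite and at most a multiple of the
weighted measure. Positivity of the weight is essential, as otherwise the weighted norm would not
control `f`. -/
theorem integrable_indicator_of_memLp (hw : ∀ P, 0 < sqWeight t ε P) {f : ℂ → ℂ} {p : ℝ≥0∞}
    (hp : 1 ≤ p) (hf : MemLp f p (weightMeasure t ε F)) : Integrable ((unionSet F).indicator f) := by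
  have h : IntegrableOn f (unionSet F) := by
    rw [unionSet, integrableOn_finset_iUnion]
    intro P hP
    have hc : ENNReal.ofReal (sqWeight t ε P) ≠ 0 := by simpa using hw P
    have hle : (volume : Measure ℂ).restrict P.toSet
        ≤ (ENNReal.ofReal (sqWeight t ε P))⁻¹ • weightMeasure t ε F := by
      refine Measure.le_iff.2 fun s hs => ?_
      rw [Measure.restrict_apply hs, Measure.smul_apply, smul_eq_mul, weightMeasure_apply _ _ _ hs]
      calc volume (s ∩ P.toSet) = (ENNReal.ofReal (sqWeight t ε P))⁻¹ *
            (ENNReal.ofReal (sqWeight t ε P) * volume (s ∩ P.toSet)) := by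
            rw [← mul_assoc, ENNReal.inv_mul_cancel hc ENNReal.ofReal_ne_top, one_mul]
        _ ≤ _ := by
            refine mul_le_mul_right ?_ _
            exact Finset.single_le_sum (f := fun P : DyadicSquare =>
              ENNReal.ofReal (sqWeight t ε P) * volume (s ∩ P.toSet)) (fun _ _ => zero_le) hP
    have : IsFiniteMeasure ((volume : Measure ℂ).restrict P.toSet) :=
      ⟨by rw [Measure.restrict_apply_univ, P.volume_toSet]; exact ENNReal.ofReal_lt_top⟩
    exact (hf.of_measure_le_smul (ENNReal.inv_ne_top.2 hc) hle).integrable hp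
  exact h.integrable_indicator (measurableSet_unionSet F)

theorem truncBeurling_congr {u v : ℂ → ℂ} (h : u =ᵐ[volume] v) (δ : ℝ) (z : ℂ) :
    truncBeurling δ u z = truncBeurling δ v z := by
  rw [truncBeurling, truncBeurling]
  congr 1
  refine integral_congr_ae (ae_restrict_of_ae ?_)
  filter_upwards [h] with ξ hξ
  rw [hξ]

theorem maxBeurling_congr {u v : ℂ → ℂ} (h : u =ᵐ[volume] v) : maxBeurling u = maxBeurling v := by
  funext z
  simp only [maxBeurling, truncBeurling_congr h]

theorem exists_measurable_rep {f : ℂ → ℂ} (hf : Integrable ((unionSet F).indicator f)) :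
    ∃ u : ℂ → ℂ, Measurable u ∧ Integrable u ∧ (∀ y, y ∉ unionSet F → u y = 0) ∧
      u =ᵐ[volume] (unionSet F).indicator f ∧ u =ᵐ[weightMeasure t ε F] f := by
  set v := hf.1.mk ((unionSet F).indicator f) with hv
  have hvf : (unionSet F).indicator f =ᵐ[volume] v := hf.1.ae_eq_mk
  have hvm : Measurable v := hf.1.stronglyMeasurable_mk.measurable
  have e : (unionSet F).indicator v =ᵐ[volume] (unionSet F).indicator f := by
    filter_upwards [hvf] with z hz
    by_cases h : z ∈ unionSet F
    · rw [Set.indicator_of_mem h, ← hz]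
    · rw [Set.indicator_of_notMem h, Set.indicator_of_notMem h]
  refine ⟨(unionSet F).indicator v, hvm.indicator (measurableSet_unionSet F), hf.congr e.symm,
    fun y hy => Set.indicator_of_notMem hy _, e, ?_⟩
  filter_upwards [(weightMeasure_ac t ε F).ae_le e, ae_mem_unionSet t ε F] with z hz hzF
  rw [hz, Set.indicator_of_mem hzF]

end Weighted

end BeurlingWeight


namespace BeurlingWeight

open ComplexConjugate

/-! ### The Beurling transform on the weighted spaces -/

section Conclusion

variable {t C₁ C₂ Cpack : ℝ} {ε : ℂ → ℝ → ℝ≥0} {F : Finset DyadicSquare}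

theorem eLpNorm_maxBeurling_le (ht0 : 0 < t) (h1 : MemG1 C₁ ε) (h2 : MemG2 t C₂ ε)
    (hF : DisjointTriples F) (hpk : Packing t ε Cpack F) {f : ℂ → ℂ}
    (hf : Integrable ((unionSet F).indicator f)) {p : ℝ} (hp : 1 < p) :
    eLpNorm (maxBeurling ((unionSet F).indicator f)) (ENNReal.ofReal p) (weightMeasure t ε F)
      ≤ (wConst t C₁ C₂ Cpack p ^ (1 / p)).toNNReal *
        eLpNorm f (ENNReal.ofReal p) (weightMeasure t ε F) := by
  have hp0 : 0 < p := by linarith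
  have hpi : 0 ≤ 1 / p := by positivity
  obtain ⟨u, hum, hu, hs, huf, huf'⟩ := exists_measurable_rep (t := t) (ε := ε) hf
  rw [ENNReal.coe_toNNReal (ENNReal.rpow_ne_top_of_nonneg hpi (wConst_ne_top t C₁ C₂ Cpack hp)),
    ← maxBeurling_congr huf, ← eLpNorm_congr_ae huf',
    eLpNorm_eq_lintegral_rpow_enorm_toReal (by simpa using hp0) ENNReal.ofReal_ne_top,
    eLpNorm_eq_lintegral_rpow_enorm_toReal (by simpa using hp0) ENNReal.ofReal_ne_top,
    ENNReal.toReal_ofReal hp0.le, ← ENNReal.mul_rpow_of_nonneg _ _ hpi]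
  simp_rw [enorm_eq_self]
  exact ENNReal.rpow_le_rpow (lintegral_maxBeurling_rpow_le ht0 h1 h2 hF hpk hum hu hs hp) hpi

theorem weakL1Norm_maxBeurling_le (ht0 : 0 < t) (h1 : MemG1 C₁ ε) (h2 : MemG2 t C₂ ε)
    (hF : DisjointTriples F) (hpk : Packing t ε Cpack F) {f : ℂ → ℂ}
    (hf : Integrable ((unionSet F).indicator f)) :
    weakL1Norm (maxBeurling ((unionSet F).indicator f)) (weightMeasure t ε F)
      ≤ (wConst₁ t C₁ C₂ Cpack).toNNReal * eLpNorm f 1 (weightMeasure t ε F) := by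
  obtain ⟨u, hum, hu, hs, huf, huf'⟩ := exists_measurable_rep (t := t) (ε := ε) hf
  rw [ENNReal.coe_toNNReal (wConst₁_ne_top t C₁ C₂ Cpack), ← maxBeurling_congr huf,
    ← eLpNorm_congr_ae huf', eLpNorm_one_eq_lintegral_enorm]
  refine iSup_le fun s => ?_
  simp_rw [enorm_eq_self]
  exact mul_weightMeasure_lt_maxBeurling_le ht0 h1 h2 hF hpk hum hu hs s

theorem ae_weightMeasure_beurlingConverges {f : ℂ → ℂ}
    (hf : Integrable ((unionSet F).indicator f)) :
    ∀ᵐ z ∂(weightMeasure t ε F), BeurlingConverges ((unionSet F).indicator f) z :=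
  (weightMeasure_ac t ε F).ae_le (ae_beurlingConverges hf)

theorem eLpNorm_beurling_le {f : ℂ → ℂ} (hf : Integrable ((unionSet F).indicator f)) (p : ℝ≥0∞) :
    eLpNorm (beurling ((unionSet F).indicator f)) p (weightMeasure t ε F)
      ≤ eLpNorm (maxBeurling ((unionSet F).indicator f)) p (weightMeasure t ε F) := by
  refine eLpNorm_mono_enorm_ae ?_
  filter_upwards [ae_weightMeasure_beurlingConverges hf] with z hz
  exact enorm_beurling_le hz

theorem weakL1Norm_beurling_le {f : ℂ → ℂ} (hf : Integrable ((unionSet F).indicator f)) :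
    weakL1Norm (beurling ((unionSet F).indicator f)) (weightMeasure t ε F)
      ≤ weakL1Norm (maxBeurling ((unionSet F).indicator f)) (weightMeasure t ε F) := by
  refine iSup_mono fun s => mul_le_mul_right (measure_mono_ae ?_) _
  filter_upwards [ae_weightMeasure_beurlingConverges hf] with z hz hs
  exact lt_of_lt_of_le hs (enorm_beurling_le hz)

theorem weakL1Norm_zero_measure {E : Type*} [ENorm E] (g : ℂ → E) :
    weakL1Norm g (0 : Measure ℂ) = 0 := by
  simp [weakL1Norm]

end Conclusion

end BeurlingWeight

/-- The constants are chosen before `ε` and `F`, which expresses their uniformity. Measurability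
accompanies every bound, because `weakL1Norm` and `eLpNorm` are written for arbitrary functions. -/
theorem mainTheorem6 (t : ℝ) (ht0 : 0 < t) (ht2 : t < 2) (C₁ C₂ Cpack : ℝ) :
    (∀ p : ℝ, 1 < p → ∃ C : ℝ≥0,
      ∀ (ε : ℂ → ℝ → ℝ≥0) (F : Finset BeurlingWeight.DyadicSquare),
        BeurlingWeight.MemG1 C₁ ε → BeurlingWeight.MemG2 t C₂ ε →
        BeurlingWeight.DisjointTriples F → BeurlingWeight.Packing t ε Cpack F →
        ∀ f : ℂ → ℂ,
          MemLp f (ENNReal.ofReal p) (BeurlingWeight.weightMeasure t ε F) →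
          (∀ᵐ z ∂(BeurlingWeight.weightMeasure t ε F),
            BeurlingWeight.BeurlingConverges ((BeurlingWeight.unionSet F).indicator f) z) ∧
          MemLp (BeurlingWeight.beurling ((BeurlingWeight.unionSet F).indicator f))
            (ENNReal.ofReal p) (BeurlingWeight.weightMeasure t ε F) ∧
          eLpNorm (BeurlingWeight.beurling ((BeurlingWeight.unionSet F).indicator f))
              (ENNReal.ofReal p) (BeurlingWeight.weightMeasure t ε F)
            ≤ C * eLpNorm f (ENNReal.ofReal p) (BeurlingWeight.weightMeasure t ε F) ∧
          MemLp (BeurlingWeight.maxBeurling ((BeurlingWeight.unionSet F).indicator f))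
            (ENNReal.ofReal p) (BeurlingWeight.weightMeasure t ε F) ∧
          eLpNorm (BeurlingWeight.maxBeurling ((BeurlingWeight.unionSet F).indicator f))
              (ENNReal.ofReal p) (BeurlingWeight.weightMeasure t ε F)
            ≤ C * eLpNorm f (ENNReal.ofReal p) (BeurlingWeight.weightMeasure t ε F)) ∧
    (∃ C : ℝ≥0,
      ∀ (ε : ℂ → ℝ → ℝ≥0) (F : Finset BeurlingWeight.DyadicSquare),
        BeurlingWeight.MemG1 C₁ ε → BeurlingWeight.MemG2 t C₂ ε →
        BeurlingWeight.DisjointTriples F → BeurlingWeight.Packing t ε Cpack F →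
        ∀ f : ℂ → ℂ,
          MemLp f 1 (BeurlingWeight.weightMeasure t ε F) →
          (∀ᵐ z ∂(BeurlingWeight.weightMeasure t ε F),
            BeurlingWeight.BeurlingConverges ((BeurlingWeight.unionSet F).indicator f) z) ∧
          AEStronglyMeasurable
            (BeurlingWeight.beurling ((BeurlingWeight.unionSet F).indicator f))
            (BeurlingWeight.weightMeasure t ε F) ∧
          BeurlingWeight.weakL1Norm
              (BeurlingWeight.beurling ((BeurlingWeight.unionSet F).indicator f))
              (BeurlingWeight.weightMeasure t ε F)
            ≤ C * eLpNorm f 1 (BeurlingWeight.weightMeasure t ε F) ∧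
          AEStronglyMeasurable
            (BeurlingWeight.maxBeurling ((BeurlingWeight.unionSet F).indicator f))
            (BeurlingWeight.weightMeasure t ε F) ∧
          BeurlingWeight.weakL1Norm
              (BeurlingWeight.maxBeurling ((BeurlingWeight.unionSet F).indicator f))
              (BeurlingWeight.weightMeasure t ε F)
            ≤ C * eLpNorm f 1 (BeurlingWeight.weightMeasure t ε F)) := by
  open BeurlingWeight in
  refine ⟨fun p hp => ⟨(wConst t C₁ C₂ Cpack p ^ (1 / p)).toNNReal,
    fun ε F h1 h2 hF hpk f hf => ?_⟩,
    ⟨(wConst₁ t C₁ C₂ Cpack).toNNReal, fun ε F h1 h2 hF hpk f hf => ?_⟩⟩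
  -- By the class `𝒢₁` a gauge that vanishes once vanishes identically; then the measure is zero and
  -- every claim is trivial. Otherwise the restricted function is Lebesgue integrable and the
  -- unweighted theory is available.
  · rcases weightMeasure_eq_zero_or (t := t) h1 F with h0 | hw
    · simp [h0]
    · have hi := integrable_indicator_of_memLp hw
        (by rw [← ENNReal.ofReal_one]; exact ENNReal.ofReal_le_ofReal hp.le) hf
      have hmax := eLpNorm_maxBeurling_le ht0 h1 h2 hF hpk hi hp
      have hb := (eLpNorm_beurling_le hi (ENNReal.ofReal p)).trans hmax
      have hfin := ENNReal.mul_lt_top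
        (ENNReal.coe_lt_top (r := (wConst t C₁ C₂ Cpack p ^ (1 / p)).toNNReal)) hf.2
      exact ⟨ae_weightMeasure_beurlingConverges hi,
        ⟨aestronglyMeasurable_beurling hi (weightMeasure_ac t ε F),
          hb.trans_lt hfin⟩, hb,
        ⟨(measurable_maxBeurling hi).aestronglyMeasurable, hmax.trans_lt hfin⟩, hmax⟩
  · rcases weightMeasure_eq_zero_or (t := t) h1 F with h0 | hw
    · simp [h0, weakL1Norm_zero_measure]
    · have hi := integrable_indicator_of_memLp hw le_rfl hf
      have hmax := weakL1Norm_maxBeurling_le ht0 h1 h2 hF hpk hi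
      exact ⟨ae_weightMeasure_beurlingConverges hi,
        aestronglyMeasurable_beurling hi (weightMeasure_ac t ε F),
        (weakL1Norm_beurling_le hi).trans hmax,
        (measurable_maxBeurling hi).aestronglyMeasurable, hmax⟩
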